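/- Let $d\ge 2$, let $\mathbb T^d=\mathbb R^d/\mathbb Z^d$, write $\int=\int_{\mathbb T^d}$, and let $b\in W^{1,1}(\mathbb T^d;\mathbb R^d)$ be weakly divergence-free, i.e. $\int b\cdot\nabla\varphi=0$ for all $\varphi\in C^\infty(\mathbb T^d)$. (i) If $u\in L^\infty(\mathbb T^d)$ satisfies $\int u=0$ and $\int(\nabla u+bu)\cdot\nabla\varphi=0$ for all $\varphi\in C^\infty(\mathbb T^d)$, then $u=0$ almost everywhere. Here $\nabla u$ is the distributional gradient, so that the equation reads $\int(-u\,\Delta\varphi+bu\cdot\nabla\varphi)=0$; in particular, the claim holds whenever $u$ has an integrable weak gradient (for instance if $u\in H^1(\mathbb T^d)$) and the equation holds with that gradient. (ii) Consequently, approximation solutions are unique: let $p,p'\in[1,\infty]$ with $1/p+1/p'=1$, let $b\in L^p$ and let $f\in H^{-1}(\mathbb T^d)$. Then any two approximation solutions of $-\operatorname{div}(\nabla u+bu)=f$ coincide almost everywhere. Here, for a weakly divergence-free drift $a$, a function $w$ is said to solve $-\operatorname{div}(\nabla w+aw)=f$ if $\int(-w\,\Delta\varphi+aw\cdot\nabla\varphi)=(f,\varphi)$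 for all $\varphi\in C^\infty(\mathbb T^d)$ with $\int\varphi=0$. An approximation solution is a function $u\in L^{p'}$ that solves this equation with $a=b$ and for which there are weakly divergence-free $b_n\in L^\infty$ with $\|b_n-b\|_{L^p}\to0$ such that the unique solutions $u_n\in H^1(\mathbb T^d)$ with zero mean of the equation with $a=b_n$ belong to $L^{p'}$ and converge to $u$ weakly in $L^{p'}$ (weakly-$*$ if $p'=\infty$). -/

import Mathlib

open MeasureTheory Filter Topology
open scoped ContDiff ENNReal

namespace Zhikov

/-- The `d`-dimensional torus `ℝᵈ/ℤᵈ`; `volume` is its Haar probability measure. -/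
abbrev Torus (d : ℕ) : Type := UnitAddTorus (Fin d)

/-- `C^∞(𝕋ᵈ)`: the functions whose `ℤᵈ`-periodic lift to `ℝᵈ` is smooth. -/
def smoothFun (d : ℕ) : Submodule ℝ (Torus d → ℝ) where
  carrier := {φ | ContDiff ℝ ∞ fun x : Fin d → ℝ => φ fun i => (x i : UnitAddCircle)}
  add_mem' hφ hψ := by
    simp only [Set.mem_ofPred_eq] at hφ hψ ⊢
    exact hφ.add hψ
  zero_mem' := by
    simp only [Set.mem_ofPred_eq]
    exact contDiff_const
  smul_mem' c _ hφ := by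
    simp only [Set.mem_ofPred_eq] at hφ ⊢
    exact hφ.const_smul c

/-- The classical partial derivative `∂ᵢ φ` of a function on the torus. -/
noncomputable def pderiv {d : ℕ} (i : Fin d) (φ : Torus d → ℝ) (x : Torus d) : ℝ :=
  deriv (fun t : ℝ => φ (x + Pi.single i (t : UnitAddCircle))) 0

/-- The Laplacian `Δ φ = ∑ᵢ ∂ᵢ ∂ᵢ φ`. -/
noncomputable def laplacian {d : ℕ} (φ : Torus d → ℝ) (x : Torus d) : ℝ :=
  ∑ i, pderiv i (pderiv i φ) x

/-- `w` is the weak partial derivative `∂ᵢ v` (`v` and `w` are integrable where this is used). -/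
def HasWeakPDeriv {d : ℕ} (i : Fin d) (v w : Torus d → ℝ) : Prop :=
  ∀ φ ∈ smoothFun d, ∫ x, v x * pderiv i φ x = -∫ x, w x * φ x

/-- The Sobolev space `W^{1,p}(𝕋ᵈ)` of scalar functions (`1 ≤ p`). -/
def MemW1 {d : ℕ} (v : Torus d → ℝ) (p : ℝ≥0∞) : Prop :=
  MemLp v p ∧ ∀ i, ∃ w : Torus d → ℝ, MemLp w p ∧ HasWeakPDeriv i v w

/-- The weak divergence-free condition `∫ b · ∇φ = 0` for all `φ ∈ C^∞(𝕋ᵈ)`. -/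
def WeaklyDivFree {d : ℕ} (b : Torus d → EuclideanSpace ℝ (Fin d)) : Prop :=
  ∀ φ ∈ smoothFun d, ∫ x, ∑ i, b x i * pderiv i φ x = 0

/-- The form `∫ (-u Δφ + b u · ∇φ)`, that is, the distribution `-div (∇u + b u)` tested with
`φ`. -/
noncomputable def weakForm {d : ℕ} (b : Torus d → EuclideanSpace ℝ (Fin d)) (u φ : Torus d → ℝ) :
    ℝ :=
  ∫ x, (-(u x * laplacian φ x) + ∑ i, b x i * u x * pderiv i φ x)

/-- The `H^1` norm of a smooth function. -/
noncomputable def normH1 {d : ℕ} (φ : Torus d → ℝ) : ℝ :=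
  Real.sqrt (∫ x, (φ x ^ 2 + ∑ i, pderiv i φ x ^ 2))

/-- `f ∈ H^{-1}(𝕋ᵈ)`: a linear functional on `C^∞(𝕋ᵈ)` that is bounded for the `H^1` norm,
equivalently (by density) a bounded linear functional on `H^1(𝕋ᵈ)`. -/
def MemHMinusOne {d : ℕ} (f : smoothFun d →ₗ[ℝ] ℝ) : Prop :=
  ∃ C : ℝ, ∀ φ : smoothFun d, |f φ| ≤ C * normH1 (φ : Torus d → ℝ)

/-- `-div (∇u + b u) = f`, tested with all smooth functions of zero mean. -/
def SolvesZhikov {d : ℕ} (b : Torus d → EuclideanSpace ℝ (Fin d)) (f : smoothFun d →ₗ[ℝ] ℝ)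
    (u : Torus d → ℝ) : Prop :=
  ∀ φ : smoothFun d, ∫ x, (φ : Torus d → ℝ) x = 0 → weakForm b u φ = f φ

/-- Weak solutions of the Zhikov problem: `u ∈ H^1` with zero mean that solves the equation. -/
def IsWeakSolution {d : ℕ} (b : Torus d → EuclideanSpace ℝ (Fin d)) (f : smoothFun d →ₗ[ℝ] ℝ)
    (u : Torus d → ℝ) : Prop :=
  MemW1 u 2 ∧ ∫ x, u x = 0 ∧ SolvesZhikov b f u

/-- Approximation solutions of the Zhikov problem with drift `b ∈ L^p`, where `p'` is the conjugate
exponent of `p`: `u ∈ L^{p'}` solves the equation, and it is the weak limit in `L^{p'}` (weak-star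
if `p' = ∞`) of the weak solutions `un n` for bounded divergence-free drifts `bn n` that converge
to `b` in `L^p`. -/
def IsApproximationSolution {d : ℕ} (p p' : ℝ≥0∞) (b : Torus d → EuclideanSpace ℝ (Fin d))
    (f : smoothFun d →ₗ[ℝ] ℝ) (u : Torus d → ℝ) : Prop :=
  MemLp u p' ∧ SolvesZhikov b f u ∧
    ∃ (bn : ℕ → Torus d → EuclideanSpace ℝ (Fin d)) (un : ℕ → Torus d → ℝ),
      (∀ n, MemLp (bn n) ∞ ∧ WeaklyDivFree (bn n)) ∧
      (∀ n, IsWeakSolution (bn n) f (un n) ∧ MemLp (un n) p') ∧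
      Tendsto (fun n => eLpNorm (bn n - b) p volume) atTop (𝓝 0) ∧
      ∀ ψ : Torus d → ℝ, MemLp ψ p →
        Tendsto (fun n => ∫ x, un n x * ψ x) atTop (𝓝 (∫ x, u x * ψ x))

end Zhikov

namespace Zhikov

/-! Part (i). Formally one tests the equation with `u`: the drift term ∫ b u · ∇u = ½ ∫ b · ∇(u²)
vanishes and ∫ |∇u|² = 0 remains. Since `u` is only bounded, it is tested with the convolution f * u
instead, where `f` is an even kernel with nonnegative cosine coefficients. On the Fourier side the
elliptic term becomes a sum of nonnegative contributions, so it dominates each single mode without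
any regularity of `u` (`energy_lower_bound`). Because ∂ⱼf is odd, symmetrization turns the drift
term into −½ ∑ⱼ ∫ ∂ⱼf(z) ∫ (bⱼ(x) − bⱼ(x−z)) u(x) u(x−z) dx dz (`integral_convolution_odd`). For a
concentrating `f` this is a DiPerna–Lions commutator: the first-order expansion of `b` in L¹
(`abs_integral_taylor_le`, `exists_commutator_bound`) shows that it tends to ½ ∫ (div b) u² = 0
(`tendsto_integral_pderiv_commutator`). Hence every nonconstant mode of `u` vanishes. The kernel is
the normalized power ∏ₖ cos²(πxₖ)^N, a trigonometric polynomial with nonnegative coefficients whose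
moments follow from integrations by parts. A term `l * u` with `l ≥ 0` is carried along for the
second part.

Part (ii). This is a duality argument. For a bounded divergence-free drift the transport form is
skew, so the energy bounds do not see the drift, and the approximating solutions converge in L²
along a subsequence. For bounded `F` of zero mean and `l > 0`, let `v` solve the adjoint problem l v
− Δv + bₙ · ∇v = F. The maximum principle gives |v| ≤ sup|F| / l, so the limit in `n` is a bounded
distributional solution for the drift `b`, and by the method of (i) it is unique: it does not depend
on the approximating sequence. Passing to the limit in the duality identity gives (F, u) = (r, v) +
l (v, u), with `r` representing `f`. For two approximation solutions this yields (F, u₁ − u₂) = l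
(v, u₁ − u₂). As ‖v‖ ≤ ‖F‖ uniformly in `l` by Poincaré, l → 0 gives (F, u₁ − u₂) = 0. -/

variable {d : ℕ}

/-! ### Calculus of smooth functions on the torus -/

/-- The covering map `ℝᵈ → 𝕋ᵈ`. -/
def toTorus (x : Fin d → ℝ) : Torus d := fun i => (x i : UnitAddCircle)

theorem mem_smoothFun {φ : Torus d → ℝ} :
    φ ∈ smoothFun d ↔ ContDiff ℝ ∞ fun x : Fin d → ℝ => φ (toTorus x) := Iff.rfl

theorem toTorus_add (x y : Fin d → ℝ) : toTorus (x + y) = toTorus x + toTorus y := rfl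

theorem toTorus_zero : toTorus (0 : Fin d → ℝ) = 0 := rfl

theorem toTorus_neg (x : Fin d → ℝ) : toTorus (-x) = -toTorus x := rfl

theorem toTorus_single (i : Fin d) (t : ℝ) :
    toTorus (Pi.single i t) = Pi.single i (t : UnitAddCircle) := by
  funext j
  by_cases h : j = i
  · subst h; simp [toTorus]
  · simp [toTorus, h]

theorem isOpenQuotientMap_toTorus : IsOpenQuotientMap (toTorus (d := d)) :=
  IsOpenQuotientMap.piMap (f := fun _ : Fin d => ((↑) : ℝ → UnitAddCircle))
    fun _ => QuotientAddGroup.isOpenQuotientMap_mk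

/-- Rounding each coordinate gives the representative. The bound 1/2 is what later makes the
comparisons between `t k` and sin(π `t k`) valid. -/
theorem exists_toTorus (z : Torus d) : ∃ t : Fin d → ℝ, (∀ i, |t i| ≤ 1 / 2) ∧ toTorus t = z := by
  have h : ∀ i, ∃ s : ℝ, |s| ≤ 1 / 2 ∧ (s : UnitAddCircle) = z i := fun i => by
    obtain ⟨s, hs⟩ := QuotientAddGroup.mk_surjective (z i)
    refine ⟨s - round s, abs_sub_round s, ?_⟩
    rw [← hs]
    refine (QuotientAddGroup.eq_iff_sub_mem).2 ?_
    rw [AddSubgroup.mem_zmultiples_iff]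
    exact ⟨-round s, by simp⟩
  choose t h1 h2 using h
  exact ⟨t, h1, funext h2⟩

theorem continuous_of_mem {φ : Torus d → ℝ} (h : φ ∈ smoothFun d) : Continuous φ :=
  isOpenQuotientMap_toTorus.isQuotientMap.continuous_iff.2 (mem_smoothFun.1 h).continuous

theorem const_mem (c : ℝ) : (fun _ => c) ∈ smoothFun d := mem_smoothFun.2 contDiff_const

theorem mul_mem {φ ψ : Torus d → ℝ} (h : φ ∈ smoothFun d) (h' : ψ ∈ smoothFun d) :
    (fun x => φ x * ψ x) ∈ smoothFun d :=
  mem_smoothFun.2 ((mem_smoothFun.1 h).mul (mem_smoothFun.1 h'))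

theorem comp_mem {φ : Torus d → ℝ} (h : φ ∈ smoothFun d) {G : ℝ → ℝ} (hG : ContDiff ℝ ∞ G) :
    (fun x => G (φ x)) ∈ smoothFun d :=
  mem_smoothFun.2 (hG.comp (mem_smoothFun.1 h))

theorem hasDerivAt_toTorus {φ : Torus d → ℝ} (h : φ ∈ smoothFun d) (y τ : Fin d → ℝ) (t : ℝ) :
    HasDerivAt (fun s : ℝ => φ (toTorus y + toTorus (s • τ)))
      (fderiv ℝ (fun x => φ (toTorus x)) (y + t • τ) τ) t := by
  have h1 : HasFDerivAt (fun x : Fin d → ℝ => φ (toTorus x))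
      (fderiv ℝ (fun x => φ (toTorus x)) (y + t • τ)) (y + t • τ) :=
    ((mem_smoothFun.1 h).differentiable (by simp)).differentiableAt.hasFDerivAt
  have h2 : HasDerivAt (fun s : ℝ => y + s • τ) τ t := by
    simpa using ((hasDerivAt_id t).smul_const τ).const_add y
  exact h1.comp_hasDerivAt t h2

theorem pderiv_toTorus {φ : Torus d → ℝ} (h : φ ∈ smoothFun d) (i : Fin d) (y : Fin d → ℝ) :
    pderiv i φ (toTorus y) = fderiv ℝ (fun x => φ (toTorus x)) y (Pi.single i 1) := by
  have := (hasDerivAt_toTorus h y (Pi.single i 1) 0).deriv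
  simp only [zero_smul, add_zero] at this
  rw [← this]
  simp only [pderiv, ← toTorus_single, ← Pi.single_smul, smul_eq_mul, mul_one]

theorem pderiv_mem {φ : Torus d → ℝ} (h : φ ∈ smoothFun d) (i : Fin d) :
    pderiv i φ ∈ smoothFun d := by
  rw [mem_smoothFun]
  simp_rw [pderiv_toTorus h i]
  exact ((mem_smoothFun.1 h).fderiv_right (m := ∞) (by simp)).clm_apply contDiff_const

theorem continuous_pderiv {φ : Torus d → ℝ} (h : φ ∈ smoothFun d) (i : Fin d) :
    Continuous (pderiv i φ) := continuous_of_mem (pderiv_mem h i)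

/-- The derivative of a smooth function along a line. -/
theorem hasDerivAt_line {φ : Torus d → ℝ} (h : φ ∈ smoothFun d) (x : Torus d) (τ : Fin d → ℝ)
    (t : ℝ) :
    HasDerivAt (fun s : ℝ => φ (x + toTorus (s • τ)))
      (∑ k, τ k * pderiv k φ (x + toTorus (t • τ))) t := by
  obtain ⟨y, -, rfl⟩ := exists_toTorus x
  convert hasDerivAt_toTorus h y τ t using 1
  simp_rw [← toTorus_add, pderiv_toTorus h]
  have e : τ = ∑ k, τ k • (Pi.single k 1 : Fin d → ℝ) := pi_eq_sum_univ' τ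
  generalize fderiv ℝ (fun x => φ (toTorus x)) (y + t • τ) = L
  conv_rhs => rw [e]
  simp only [map_sum, map_smul, smul_eq_mul]

theorem hasDerivAt_pderiv {φ : Torus d → ℝ} (h : φ ∈ smoothFun d) (x : Torus d) (i : Fin d) :
    HasDerivAt (fun t : ℝ => φ (x + Pi.single i (t : UnitAddCircle))) (pderiv i φ x) 0 := by
  have := hasDerivAt_line h x (Pi.single i 1) 0
  have h2 := this.differentiableAt.hasDerivAt
  simp only [← Pi.single_smul, smul_eq_mul, mul_one, toTorus_single] at h2
  exact h2

theorem pderiv_eq {φ : Torus d → ℝ} {x : Torus d} {i : Fin d} {c : ℝ}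
    (h : HasDerivAt (fun t : ℝ => φ (x + Pi.single i (t : UnitAddCircle))) c 0) :
    pderiv i φ x = c := h.deriv

theorem pderiv_const (i : Fin d) (c : ℝ) : pderiv i (fun _ => c) = 0 := by
  funext x
  exact pderiv_eq (hasDerivAt_const _ _)

theorem add_single_zero (x : Torus d) (i : Fin d) :
    x + Pi.single i ((0 : ℝ) : UnitAddCircle) = x := by
  simp

theorem pderiv_add {φ ψ : Torus d → ℝ} (h : φ ∈ smoothFun d) (h' : ψ ∈ smoothFun d) (i : Fin d) :
    pderiv i (φ + ψ) = pderiv i φ + pderiv i ψ := by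
  funext x
  exact pderiv_eq ((hasDerivAt_pderiv h x i).add (hasDerivAt_pderiv h' x i))

theorem pderiv_smul {φ : Torus d → ℝ} (h : φ ∈ smoothFun d) (c : ℝ) (i : Fin d) :
    pderiv i (c • φ) = c • pderiv i φ := by
  funext x
  exact pderiv_eq ((hasDerivAt_pderiv h x i).const_smul c)

theorem pderiv_sum {ι : Type*} (s : Finset ι) {φ : ι → Torus d → ℝ}
    (h : ∀ j ∈ s, φ j ∈ smoothFun d) (i : Fin d) :
    pderiv i (fun x => ∑ j ∈ s, φ j x) = fun x => ∑ j ∈ s, pderiv i (φ j) x := by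
  funext x
  exact pderiv_eq (HasDerivAt.fun_sum fun j hj => hasDerivAt_pderiv (h j hj) x i)

theorem pderiv_const_mul {φ : Torus d → ℝ} (h : φ ∈ smoothFun d) (c : ℝ) (i : Fin d) :
    pderiv i (fun x => c * φ x) = fun x => c * pderiv i φ x :=
  pderiv_smul h c i

theorem pderiv_mul {φ ψ : Torus d → ℝ} (h : φ ∈ smoothFun d) (h' : ψ ∈ smoothFun d) (i : Fin d) :
    pderiv i (fun x => φ x * ψ x) = fun x => pderiv i φ x * ψ x + φ x * pderiv i ψ x := by
  funext x
  have := (hasDerivAt_pderiv h x i).mul (hasDerivAt_pderiv h' x i)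
  rw [add_single_zero] at this
  exact pderiv_eq this

theorem pderiv_comp {φ : Torus d → ℝ} (h : φ ∈ smoothFun d) {G : ℝ → ℝ} (hG : ContDiff ℝ ∞ G)
    (i : Fin d) :
    pderiv i (fun x => G (φ x)) = fun x => deriv G (φ x) * pderiv i φ x := by
  funext x
  have h1 : HasDerivAt G (deriv G (φ x)) (φ (x + Pi.single i ((0 : ℝ) : UnitAddCircle))) := by
    rw [add_single_zero]
    exact (hG.differentiable (by simp) _).hasDerivAt
  exact pderiv_eq (h1.comp 0 (hasDerivAt_pderiv h x i))

theorem bounded_of_continuous {φ : Torus d → ℝ} (h : Continuous φ) :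
    ∃ C, 0 ≤ C ∧ ∀ x, |φ x| ≤ C := by
  obtain ⟨C, hC⟩ := isCompact_univ.exists_bound_of_continuousOn (f := φ) h.continuousOn
  exact ⟨max C 0, le_max_right _ _, fun x => (hC x trivial).trans (le_max_left _ _)⟩

theorem integrable_of_continuous {φ : Torus d → ℝ} (h : Continuous φ) : Integrable φ := by
  obtain ⟨C, -, hC⟩ := bounded_of_continuous h
  exact (integrable_const C).mono' h.aestronglyMeasurable (Eventually.of_forall hC)

theorem integrable_mul_continuous {f φ : Torus d → ℝ} (hf : Integrable f) (h : Continuous φ) :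
    Integrable fun x => f x * φ x := by
  obtain ⟨C, -, hC⟩ := bounded_of_continuous h
  exact hf.mul_bdd h.aestronglyMeasurable (Eventually.of_forall hC)

/-- Differentiation of `t ↦ ∫ f(x) φ(x + tτ) dx`. -/
theorem hasDerivAt_integral_line {f φ : Torus d → ℝ} (hf : Integrable f) (h : φ ∈ smoothFun d)
    (τ : Fin d → ℝ) (t : ℝ) :
    HasDerivAt (fun s : ℝ => ∫ x, f x * φ (x + toTorus (s • τ)))
      (∑ k, τ k * ∫ x, f x * pderiv k φ (x + toTorus (t • τ))) t := by
  have hc : ∀ (ψ : Torus d → ℝ) (s : ℝ), Continuous ψ →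
      Continuous fun x => ψ (x + toTorus (s • τ)) := fun ψ s hψ =>
    hψ.comp (continuous_id.add continuous_const)
  have hcd : Continuous fun x => ∑ k, τ k * pderiv k φ x :=
    continuous_finsetSum _ fun k _ => continuous_const.mul (continuous_pderiv h k)
  obtain ⟨C, -, hC⟩ := bounded_of_continuous hcd
  have := (hasDerivAt_integral_of_dominated_loc_of_deriv_le (μ := volume)
    (F := fun s x => f x * φ (x + toTorus (s • τ)))
    (F' := fun s x => f x * ∑ k, τ k * pderiv k φ (x + toTorus (s • τ)))
    (x₀ := t) (bound := fun x => ‖f x‖ * C) (s := Set.univ) Filter.univ_mem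
    (Eventually.of_forall fun s =>
      (integrable_mul_continuous hf (hc _ s (continuous_of_mem h))).aestronglyMeasurable)
    (integrable_mul_continuous hf (hc _ t (continuous_of_mem h)))
    (integrable_mul_continuous hf (hc _ t hcd)).aestronglyMeasurable
    (Eventually.of_forall fun x s _ => by
      rw [norm_mul]
      exact mul_le_mul_of_nonneg_left (hC _) (norm_nonneg _))
    (hf.norm.mul_const C)
    (Eventually.of_forall fun x s _ => (hasDerivAt_line h x τ s).const_mul (f x))).2
  have e : ∑ k, τ k * ∫ x, f x * pderiv k φ (x + toTorus (t • τ))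
      = ∫ x, f x * ∑ k, τ k * pderiv k φ (x + toTorus (t • τ)) := by
    simp_rw [Finset.mul_sum]
    rw [integral_finsetSum]
    · refine Finset.sum_congr rfl fun k _ => ?_
      rw [← integral_const_mul]
      exact integral_congr_ae (Eventually.of_forall fun x => by ring)
    · intro k _
      exact integrable_mul_continuous hf (continuous_const.mul (hc _ t (continuous_pderiv h k)))
  rw [e]
  exact this

/-- By translation invariance the function t ↦ ∫ φ(x + t eᵢ) dx is constant; its derivative at 0 is
the integral in question. -/
theorem integral_pderiv {φ : Torus d → ℝ} (h : φ ∈ smoothFun d) (i : Fin d) :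
    ∫ x, pderiv i φ x = 0 := by
  have h1 := hasDerivAt_integral_line (integrable_const (1 : ℝ)) h (Pi.single i 1) 0
  have e : ∀ s : ℝ, ∫ x, (1 : ℝ) * φ (x + toTorus (s • Pi.single i 1)) = ∫ x, φ x := fun s => by
    refine (integral_congr_ae (Eventually.of_forall fun x => one_mul _)).trans ?_
    exact integral_add_right_eq_self φ _
  rw [funext e] at h1
  have h2 := h1.unique (hasDerivAt_const _ _)
  simpa [Pi.single_apply, toTorus_zero] using h2

/-- Integration by parts on the torus. -/
theorem integral_mul_pderiv {φ ψ : Torus d → ℝ} (h : φ ∈ smoothFun d) (h' : ψ ∈ smoothFun d)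
    (i : Fin d) : ∫ x, φ x * pderiv i ψ x = -∫ x, pderiv i φ x * ψ x := by
  have h1 := integral_pderiv (mul_mem h h') i
  rw [pderiv_mul h h', integral_add] at h1
  · linarith
  · exact integrable_of_continuous ((continuous_pderiv h i).mul (continuous_of_mem h'))
  · exact integrable_of_continuous ((continuous_of_mem h).mul (continuous_pderiv h' i))

/-! ### Trigonometric polynomials and their density -/

/-- The real part `x ↦ cos (2π n · x)` of a character. -/
noncomputable def cosT (n : Fin d → ℤ) (x : Torus d) : ℝ := (UnitAddTorus.mFourier n x).re

/-- The imaginary part `x ↦ sin (2π n · x)` of a character. -/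
noncomputable def sinT (n : Fin d → ℤ) (x : Torus d) : ℝ := (UnitAddTorus.mFourier n x).im

theorem mFourier_toTorus (n : Fin d → ℤ) (y : Fin d → ℝ) :
    UnitAddTorus.mFourier n (toTorus y)
      = Complex.exp ((2 * Real.pi * ∑ i, n i * y i : ℝ) * Complex.I) := by
  simp only [UnitAddTorus.mFourier, toTorus, ContinuousMap.coe_mk, fourier_coe_apply]
  rw [← Complex.exp_sum]
  congr 1
  push_cast
  rw [Finset.mul_sum, Finset.sum_mul]
  refine Finset.sum_congr rfl fun i _ => ?_
  simp
  ring

theorem cosT_toTorus (n : Fin d → ℤ) (y : Fin d → ℝ) :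
    cosT n (toTorus y) = Real.cos (2 * Real.pi * ∑ i, n i * y i) := by
  rw [cosT, mFourier_toTorus, Complex.exp_ofReal_mul_I_re]

theorem sinT_toTorus (n : Fin d → ℤ) (y : Fin d → ℝ) :
    sinT n (toTorus y) = Real.sin (2 * Real.pi * ∑ i, n i * y i) := by
  rw [sinT, mFourier_toTorus, Complex.exp_ofReal_mul_I_im]

theorem cosT_zero (x : Torus d) : cosT 0 x = 1 := by
  simp [cosT, UnitAddTorus.mFourier_zero]

theorem sinT_zero (x : Torus d) : sinT 0 x = 0 := by
  simp [sinT, UnitAddTorus.mFourier_zero]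

theorem cosT_apply_zero (n : Fin d → ℤ) : cosT n (0 : Torus d) = 1 := by
  simp [← toTorus_zero, cosT_toTorus]

theorem cosT_neg (n : Fin d → ℤ) (x : Torus d) : cosT n (-x) = cosT n x := by
  obtain ⟨y, -, rfl⟩ := exists_toTorus x
  rw [← toTorus_neg, cosT_toTorus, cosT_toTorus]
  simp

theorem sinT_sub (n : Fin d → ℤ) (x y : Torus d) :
    sinT n (x - y) = sinT n x * cosT n y - cosT n x * sinT n y := by
  obtain ⟨x, -, rfl⟩ := exists_toTorus x
  obtain ⟨y, -, rfl⟩ := exists_toTorus y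
  rw [sub_eq_add_neg, ← toTorus_neg, ← toTorus_add]
  simp only [cosT_toTorus, sinT_toTorus]
  rw [← Real.sin_sub]
  congr 1
  simp only [Pi.add_apply, Pi.neg_apply, mul_add, Finset.sum_add_distrib, mul_neg,
    Finset.sum_neg_distrib]
  ring

theorem cosT_mul_cosT (n m : Fin d → ℤ) (x : Torus d) :
    cosT n x * cosT m x = (cosT (n + m) x + cosT (n - m) x) / 2 := by
  obtain ⟨x, -, rfl⟩ := exists_toTorus x
  simp only [cosT_toTorus, Pi.add_apply, Pi.sub_apply, Int.cast_add, Int.cast_sub, add_mul, sub_mul,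
    Finset.sum_add_distrib, Finset.sum_sub_distrib, mul_add, mul_sub, Real.cos_add, Real.cos_sub]
  ring

theorem cosT_sq_add_sinT_sq (n : Fin d → ℤ) (x : Torus d) : cosT n x ^ 2 + sinT n x ^ 2 = 1 := by
  obtain ⟨x, -, rfl⟩ := exists_toTorus x
  rw [cosT_toTorus, sinT_toTorus, Real.cos_sq_add_sin_sq]

theorem abs_cosT_le (n : Fin d → ℤ) (x : Torus d) : |cosT n x| ≤ 1 :=
  abs_le_one_iff_mul_self_le_one.2 (by nlinarith [cosT_sq_add_sinT_sq n x, sq_nonneg (sinT n x)])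

theorem cosT_mem (n : Fin d → ℤ) : cosT n ∈ smoothFun d := by
  rw [mem_smoothFun]
  simp_rw [cosT_toTorus]
  fun_prop

theorem sinT_mem (n : Fin d → ℤ) : sinT n ∈ smoothFun d := by
  rw [mem_smoothFun]
  simp_rw [sinT_toTorus]
  fun_prop

theorem hasDerivAt_phase (n : Fin d → ℤ) (y : Fin d → ℝ) (i : Fin d) :
    HasDerivAt (fun t : ℝ => 2 * Real.pi * ∑ j, n j * (y + (Pi.single i t : Fin d → ℝ)) j)
      (2 * Real.pi * n i) 0 := by
  have : (fun t : ℝ => 2 * Real.pi * ∑ j, n j * (y + (Pi.single i t : Fin d → ℝ)) j)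
      = fun t => 2 * Real.pi * (∑ j, n j * y j + n i * t) := by
    funext t
    simp [mul_add, Finset.sum_add_distrib, Pi.single_apply]
  rw [this]
  simpa using (((hasDerivAt_id (0 : ℝ)).const_mul (n i : ℝ)).const_add _).const_mul (2 * Real.pi)

theorem pderiv_cosT (n : Fin d → ℤ) (i : Fin d) :
    pderiv i (cosT n) = fun x => -(2 * Real.pi * n i * sinT n x) := by
  funext x
  obtain ⟨y, -, rfl⟩ := exists_toTorus x
  refine pderiv_eq ?_
  simp_rw [← toTorus_single, ← toTorus_add, cosT_toTorus, sinT_toTorus]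
  convert (hasDerivAt_phase n y i).cos using 1
  simp
  ring

theorem pderiv_sinT (n : Fin d → ℤ) (i : Fin d) :
    pderiv i (sinT n) = fun x => 2 * Real.pi * n i * cosT n x := by
  funext x
  obtain ⟨y, -, rfl⟩ := exists_toTorus x
  refine pderiv_eq ?_
  simp_rw [← toTorus_single, ← toTorus_add, cosT_toTorus, sinT_toTorus]
  convert (hasDerivAt_phase n y i).sin using 1
  simp
  ring

theorem laplacian_cosT (n : Fin d → ℤ) (x : Torus d) :
    laplacian (cosT n) x = -(4 * Real.pi ^ 2 * ∑ i, (n i : ℝ) ^ 2) * cosT n x := by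
  simp only [laplacian]
  rw [Finset.mul_sum, ← Finset.sum_neg_distrib, Finset.sum_mul]
  refine Finset.sum_congr rfl fun i _ => ?_
  have : pderiv i (cosT n) = fun x => (-(2 * Real.pi * n i)) * sinT n x := by
    rw [pderiv_cosT]; funext x; ring
  rw [this, pderiv_const_mul (sinT_mem n), pderiv_sinT]
  ring

theorem laplacian_sinT (n : Fin d → ℤ) (x : Torus d) :
    laplacian (sinT n) x = -(4 * Real.pi ^ 2 * ∑ i, (n i : ℝ) ^ 2) * sinT n x := by
  simp only [laplacian]
  rw [Finset.mul_sum, ← Finset.sum_neg_distrib, Finset.sum_mul]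
  refine Finset.sum_congr rfl fun i _ => ?_
  rw [pderiv_sinT, pderiv_const_mul (cosT_mem n), pderiv_cosT]
  ring

/-- Real trigonometric polynomials. -/
def trig (d : ℕ) : Submodule ℝ (Torus d → ℝ) :=
  Submodule.span ℝ (Set.range cosT ∪ Set.range sinT)

theorem cosT_mem_trig (n : Fin d → ℤ) : cosT n ∈ trig d :=
  Submodule.subset_span (Or.inl ⟨n, rfl⟩)

theorem sinT_mem_trig (n : Fin d → ℤ) : sinT n ∈ trig d :=
  Submodule.subset_span (Or.inr ⟨n, rfl⟩)

theorem trig_le : trig d ≤ smoothFun d := by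
  refine Submodule.span_le.2 ?_
  rintro _ (⟨n, rfl⟩ | ⟨n, rfl⟩)
  · exact cosT_mem n
  · exact sinT_mem n

theorem exists_trig_near {g : Torus d → ℝ} (hg : Continuous g) {ε : ℝ} (hε : 0 < ε) :
    ∃ φ ∈ trig d, ∀ x, |φ x - g x| ≤ ε := by
  let G : C(Torus d, ℂ) := ⟨fun x => (g x : ℂ), by fun_prop⟩
  have hG : G ∈ (Submodule.span ℂ (Set.range (UnitAddTorus.mFourier (d := Fin d)))
      ).topologicalClosure := by
    rw [UnitAddTorus.span_mFourier_closure_eq_top]; trivial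
  obtain ⟨P, hP, hPG⟩ := Metric.mem_closure_iff.1 hG ε hε
  refine ⟨fun x => (P x).re, ?_, fun x => ?_⟩
  · clear hPG
    -- Multiplication by a complex scalar mixes real and imaginary parts, so the induction has to
    -- carry both.
    suffices h : (fun x => (P x).re) ∈ trig d ∧ (fun x => (P x).im) ∈ trig d from h.1
    refine Submodule.span_induction (p := fun P _ => (fun x => (P x).re) ∈ trig d ∧
      (fun x => (P x).im) ∈ trig d) ?_ ?_ ?_ ?_ hP
    · rintro _ ⟨n, rfl⟩
      exact ⟨cosT_mem_trig n, sinT_mem_trig n⟩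
    · exact ⟨(trig d).zero_mem, (trig d).zero_mem⟩
    · intro P Q _ _ h1 h2
      exact ⟨(trig d).add_mem h1.1 h2.1, (trig d).add_mem h1.2 h2.2⟩
    · intro a P _ h
      constructor
      · convert (trig d).sub_mem ((trig d).smul_mem a.re h.1) ((trig d).smul_mem a.im h.2) using 1
        funext x
        simp
      · convert (trig d).add_mem ((trig d).smul_mem a.re h.2) ((trig d).smul_mem a.im h.1) using 1
        funext x
        simp
  · have h1 : ‖(G - P) x‖ ≤ ε := ((G - P).norm_coe_le_norm x).trans (by
      rw [← dist_eq_norm]; exact hPG.le)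
    have h2 : (P x).re - g x = -((G - P) x).re := by simp [G]
    rw [h2, abs_neg]
    exact (Complex.abs_re_le_norm _).trans h1

/-- The total variation bound of an integrable density can be tested with trigonometric
polynomials. -/
theorem abs_integral_mul_le {H : Torus d → ℝ} (hH : Integrable H) {c : ℝ} (hc : 0 ≤ c)
    (h : ∀ φ ∈ trig d, ∀ M, (∀ x, |φ x| ≤ M) → |∫ x, H x * φ x| ≤ c * M)
    {G : Torus d → ℝ} (hG : AEStronglyMeasurable G) {M : ℝ} (hM : ∀ᵐ x, |G x| ≤ M) :
    |∫ x, H x * G x| ≤ c * M := by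
  have hM0 : 0 ≤ M := by
    obtain ⟨x, hx⟩ := hM.exists
    exact (abs_nonneg _).trans hx
  have hcont : ∀ g : Torus d → ℝ, Continuous g → (∀ x, |g x| ≤ M) →
      |∫ x, H x * g x| ≤ c * M := by
    intro g hg hgM
    refine le_of_forall_pos_le_add fun ε hε => ?_
    set K := c + ∫ x, |H x| with hK
    have hK0 : 0 ≤ K := add_nonneg hc (integral_nonneg fun _ => abs_nonneg _)
    -- Replacing `g` by `φ` costs at most `c + ∫ |H|` times the uniform error: once through the
    -- larger sup bound of `φ`, once through the difference of the integrals.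
    obtain ⟨φ, hφ, hφg⟩ := exists_trig_near hg (ε := ε / (K + 1)) (by positivity)
    have h1 := h φ hφ (M + ε / (K + 1)) fun x => by
      have := abs_add_le (g x) (φ x - g x)
      rw [add_sub_cancel] at this
      linarith [hφg x, hgM x]
    have hφc := continuous_of_mem (trig_le hφ)
    have h2 : |∫ x, H x * (φ x - g x)| ≤ ∫ x, |H x| * (ε / (K + 1)) := by
      refine (abs_integral_le_integral_abs).trans (integral_mono_of_nonneg
        (Eventually.of_forall fun _ => abs_nonneg _) (hH.abs.mul_const _)
        (Eventually.of_forall fun x => ?_))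
      simp only [abs_mul]
      exact mul_le_mul_of_nonneg_left (hφg x) (abs_nonneg _)
    rw [integral_mul_const] at h2
    have h3 : ∫ x, H x * g x = (∫ x, H x * φ x) - ∫ x, H x * (φ x - g x) := by
      rw [← integral_sub (integrable_mul_continuous hH hφc)
        (by exact integrable_mul_continuous hH (hφc.sub hg))]
      exact integral_congr_ae (Eventually.of_forall fun x => by ring)
    rw [h3]
    have h4 : (c + ∫ x, |H x|) * (ε / (K + 1)) ≤ ε := by
      rw [← hK, ← mul_div_assoc, div_le_iff₀ (by positivity)]
      nlinarith
    have := abs_sub (∫ x, H x * φ x) (∫ x, H x * (φ x - g x))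
    nlinarith
  -- Approximating `G` in L¹ of the measure |H| dx controls the integral against `H` directly.
  -- Truncation at ±M restores the sup bound and, being 1-Lipschitz and fixing `G`, does not
  -- increase the error.
  set ν : Measure (Torus d) := volume.withDensity fun x => ‖H x‖ₑ with hν
  have hνac : ν ≪ volume := withDensity_absolutelyContinuous _ _
  have : IsFiniteMeasure ν := isFiniteMeasure_withDensity hH.2.ne
  have hGν : Integrable G ν :=
    (integrable_const M).mono' (hG.mono_ac hνac) (hνac.ae_le hM)
  refine le_of_forall_pos_le_add fun ε hε => ?_
  obtain ⟨g0, hg0, -⟩ := hGν.exists_boundedContinuous_integral_sub_le hε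
  set g : Torus d → ℝ := fun x => max (-M) (min M (g0 x)) with hgdef
  have hgc : Continuous g := by fun_prop
  have hgM : ∀ x, |g x| ≤ M := fun x =>
    abs_le.2 ⟨le_max_left _ _, max_le (by linarith) (min_le_left _ _)⟩
  have hgG : ∀ᵐ x, |G x - g x| ≤ |G x - g0 x| := by
    filter_upwards [hM] with x hx
    have e : G x = max (-M) (min M (G x)) := by
      rw [min_eq_right (abs_le.1 hx).2, max_eq_right (abs_le.1 hx).1]
    calc |G x - g x| = |max (-M) (min M (G x)) - max (-M) (min M (g0 x))| := by rw [← e]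
      _ ≤ |min M (G x) - min M (g0 x)| := by
        simpa using abs_max_sub_max_le_max (-M) (min M (G x)) (-M) (min M (g0 x))
      _ ≤ |G x - g0 x| := by
        simpa using abs_min_sub_min_le_max M (G x) M (g0 x)
  have hHG : Integrable fun x => H x * G x := hH.mul_bdd hG hM
  have h5 : ∫ x, |H x| * |G x - g0 x| = ∫ x, ‖G x - g0 x‖ ∂ν := by
    rw [hν, integral_withDensity_eq_integral_toReal_smul₀ hH.1.enorm
      (Eventually.of_forall fun _ => enorm_lt_top)]
    simp
  have h6 : |∫ x, H x * (G x - g x)| ≤ ε := by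
    refine le_trans ?_ (h5.trans_le hg0)
    refine abs_integral_le_integral_abs.trans (integral_mono_of_nonneg
      (Eventually.of_forall fun _ => abs_nonneg _) ?_ ?_)
    · have : Integrable fun x => H x * (G x - g0 x) := by
        simp_rw [mul_sub]
        exact hHG.sub (integrable_mul_continuous hH g0.continuous)
      simpa [abs_mul] using this.abs
    · filter_upwards [hgG] with x hx
      simp only [abs_mul]
      exact mul_le_mul_of_nonneg_left hx (abs_nonneg _)
  have h7 : ∫ x, H x * G x = (∫ x, H x * g x) + ∫ x, H x * (G x - g x) := by
    simp_rw [mul_sub]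
    rw [integral_sub hHG (integrable_mul_continuous hH hgc)]
    ring
  rw [h7]
  exact (abs_add_le _ _).trans (add_le_add (hcont g hgc hgM) h6)

/-- An integrable function is determined by its integrals against trigonometric polynomials. -/
theorem ae_eq_zero_of_trig {H : Torus d → ℝ} (hH : Integrable H)
    (h : ∀ φ ∈ trig d, ∫ x, H x * φ x = 0) : H =ᵐ[volume] 0 := by
  -- With `c = 0` every bounded weight integrates to zero against `H`; the weight sign(H) gives ∫
  -- |H| = 0.
  have h1 := abs_integral_mul_le hH le_rfl (c := 0) (fun φ hφ M _ => by simp [h φ hφ])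
    (G := fun x => SignType.sign (H x)) (M := 1) ?_ ?_
  · have h2 : ∫ x, |H x| = 0 := by
      rw [zero_mul, abs_nonpos_iff] at h1
      rw [← h1]
      exact integral_congr_ae (Eventually.of_forall fun x => by simp [self_mul_sign])
    have := (integral_eq_zero_iff_of_nonneg (fun _ => abs_nonneg _) hH.abs).1 h2
    filter_upwards [this] with x hx
    simpa using hx
  · have : Measurable fun y : ℝ => ((SignType.sign y : SignType) : ℝ) := by
      have e : (fun y : ℝ => ((SignType.sign y : SignType) : ℝ))
          = fun y => if 0 < y then 1 else if y < 0 then -1 else 0 := by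
        funext y
        simp only [sign_apply]
        split_ifs <;> simp
      rw [e]
      exact Measurable.ite measurableSet_Ioi measurable_const
        (Measurable.ite measurableSet_Iio measurable_const measurable_const)
    exact (this.comp_aemeasurable hH.1.aemeasurable).aestronglyMeasurable
  · refine Eventually.of_forall fun x => ?_
    rcases lt_trichotomy (H x) 0 with h | h | h <;> simp [h]

theorem ae_eq_zero_of_cosT_sinT {H : Torus d → ℝ} (hH : Integrable H)
    (hc : ∀ n, ∫ x, H x * cosT n x = 0) (hs : ∀ n, ∫ x, H x * sinT n x = 0) :
    H =ᵐ[volume] 0 := by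
  refine ae_eq_zero_of_trig hH fun φ hφ => ?_
  refine (Submodule.span_induction (p := fun φ _ => Continuous φ ∧ ∫ x, H x * φ x = 0)
    ?_ ?_ ?_ ?_ hφ).2
  · rintro _ (⟨n, rfl⟩ | ⟨n, rfl⟩)
    · exact ⟨continuous_of_mem (cosT_mem n), hc n⟩
    · exact ⟨continuous_of_mem (sinT_mem n), hs n⟩
  · exact ⟨continuous_const, by simp⟩
  · intro φ ψ _ _ h1 h2
    refine ⟨h1.1.add h2.1, ?_⟩
    simp only [Pi.add_apply, mul_add]
    rw [integral_add (integrable_mul_continuous hH h1.1) (integrable_mul_continuous hH h2.1),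
      h1.2, h2.2, add_zero]
  · intro a φ _ h1
    refine ⟨h1.1.const_smul a, ?_⟩
    simp only [Pi.smul_apply, smul_eq_mul, mul_left_comm, integral_const_mul, h1.2, mul_zero]

/-! ### A periodic distance function and the moments of the kernel -/

/-- `x ↦ sin² (π xₖ)`. -/
noncomputable def sinSq (k : Fin d) (x : Torus d) : ℝ := (1 - cosT (Pi.single k 1) x) / 2

/-- `x ↦ sin (2π xₖ) / (2π)`. -/
noncomputable def sinCoord (k : Fin d) (x : Torus d) : ℝ := sinT (Pi.single k 1) x / (2 * Real.pi)

/-- `∑ₖ sin² (π xₖ)`, which is comparable to the squared distance to the origin. -/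
noncomputable def sinSqSum (x : Torus d) : ℝ := ∑ k, sinSq k x

/-- `∏ₖ cos² (π xₖ)`. -/
noncomputable def cosSqProd (x : Torus d) : ℝ := ∏ k, (1 - sinSq k x)

theorem sinSq_toTorus (k : Fin d) (t : Fin d → ℝ) :
    sinSq k (toTorus t) = Real.sin (Real.pi * t k) ^ 2 := by
  rw [sinSq, cosT_toTorus, Real.sin_sq_eq_half_sub]
  simp [Pi.single_apply]
  ring_nf

theorem sinCoord_toTorus (k : Fin d) (t : Fin d → ℝ) :
    sinCoord k (toTorus t) = Real.sin (2 * Real.pi * t k) / (2 * Real.pi) := by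
  rw [sinCoord, sinT_toTorus]
  simp [Pi.single_apply]

theorem sinSq_nonneg (k : Fin d) (x : Torus d) : 0 ≤ sinSq k x := by
  rw [sinSq]; linarith [(abs_le.1 (abs_cosT_le (Pi.single k 1) x)).2]

theorem sinSq_le_one (k : Fin d) (x : Torus d) : sinSq k x ≤ 1 := by
  rw [sinSq]; linarith [(abs_le.1 (abs_cosT_le (Pi.single k 1) x)).1]

theorem sinSqSum_nonneg (x : Torus d) : 0 ≤ sinSqSum x :=
  Finset.sum_nonneg fun k _ => sinSq_nonneg k x

theorem sinSq_le_sum (k : Fin d) (x : Torus d) : sinSq k x ≤ sinSqSum x :=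
  Finset.single_le_sum (f := fun k => sinSq k x) (fun k _ => sinSq_nonneg k x) (Finset.mem_univ k)

/-- Double-angle formula. It keeps the integrations by parts below polynomial in `sinSq k`. -/
theorem sinCoord_sq (k : Fin d) (x : Torus d) :
    sinCoord k x ^ 2 = sinSq k x * (1 - sinSq k x) / Real.pi ^ 2 := by
  have h := cosT_sq_add_sinT_sq (Pi.single k 1) x
  have hp := Real.pi_pos.ne'
  rw [sinCoord, sinSq]
  field_simp
  linear_combination h

theorem sinSq_mem (k : Fin d) : sinSq k ∈ smoothFun d := by
  convert (smoothFun d).smul_mem (1 / 2) ((smoothFun d).sub_mem (const_mem 1)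
    (cosT_mem (Pi.single k 1))) using 1
  funext x
  simp [sinSq]
  ring

theorem sinCoord_mem (k : Fin d) : sinCoord k ∈ smoothFun d := by
  convert (smoothFun d).smul_mem (1 / (2 * Real.pi)) (sinT_mem (Pi.single k 1)) using 1
  funext x
  simp [sinCoord]
  ring

theorem pderiv_sinSq (j k : Fin d) :
    pderiv j (sinSq k) = fun x => if j = k then 2 * Real.pi ^ 2 * sinCoord k x else 0 := by
  have e : sinSq k = (fun _ : Torus d => (1 / 2 : ℝ)) + (-(1 / 2 : ℝ)) • cosT (Pi.single k 1) := by
    funext x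
    simp [sinSq]
    ring
  rw [e, pderiv_add (const_mem _) ((smoothFun d).smul_mem _ (cosT_mem _)),
    pderiv_smul (cosT_mem _), pderiv_const, pderiv_cosT]
  funext x
  have hp := Real.pi_pos.ne'
  by_cases h : j = k
  · subst h
    simp [sinCoord]
    field_simp
  · simp [h]

theorem pderiv_sinCoord (j k : Fin d) :
    pderiv j (sinCoord k) = fun x => if j = k then 1 - 2 * sinSq k x else 0 := by
  have e : sinCoord k = (1 / (2 * Real.pi)) • sinT (Pi.single k 1 : Fin d → ℤ) := by
    funext x
    simp [sinCoord]
    ring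
  rw [e, pderiv_smul (sinT_mem _), pderiv_sinT]
  funext x
  have hp := Real.pi_pos.ne'
  by_cases h : j = k
  · subst h
    simp [sinSq]
    field_simp
    ring
  · simp [h]

theorem one_sub_sinSq_mem (k : Fin d) : (fun x => 1 - sinSq k x) ∈ smoothFun d :=
  (smoothFun d).sub_mem (const_mem 1) (sinSq_mem k)

theorem pderiv_one_sub_sinSq (j k : Fin d) :
    pderiv j (fun x => 1 - sinSq k x)
      = fun x => if j = k then -(2 * Real.pi ^ 2 * sinCoord k x) else 0 := by
  have e : (fun x => 1 - sinSq k x) = (fun _ : Torus d => (1 : ℝ)) + (-1 : ℝ) • sinSq k := by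
    funext x
    simp
    ring
  rw [e, pderiv_add (const_mem _) ((smoothFun d).smul_mem _ (sinSq_mem _)),
    pderiv_smul (sinSq_mem _), pderiv_const, pderiv_sinSq]
  funext x
  by_cases h : j = k <;> simp [h]

theorem prod_one_sub_sinSq_mem (s : Finset (Fin d)) :
    (fun x => ∏ k ∈ s, (1 - sinSq k x)) ∈ smoothFun d := by
  induction s using Finset.induction_on with
  | empty => simpa using const_mem 1
  | insert a s ha ih =>
    simp_rw [Finset.prod_insert ha]
    exact mul_mem (one_sub_sinSq_mem a) ih

theorem pderiv_prod_one_sub_sinSq (s : Finset (Fin d)) {j : Fin d} (hj : j ∉ s) :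
    pderiv j (fun x => ∏ k ∈ s, (1 - sinSq k x)) = 0 := by
  induction s using Finset.induction_on with
  | empty => simpa using pderiv_const j 1
  | insert a s ha ih =>
    rw [Finset.mem_insert, not_or] at hj
    simp_rw [Finset.prod_insert ha]
    rw [pderiv_mul (one_sub_sinSq_mem a) (prod_one_sub_sinSq_mem s), ih hj.2,
      pderiv_one_sub_sinSq]
    funext x
    simp [hj.1]

theorem cosSqProd_mem : cosSqProd ∈ smoothFun d := prod_one_sub_sinSq_mem Finset.univ

theorem cosSqProd_nonneg (x : Torus d) : 0 ≤ cosSqProd x :=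
  Finset.prod_nonneg fun k _ => sub_nonneg.2 (sinSq_le_one k x)

theorem pderiv_cosSqProd (k : Fin d) (x : Torus d) :
    pderiv k cosSqProd x
      = -(2 * Real.pi ^ 2 * sinCoord k x) * ∏ j ∈ Finset.univ.erase k, (1 - sinSq j x) := by
  have e : cosSqProd (d := d)
      = fun x => (1 - sinSq k x) * ∏ j ∈ Finset.univ.erase k, (1 - sinSq j x) := by
    funext x
    exact (Finset.mul_prod_erase _ _ (Finset.mem_univ k)).symm
  rw [e, pderiv_mul (one_sub_sinSq_mem k) (prod_one_sub_sinSq_mem _),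
    pderiv_prod_one_sub_sinSq _ (by simp), pderiv_one_sub_sinSq]
  simp

theorem abs_pderiv_cosSqProd_le (k : Fin d) (x : Torus d) :
    |pderiv k cosSqProd x| ≤ 2 * Real.pi ^ 2 * |sinCoord k x| := by
  have h1 : |∏ j ∈ Finset.univ.erase k, (1 - sinSq j x)| ≤ 1 := by
    rw [Finset.abs_prod]
    refine Finset.prod_le_one (fun _ _ => abs_nonneg _) fun j _ => abs_le.2 ⟨?_, ?_⟩ <;>
    linarith [sinSq_nonneg j x, sinSq_le_one j x]
  rw [pderiv_cosSqProd, abs_mul, abs_neg, abs_mul, abs_of_nonneg (by positivity)]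
  exact mul_le_of_le_one_right (by positivity) h1

/-- The field `sinCoord k` ∂ₖ is the periodic substitute for zₖ∂ₖ. It maps the kernel to a multiple
of itself, so that moments obey recursions and no explicit integral is needed. -/
theorem sinCoord_mul_pderiv_cosSqProd (k : Fin d) (x : Torus d) :
    sinCoord k x * pderiv k cosSqProd x = -2 * sinSq k x * cosSqProd x := by
  rw [pderiv_cosSqProd, cosSqProd, ← Finset.mul_prod_erase _ _ (Finset.mem_univ k)]
  have h := sinCoord_sq k x
  have hp := Real.pi_pos.ne'
  generalize ∏ j ∈ Finset.univ.erase k, (1 - sinSq j x) = P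
  field_simp at h
  linear_combination (-2 * P) * h

theorem pow_mem {φ : Torus d → ℝ} (h : φ ∈ smoothFun d) (N : ℕ) :
    (fun x => φ x ^ N) ∈ smoothFun d := comp_mem (G := fun y => y ^ N) h (by fun_prop)

theorem pderiv_pow {φ : Torus d → ℝ} (h : φ ∈ smoothFun d) (N : ℕ) (k : Fin d) (x : Torus d) :
    pderiv k (fun x => φ x ^ N) x = N * φ x ^ (N - 1) * pderiv k φ x := by
  rw [pderiv_comp (G := fun y => y ^ N) h (by fun_prop)]
  simp

theorem sinCoord_mul_pderiv_pow (N : ℕ) (k : Fin d) (x : Torus d) :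
    sinCoord k x * pderiv k (fun x => cosSqProd x ^ N) x
      = -2 * N * sinSq k x * cosSqProd x ^ N := by
  rw [pderiv_pow cosSqProd_mem]
  cases N with
  | zero => simp
  | succ N =>
    have := sinCoord_mul_pderiv_cosSqProd k x
    simp only [Nat.add_sub_cancel, pow_succ]
    linear_combination (((N + 1 : ℕ) : ℝ) * cosSqProd x ^ N) * this

theorem continuous_sinSq (k : Fin d) : Continuous (sinSq k) := continuous_of_mem (sinSq_mem k)

theorem continuous_sinSqSum : Continuous (sinSqSum (d := d)) :=
  continuous_finsetSum _ fun k _ => continuous_sinSq k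

theorem continuous_cosSqProd : Continuous (cosSqProd (d := d)) := continuous_of_mem cosSqProd_mem

/-- Integration by parts of `sinCoord k` against the derivative of the kernel. The test function
`sinCoord k * sinSq k` gives the next moment in the same way. -/
theorem integral_sinSq_mul_pow (k : Fin d) (N : ℕ) :
    (2 * N + 2) * ∫ x : Torus d, sinSq k x * cosSqProd x ^ N = ∫ x : Torus d, cosSqProd x ^ N := by
  have h := integral_mul_pderiv (sinCoord_mem k) (pow_mem cosSqProd_mem N) k
  have hs := continuous_sinSq k
  have hq := continuous_cosSqProd (d := d)
  simp_rw [sinCoord_mul_pderiv_pow, pderiv_sinCoord, if_true] at h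
  have e1 : ∫ x : Torus d, -2 * N * sinSq k x * cosSqProd x ^ N
      = -2 * N * ∫ x : Torus d, sinSq k x * cosSqProd x ^ N := by
    rw [← integral_const_mul]; congr 1; funext x; ring
  have e2 : ∫ x : Torus d, (1 - 2 * sinSq k x) * cosSqProd x ^ N
      = (∫ x : Torus d, cosSqProd x ^ N) - 2 * ∫ x : Torus d, sinSq k x * cosSqProd x ^ N := by
    rw [← integral_const_mul, ← integral_sub (integrable_of_continuous (by fun_prop))
      (integrable_of_continuous (by fun_prop))]
    congr 1; funext x; ring
  rw [e1, e2] at h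
  linarith

theorem integral_sinSq_sq_mul_pow (k : Fin d) (N : ℕ) :
    (2 * N + 4) * ∫ x : Torus d, sinSq k x ^ 2 * cosSqProd x ^ N
      = 3 * ∫ x : Torus d, sinSq k x * cosSqProd x ^ N := by
  have h := integral_mul_pderiv (mul_mem (sinCoord_mem k) (sinSq_mem k))
    (pow_mem cosSqProd_mem N) k
  have hs := continuous_sinSq k
  have hq := continuous_cosSqProd (d := d)
  have e0 : ∀ x : Torus d, sinCoord k x * sinSq k x * pderiv k (fun x => cosSqProd x ^ N) x
      = -2 * N * (sinSq k x ^ 2 * cosSqProd x ^ N) := fun x => by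
    linear_combination sinSq k x * sinCoord_mul_pderiv_pow N k x
  have e3 : ∀ x : Torus d, pderiv k (fun x => sinCoord k x * sinSq k x) x * cosSqProd x ^ N
      = 3 * (sinSq k x * cosSqProd x ^ N) - 4 * (sinSq k x ^ 2 * cosSqProd x ^ N) := fun x => by
    rw [pderiv_mul (sinCoord_mem k) (sinSq_mem k), pderiv_sinCoord, pderiv_sinSq]
    have h := sinCoord_sq k x
    have hp := Real.pi_pos.ne'
    field_simp at h
    simp only [if_true]
    linear_combination (2 * cosSqProd x ^ N) * h
  simp_rw [e0, e3] at h
  rw [integral_const_mul, integral_sub (integrable_of_continuous (by fun_prop))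
      (integrable_of_continuous (by fun_prop)), integral_const_mul, integral_const_mul] at h
  linarith

theorem integral_cosSqProd_pow_pos (N : ℕ) : 0 < ∫ x : Torus d, cosSqProd x ^ N := by
  have hq := continuous_cosSqProd (d := d)
  refine Continuous.integral_pos_of_hasCompactSupport_nonneg_nonzero (by fun_prop)
    (HasCompactSupport.of_compactSpace _) (fun x => pow_nonneg (cosSqProd_nonneg x) N) (x := 0) ?_
  simp [cosSqProd, sinSq, cosT_apply_zero]

theorem integral_sinSqSum_mul_pow (N : ℕ) :
    ∫ x : Torus d, sinSqSum x * cosSqProd x ^ N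
      = d / (2 * N + 2) * ∫ x : Torus d, cosSqProd x ^ N := by
  have hq := continuous_cosSqProd (d := d)
  simp_rw [sinSqSum, Finset.sum_mul]
  rw [integral_finsetSum]
  · have : ∀ k : Fin d, ∫ x : Torus d, sinSq k x * cosSqProd x ^ N
        = (∫ x : Torus d, cosSqProd x ^ N) / (2 * N + 2) := fun k => by
      rw [← integral_sinSq_mul_pow k]; field_simp
    simp_rw [this]
    simp
    ring
  · intro k _
    have hs := continuous_sinSq k
    exact integrable_of_continuous (by fun_prop)

/-- Cauchy–Schwarz reduces the square of the sum to single coordinates, whose second moment is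
3/((2N+2)(2N+4)) of the mass. The order N⁻² beats the factor N from the gradient of the kernel. -/
theorem integral_sinSqSum_sq_mul_pow_le (N : ℕ) :
    ∫ x : Torus d, sinSqSum x ^ 2 * cosSqProd x ^ N
      ≤ 3 * d ^ 2 / (2 * N + 2) ^ 2 * ∫ x : Torus d, cosSqProd x ^ N := by
  have hq := continuous_cosSqProd (d := d)
  have hS := continuous_sinSqSum (d := d)
  have h1 : ∀ k : Fin d, ∫ x : Torus d, sinSq k x ^ 2 * cosSqProd x ^ N
      ≤ 3 / (2 * N + 2) ^ 2 * ∫ x : Torus d, cosSqProd x ^ N := fun k => by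
    have e1 := integral_sinSq_mul_pow k N
    have e2 := integral_sinSq_sq_mul_pow k N
    have h0 : 0 ≤ ∫ x : Torus d, sinSq k x ^ 2 * cosSqProd x ^ N :=
      integral_nonneg fun x => mul_nonneg (sq_nonneg _) (pow_nonneg (cosSqProd_nonneg x) _)
    rw [← e1, div_mul_eq_mul_div, le_div_iff₀ (by positivity)]
    have hN : (0 : ℝ) ≤ N := N.cast_nonneg
    nlinarith [mul_nonneg h0 (by positivity : (0 : ℝ) ≤ 2 * N + 2)]
  have h2 : ∫ x : Torus d, sinSqSum x ^ 2 * cosSqProd x ^ N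
      ≤ ∫ x : Torus d, ∑ k, d * (sinSq k x ^ 2 * cosSqProd x ^ N) := by
    refine integral_mono (integrable_of_continuous (by fun_prop))
      (integrable_of_continuous (continuous_finsetSum _ fun k _ => ?_)) fun x => ?_
    · have hs := continuous_sinSq k
      fun_prop
    · simp only [sinSqSum]
      have := sq_sum_le_card_mul_sum_sq (s := Finset.univ) (f := fun k => sinSq k x)
      simp only [Finset.card_univ, Fintype.card_fin] at this
      rw [← Finset.mul_sum, ← Finset.sum_mul, ← mul_assoc]
      exact mul_le_mul_of_nonneg_right this (pow_nonneg (cosSqProd_nonneg x) _)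
  refine h2.trans ?_
  rw [integral_finsetSum]
  · simp_rw [integral_const_mul]
    refine (Finset.sum_le_sum fun k _ => mul_le_mul_of_nonneg_left (h1 k)
      (Nat.cast_nonneg d)).trans (le_of_eq ?_)
    simp
    ring
  · intro k _
    have hs := continuous_sinSq k
    exact integrable_of_continuous (by fun_prop)

/-- Weierstrass product inequality, by induction on the set of coordinates. -/
theorem one_sub_sinSqSum_le (x : Torus d) : 1 - sinSqSum x ≤ cosSqProd x := by
  have h : ∀ s : Finset (Fin d), 1 - ∑ k ∈ s, sinSq k x ≤ ∏ k ∈ s, (1 - sinSq k x) ∧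
      0 ≤ ∏ k ∈ s, (1 - sinSq k x) ∧ ∏ k ∈ s, (1 - sinSq k x) ≤ 1 := fun s => by
    induction s using Finset.induction_on with
    | empty => simp
    | insert a s ha ih =>
      rw [Finset.sum_insert ha, Finset.prod_insert ha]
      have h0 := sinSq_nonneg a x
      have h1 := sinSq_le_one a x
      refine ⟨by nlinarith, mul_nonneg (by linarith) ih.2.1, by nlinarith⟩
  exact (h Finset.univ).1

/-- Differentiating the power N + 1 leaves the power N, while the normalization stays that of N + 1;
this comparison absorbs the mismatch. It follows from q ≥ 1 − S and the first moment d/(2N+2) ≤ 1/2.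
-/
theorem integral_cosSqProd_pow_succ_ge {N : ℕ} (hN : d ≤ N + 1) :
    (∫ x : Torus d, cosSqProd x ^ N) ≤ 2 * ∫ x : Torus d, cosSqProd x ^ (N + 1) := by
  have hq := continuous_cosSqProd (d := d)
  have hS := continuous_sinSqSum (d := d)
  have h1 : ∫ x : Torus d, (cosSqProd x ^ N - sinSqSum x * cosSqProd x ^ N)
      ≤ ∫ x : Torus d, cosSqProd x ^ (N + 1) := by
    refine integral_mono (integrable_of_continuous (by fun_prop))
      (integrable_of_continuous (by fun_prop)) fun x => ?_
    have := mul_le_mul_of_nonneg_right (one_sub_sinSqSum_le x)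
      (pow_nonneg (cosSqProd_nonneg x) N)
    simp only [pow_succ]
    linarith
  rw [integral_sub (integrable_of_continuous (by fun_prop))
      (integrable_of_continuous (by fun_prop)), integral_sinSqSum_mul_pow] at h1
  have hN' : (d : ℝ) ≤ N + 1 := by exact_mod_cast hN
  have h2 : (d : ℝ) / (2 * N + 2) ≤ 1 / 2 := by
    rw [div_le_div_iff₀ (by positivity) (by norm_num)]; linarith
  nlinarith [integral_cosSqProd_pow_pos (d := d) N]

theorem sinSqSum_eq_zero {x : Torus d} (h : sinSqSum x = 0) : x = 0 := by
  obtain ⟨t, ht, rfl⟩ := exists_toTorus x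
  have h1 := (Finset.sum_eq_zero_iff_of_nonneg fun k _ => sinSq_nonneg k (toTorus t)).1 h
  rw [← toTorus_zero]
  congr 1
  funext k
  have h2 := h1 k (Finset.mem_univ k)
  rw [sinSq_toTorus, sq_eq_zero_iff] at h2
  have h3 := abs_le.1 (ht k)
  have hp := Real.pi_pos
  have h4 := (Real.sin_eq_zero_iff_of_lt_of_lt (by nlinarith) (by nlinarith)).1 h2
  simpa [hp.ne'] using h4

/-- A nonnegative continuous function that vanishes at the origin is small up to a multiple of
`sinSqSum`. -/
theorem exists_le_add_mul_sinSqSum {τ : Torus d → ℝ} (hτ : Continuous τ) (h0 : τ 0 = 0) {η : ℝ}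
    (hη : 0 < η) : ∃ C, 0 ≤ C ∧ ∀ x, τ x ≤ η + C * sinSqSum x := by
  obtain ⟨B, hB0, hB⟩ := bounded_of_continuous hτ
  have hK : IsCompact {x | η ≤ τ x} := (isClosed_le continuous_const hτ).isCompact
  rcases Set.eq_empty_or_nonempty {x | η ≤ τ x} with he | hne
  · refine ⟨0, le_rfl, fun x => ?_⟩
    have : x ∉ {x | η ≤ τ x} := by rw [he]; simp
    simp only [Set.mem_ofPred_eq, not_le] at this
    linarith
  -- On the compact set τ ≥ η, which avoids the origin, `sinSqSum` has a positive minimum; the sup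
  -- bound of τ divided by it is an admissible slope.
  · obtain ⟨x0, hx0, hmin⟩ := hK.exists_isMinOn hne continuous_sinSqSum.continuousOn
    have hpos : 0 < sinSqSum x0 := by
      refine lt_of_le_of_ne (sinSqSum_nonneg x0) fun h => ?_
      have := sinSqSum_eq_zero h.symm
      simp only [Set.mem_ofPred_eq, this, h0] at hx0
      linarith
    refine ⟨B / sinSqSum x0, by positivity, fun x => ?_⟩
    by_cases hx : η ≤ τ x
    · have h1 : sinSqSum x0 ≤ sinSqSum x := hmin hx
      have h2 : B ≤ B / sinSqSum x0 * sinSqSum x := by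
        rw [div_mul_eq_mul_div, le_div_iff₀ hpos]
        exact mul_le_mul_of_nonneg_left h1 hB0
      linarith [(abs_le.1 (hB x)).2]
    · have : 0 ≤ B / sinSqSum x0 * sinSqSum x :=
        mul_nonneg (by positivity) (sinSqSum_nonneg x)
      linarith

theorem integral_cosT_of_ne {n : Fin d → ℤ} (hn : n ≠ 0) : ∫ x, cosT n x = 0 := by
  obtain ⟨i, hi⟩ := Function.ne_iff.1 hn
  have h := integral_pderiv (sinT_mem n) i
  rw [pderiv_sinT, integral_const_mul] at h
  have hi' : (n i : ℝ) ≠ 0 := by simpa using hi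
  simpa [hi', Real.pi_ne_zero] using h

/-! ### First-order expansion in L¹ and the commutator -/

/-- Translation is continuous in `L¹`. -/
theorem continuous_integral_abs_translate {f : Torus d → ℝ} (hf : Integrable f) :
    Continuous fun z : Torus d => ∫ x, |f (x - z) - f x| := by
  have hf1 : MemLp f 1 := memLp_one_iff_integrable.2 hf
  let g : C(Torus d, C(Torus d, Torus d)) :=
    (ContinuousMap.mk (fun a : Torus d × Torus d => a.2 - a.1) (by fun_prop)).curry
  have hg : ∀ z, MeasurePreserving (g z) volume volume := fun z => measurePreserving_sub_right _ z
  have h : Continuous fun z : Torus d =>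
      ‖Lp.compMeasurePreserving (g z) (hg z) (hf1.toLp f) - hf1.toLp f‖ :=
    ((continuous_const.compMeasurePreservingLp g.continuous hg ENNReal.one_ne_top).sub
      continuous_const).norm
  convert h using 1
  funext z
  rw [L1.norm_eq_integral_norm]
  refine integral_congr_ae ?_
  filter_upwards [Lp.coeFn_sub (Lp.compMeasurePreserving (g z) (hg z) (hf1.toLp f)) (hf1.toLp f),
    hf1.coeFn_toLp, (hf1.comp_measurePreserving (hg z)).coeFn_toLp] with x h1 h2 h3
  have h4 : Lp.compMeasurePreserving (g z) (hg z) (hf1.toLp f) x = f (x - z) := h3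
  rw [h1, Pi.sub_apply, h2, h4, Real.norm_eq_abs]

theorem translate_mem {φ : Torus d → ℝ} (h : φ ∈ smoothFun d) (z : Torus d) :
    (fun x => φ (x + z)) ∈ smoothFun d := by
  obtain ⟨t, -, rfl⟩ := exists_toTorus z
  rw [mem_smoothFun] at h ⊢
  simp_rw [← toTorus_add]
  exact h.comp (contDiff_id.add contDiff_const)

theorem pderiv_translate (φ : Torus d → ℝ) (z : Torus d) (k : Fin d) (x : Torus d) :
    pderiv k (fun x => φ (x + z)) x = pderiv k φ (x + z) := by
  simp only [pderiv, add_right_comm]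

theorem integrable_comp_sub {f : Torus d → ℝ} (hf : Integrable f) (z : Torus d) :
    Integrable fun x => f (x - z) := hf.comp_sub_right z

/-- First-order Taylor expansion of a `W^{1,1}` function in `L¹`. -/
theorem abs_integral_taylor_le {b : Torus d → ℝ} {B : Fin d → Torus d → ℝ} (hb : Integrable b)
    (hB : ∀ k, Integrable (B k)) (hw : ∀ k, HasWeakPDeriv k b (B k)) (t : Fin d → ℝ) {δ : ℝ}
    (hδ : ∀ s ∈ Set.Icc (0 : ℝ) 1, ∀ k, ∫ x, |B k (x - toTorus (s • t)) - B k x| ≤ δ)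
    {G : Torus d → ℝ} (hG : AEStronglyMeasurable G) {M : ℝ} (hM : ∀ᵐ x, |G x| ≤ M) :
    |∫ x, (b x - b (x - toTorus t) - ∑ k, t k * B k x) * G x| ≤ (∑ k, |t k|) * δ * M := by
  have hsum : Integrable fun x => ∑ k, t k * B k x :=
    integrable_finsetSum _ fun k _ => (hB k).const_mul _
  have hdiff := hb.sub (integrable_comp_sub hb (toTorus t))
  have hδ0 : 0 ≤ (∑ k, |t k|) * δ := by
    rw [Finset.sum_mul]
    exact Finset.sum_nonneg fun k _ => mul_nonneg (abs_nonneg _)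
      ((integral_nonneg fun _ => abs_nonneg _).trans (hδ 0 (by simp) k))
  -- By duality smooth weights suffice; translations and derivatives can then be moved onto the
  -- weight.
  refine abs_integral_mul_le (hdiff.sub hsum) hδ0 ?_ hG hM
  intro φ hφ M hφM
  have hφ' := trig_le hφ
  have hφc := continuous_of_mem hφ'
  have hshift : ∀ (f : Torus d → ℝ) (z : Torus d),
      ∫ x, f x * φ (x + z) = ∫ x, f (x - z) * φ x := fun f z => by
    rw [← integral_sub_right_eq_self _ z]
    simp
  set K := ∑ k, t k * ∫ x, B k x * φ x with hK
  -- `F 0 - F 1` is the integral to be bounded. The term `s * K` leaves in F′ only the differences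
  -- between `B k` and its translates, and the mean value inequality on [0, 1] concludes.
  let F : ℝ → ℝ := fun s => (∫ x, b x * φ (x + toTorus (s • t))) + s * K
  have hF : ∀ s, HasDerivAt F (-∑ k, t k * ∫ x, (B k (x - toTorus (s • t)) - B k x) * φ x) s := by
    intro s
    have h1 := (hasDerivAt_integral_line hb hφ' t s).add ((hasDerivAt_id s).mul_const K)
    suffices e0 : -∑ k, t k * ∫ x, (B k (x - toTorus (s • t)) - B k x) * φ x
        = (∑ k, t k * ∫ x, b x * pderiv k φ (x + toTorus (s • t))) + 1 * K by
      rw [e0]; exact h1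
    rw [hK, one_mul, ← Finset.sum_add_distrib, ← Finset.sum_neg_distrib]
    refine Finset.sum_congr rfl fun k _ => ?_
    have h2 := hw k _ (translate_mem hφ' (toTorus (s • t)))
    simp_rw [pderiv_translate] at h2
    rw [h2, hshift]
    simp_rw [sub_mul]
    rw [integral_sub (integrable_mul_continuous (integrable_comp_sub (hB k) _) hφc)
      (integrable_mul_continuous (hB k) hφc)]
    ring
  have hbound : ∀ s ∈ Set.Ico (0 : ℝ) 1,
      ‖-∑ k, t k * ∫ x, (B k (x - toTorus (s • t)) - B k x) * φ x‖ ≤ (∑ k, |t k|) * δ * M := by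
    intro s hs
    have hM0 : 0 ≤ M := (abs_nonneg _).trans (hφM 0)
    rw [norm_neg, mul_assoc, Finset.sum_mul]
    refine (norm_sum_le _ _).trans (Finset.sum_le_sum fun k _ => ?_)
    rw [norm_mul, Real.norm_eq_abs, Real.norm_eq_abs]
    refine mul_le_mul_of_nonneg_left ?_ (abs_nonneg _)
    have hd := (integrable_comp_sub (hB k) (toTorus (s • t))).sub (hB k)
    calc |∫ x, (B k (x - toTorus (s • t)) - B k x) * φ x|
        ≤ ∫ x, |B k (x - toTorus (s • t)) - B k x| * M := by
          refine abs_integral_le_integral_abs.trans (integral_mono_of_nonneg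
            (Eventually.of_forall fun _ => abs_nonneg _) (hd.abs.mul_const M)
            (Eventually.of_forall fun x => ?_))
          simp only [abs_mul]
          exact mul_le_mul_of_nonneg_left (hφM x) (abs_nonneg _)
      _ ≤ δ * M := by
          rw [integral_mul_const]
          exact mul_le_mul_of_nonneg_right (hδ s ⟨hs.1, hs.2.le⟩ k) hM0
  have := norm_image_sub_le_of_norm_deriv_le_segment_01'
    (fun s _ => (hF s).hasDerivWithinAt) hbound
  rw [Real.norm_eq_abs, abs_sub_comm] at this
  have hi1 := integrable_mul_continuous hb hφc
  have hi2 := integrable_mul_continuous (integrable_comp_sub hb (toTorus t)) hφc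
  have hi3 := integrable_mul_continuous hsum hφc
  have e3 : ∫ x, (∑ k, t k * B k x) * φ x = K := by
    simp_rw [Finset.sum_mul, mul_assoc]
    rw [integral_finsetSum _ fun k _ => (integrable_mul_continuous (hB k) hφc).const_mul _]
    simp_rw [integral_const_mul]
    rfl
  have e4 : F 0 - F 1 = ∫ x, (b x - b (x - toTorus t) - ∑ k, t k * B k x) * φ x := by
    have e5 : ∀ x, (b x - b (x - toTorus t) - ∑ k, t k * B k x) * φ x
        = b x * φ x - b (x - toTorus t) * φ x - (∑ k, t k * B k x) * φ x := fun x => by ring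
    simp_rw [e5]
    have hi12 : Integrable fun x => b x * φ x - b (x - toTorus t) * φ x := hi1.sub hi2
    rw [integral_sub hi12 hi3, integral_sub hi1 hi2, e3, ← hshift b (toTorus t)]
    simp only [F, zero_smul, toTorus_zero, add_zero, zero_mul, one_smul, one_mul]
    ring
  rw [e4] at this
  exact this

theorem abs_sin_le_abs_sin {s t : ℝ} (hs : s ∈ Set.Icc (0 : ℝ) 1) (ht : |t| ≤ 1 / 2) :
    Real.sin (Real.pi * (s * t)) ^ 2 ≤ Real.sin (Real.pi * t) ^ 2 := by
  have hp := Real.pi_pos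
  have key : ∀ r : ℝ, Real.sin (Real.pi * r) ^ 2 = Real.sin (Real.pi * |r|) ^ 2 := fun r => by
    rcases abs_choice r with h | h <;> rw [h]
    rw [mul_neg, Real.sin_neg, neg_sq]
  rw [key, key t, abs_mul, abs_of_nonneg hs.1]
  have h1 : s * |t| ≤ |t| := mul_le_of_le_one_left (abs_nonneg _) hs.2
  have h0 : 0 ≤ s * |t| := mul_nonneg hs.1 (abs_nonneg _)
  refine pow_le_pow_left₀ (Real.sin_nonneg_of_nonneg_of_le_pi (by positivity) ?_) ?_ 2
  · nlinarith
  · exact Real.sin_le_sin_of_le_of_le_pi_div_two (by nlinarith) (by nlinarith)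
      (mul_le_mul_of_nonneg_left h1 hp.le)

/-- The function sin²(π ·) increases with |·| on [−1/2, 1/2]. So the moduli of continuity on the
whole segment from 0 to `t` are controlled by the endpoint. -/
theorem sinSqSum_smul_le {t : Fin d → ℝ} (ht : ∀ i, |t i| ≤ 1 / 2) {s : ℝ}
    (hs : s ∈ Set.Icc (0 : ℝ) 1) : sinSqSum (toTorus (s • t)) ≤ sinSqSum (toTorus t) := by
  refine Finset.sum_le_sum fun k _ => ?_
  rw [sinSq_toTorus, sinSq_toTorus]
  exact abs_sin_le_abs_sin hs (ht k)

theorem sinSqSum_neg (x : Torus d) : sinSqSum (-x) = sinSqSum x := by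
  simp only [sinSqSum, sinSq, cosT_neg]

/-- Jordan's inequality |sin y| ≥ (2/π)|y| for |y| ≤ π/2. -/
theorem abs_le_sqrt_sinSqSum {t : Fin d → ℝ} (ht : ∀ i, |t i| ≤ 1 / 2) (k : Fin d) :
    |t k| ≤ Real.sqrt (sinSqSum (toTorus t)) := by
  have hp := Real.pi_pos
  refine Real.le_sqrt_of_sq_le ((?_ : _ ≤ sinSq k (toTorus t)).trans (sinSq_le_sum k _))
  rw [sinSq_toTorus, ← sq_abs (Real.sin _)]
  refine pow_le_pow_left₀ (abs_nonneg _) ?_ 2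
  have h1 : |Real.pi * t k| ≤ Real.pi / 2 := by
    rw [abs_mul, abs_of_pos hp]; nlinarith [ht k]
  have := Real.mul_abs_le_abs_sin h1
  rw [abs_mul, abs_of_pos hp] at this
  have e : 2 / Real.pi * (Real.pi * |t k|) = 2 * |t k| := by field_simp
  linarith [abs_nonneg (t k)]

/-- For y ≥ 0 this is y cos y ≤ sin y: before π/2 it is y ≤ tan y, after π/2 the two sides have
opposite signs. -/
theorem abs_sub_sin_le {x : ℝ} (hx : |x| ≤ Real.pi) :
    |x - Real.sin x| ≤ |x| * (1 - Real.cos x) := by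
  have key : ∀ y, 0 ≤ y → y ≤ Real.pi → |y - Real.sin y| ≤ y * (1 - Real.cos y) := by
    intro y h0 h1
    rw [abs_of_nonneg (sub_nonneg.2 (Real.sin_le h0))]
    suffices y * Real.cos y ≤ Real.sin y by linarith
    rcases lt_or_ge y (Real.pi / 2) with h | h
    · have hc : 0 < Real.cos y := Real.cos_pos_of_mem_Ioo ⟨by linarith [Real.pi_pos], h⟩
      have := Real.le_tan h0 h
      rwa [Real.tan_eq_sin_div_cos, le_div_iff₀ hc] at this
    · have hc : Real.cos y ≤ 0 := Real.cos_nonpos_of_pi_div_two_le_of_le h (by linarith)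
      exact (mul_nonpos_of_nonneg_of_nonpos h0 hc).trans
        (Real.sin_nonneg_of_nonneg_of_le_pi h0 h1)
  rcases le_total 0 x with h | h
  · rw [abs_of_nonneg h] at hx ⊢
    exact key x h hx
  · rw [abs_of_nonpos h] at hx ⊢
    have := key (-x) (by linarith) hx
    rw [Real.sin_neg, Real.cos_neg] at this
    rwa [← abs_neg, neg_sub, show Real.sin x - x = -x - -Real.sin x by ring]

/-- The smooth periodic function `sinCoord k` may replace the coordinate, which is not periodic, at
the price of a third-order error. -/
theorem abs_sub_sinCoord_le {t : Fin d → ℝ} (ht : ∀ i, |t i| ≤ 1 / 2) (k : Fin d) :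
    |t k - sinCoord k (toTorus t)| ≤ |t k| * (2 * sinSqSum (toTorus t)) := by
  have hp := Real.pi_pos
  have h1 : |2 * Real.pi * t k| ≤ Real.pi := by
    rw [abs_mul, abs_of_pos (by positivity)]; nlinarith [ht k]
  have h2 := abs_sub_sin_le h1
  have h3 : 1 - Real.cos (2 * Real.pi * t k) = 2 * sinSq k (toTorus t) := by
    rw [sinSq_toTorus, Real.sin_sq_eq_half_sub]; ring_nf
  have h4 : t k - sinCoord k (toTorus t)
      = (2 * Real.pi * t k - Real.sin (2 * Real.pi * t k)) / (2 * Real.pi) := by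
    rw [sinCoord_toTorus]; field_simp
  rw [h4, abs_div, abs_of_pos (by positivity : (0 : ℝ) < 2 * Real.pi), div_le_iff₀ (by positivity)]
  rw [h3, abs_mul, abs_of_pos (by positivity : (0 : ℝ) < 2 * Real.pi)] at h2
  refine h2.trans ?_
  have := mul_le_mul_of_nonneg_left (sinSq_le_sum k (toTorus t)) (abs_nonneg (t k))
  nlinarith

theorem abs_sinCoord_le (k : Fin d) (x : Torus d) :
    |sinCoord k x| ≤ Real.sqrt (sinSqSum x) / Real.pi := by
  have hp := Real.pi_pos
  have h0 := sinSq_nonneg k x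
  rw [le_div_iff₀ hp]
  refine Real.le_sqrt_of_sq_le ?_
  rw [mul_pow, sq_abs, sinCoord_sq, div_mul_cancel₀ _ (by positivity)]
  nlinarith [sinSq_le_sum k x]

theorem integrable_mul_bounded {f u : Torus d → ℝ} (hf : Integrable f) (hu : Measurable u) {M : ℝ}
    (hM : ∀ x, |u x| ≤ M) : Integrable fun x => f x * u x :=
  hf.mul_bdd hu.aestronglyMeasurable (Eventually.of_forall hM)

/-- The expansion of the commutator `∫ (b(x) - b(x - z)) u(x) u(x - z) dx` near `z = 0`. -/
theorem exists_commutator_bound {b : Torus d → ℝ} {B : Fin d → Torus d → ℝ} (hb : Integrable b)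
    (hB : ∀ k, Integrable (B k)) (hw : ∀ k, HasWeakPDeriv k b (B k)) {u : Torus d → ℝ}
    (hu : Measurable u) {M : ℝ} (hM : ∀ x, |u x| ≤ M) {η : ℝ} (hη : 0 < η) :
    ∃ C, 0 ≤ C ∧ ∀ z, |(∫ x, (b x - b (x - z)) * (u x * u (x - z)))
        - ∑ k, sinCoord k z * ∫ x, B k x * u x ^ 2|
      ≤ Real.sqrt (sinSqSum z) * (η + C * sinSqSum z) := by
  have hM0 : 0 ≤ M := (abs_nonneg _).trans (hM 0)
  have hBu : ∀ k, Integrable fun x => B k x * u x := fun k => integrable_mul_bounded (hB k) hu hM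
  -- The L¹ moduli of `B k` govern the expansion of `b`; those of `B k * u` serve to replace u(x −
  -- z) by u(x) afterwards.
  let τ : Torus d → ℝ := fun z => ∑ k, ((∫ x, |B k (x - z) - B k x|)
    + ∫ x, |B k (x - z) * u (x - z) - B k x * u x|)
  have hτc : Continuous τ := continuous_finsetSum _ fun k _ =>
    (continuous_integral_abs_translate (hB k)).add (continuous_integral_abs_translate (hBu k))
  have hτ0 : τ 0 = 0 := by simp [τ]
  set K1 := (d : ℝ) * (M ^ 2 + M) + 1 with hK1
  have hK1p : 0 < K1 := by positivity
  obtain ⟨C0, hC00, hC0⟩ := exists_le_add_mul_sinSqSum hτc hτ0 (η := η / K1) (by positivity)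
  have hnn1 : ∀ k z, 0 ≤ ∫ x, |B k (x - z) - B k x| := fun k z =>
    integral_nonneg fun _ => abs_nonneg _
  have hnn2 : ∀ k z, 0 ≤ ∫ x, |B k (x - z) * u (x - z) - B k x * u x| := fun k z =>
    integral_nonneg fun _ => abs_nonneg _
  have hτ1 : ∀ k z, ∫ x, |B k (x - z) - B k x| ≤ τ z := fun k z =>
    (le_add_of_nonneg_right (hnn2 k z)).trans (Finset.single_le_sum
      (f := fun k => (∫ x, |B k (x - z) - B k x|)
        + ∫ x, |B k (x - z) * u (x - z) - B k x * u x|)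
      (fun k _ => add_nonneg (hnn1 k z) (hnn2 k z)) (Finset.mem_univ k))
  have hτ2 : ∀ k z, ∫ x, |B k (x - z) * u (x - z) - B k x * u x| ≤ τ z := fun k z =>
    (le_add_of_nonneg_left (hnn1 k z)).trans (Finset.single_le_sum
      (f := fun k => (∫ x, |B k (x - z) - B k x|)
        + ∫ x, |B k (x - z) * u (x - z) - B k x * u x|)
      (fun k _ => add_nonneg (hnn1 k z) (hnn2 k z)) (Finset.mem_univ k))
  set e : Fin d → ℝ := fun k => ∫ x, B k x * u x ^ 2 with he
  -- `K1 * C0` comes from the moduli of continuity, the sum from exchanging `t k` for `sinCoord k`.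
  refine ⟨K1 * C0 + 2 * ∑ k, |e k|, by positivity, fun z => ?_⟩
  obtain ⟨t, ht, rfl⟩ := exists_toTorus z
  set z := toTorus t with hz
  set S := sinSqSum z with hS
  have hS0 : 0 ≤ S := sinSqSum_nonneg z
  set δ := η / K1 + C0 * S with hδ
  have hδ0 : 0 ≤ δ := by positivity
  have huz : Measurable fun x => u (x - z) := hu.comp (measurable_sub_const z)
  have hG : AEStronglyMeasurable fun x => u x * u (x - z) := (hu.mul huz).aestronglyMeasurable
  have hGM : ∀ x, |u x * u (x - z)| ≤ M ^ 2 := fun x => by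
    rw [abs_mul, sq]; exact mul_le_mul (hM x) (hM _) (abs_nonneg _) hM0
  have h1 := abs_integral_taylor_le hb hB hw t (δ := δ) (fun s hs k => by
    refine (hτ1 k _).trans ((hC0 _).trans ?_)
    rw [hδ]
    gcongr
    exact sinSqSum_smul_le ht hs) hG (Eventually.of_forall hGM)
  have h2 : ∀ k, |(∫ x, B k x * (u x * u (x - z))) - e k| ≤ δ * M := fun k => by
    -- After a shift by `z` the translate falls on the integrable function `B k * u`, and the factor
    -- left over is the bounded `u`.
    have e1 : ∫ x, B k x * (u x * u (x - z)) = ∫ x, (B k (x - -z) * u (x - -z)) * u x := by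
      rw [← integral_add_right_eq_self _ z]
      simp [mul_assoc]
    have e2 : (∫ x, B k x * (u x * u (x - z))) - e k
        = ∫ x, (B k (x - -z) * u (x - -z) - B k x * u x) * u x := by
      rw [e1, he]
      simp_rw [sub_mul]
      rw [integral_sub (integrable_mul_bounded (integrable_comp_sub (hBu k) (-z)) hu hM)
        (integrable_mul_bounded (hBu k) hu hM)]
      congr 2
      funext x
      ring
    rw [e2]
    calc |∫ x, (B k (x - -z) * u (x - -z) - B k x * u x) * u x|
        ≤ ∫ x, |B k (x - -z) * u (x - -z) - B k x * u x| * M := by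
          refine abs_integral_le_integral_abs.trans (integral_mono_of_nonneg
            (Eventually.of_forall fun _ => abs_nonneg _)
            (((integrable_comp_sub (hBu k) (-z)).sub (hBu k)).abs.mul_const M)
            (Eventually.of_forall fun x => ?_))
          simp only [abs_mul]
          exact mul_le_mul_of_nonneg_left (hM x) (abs_nonneg _)
      _ ≤ δ * M := by
          rw [integral_mul_const]
          refine mul_le_mul_of_nonneg_right ((hτ2 k (-z)).trans ((hC0 _).trans ?_)) hM0
          rw [sinSqSum_neg]
  have h3 : ∫ x, (b x - b (x - z) - ∑ k, t k * B k x) * (u x * u (x - z))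
      = (∫ x, (b x - b (x - z)) * (u x * u (x - z)))
        - ∑ k, t k * ∫ x, B k x * (u x * u (x - z)) := by
    have hi : ∀ k, Integrable fun x => B k x * (u x * u (x - z)) := fun k =>
      integrable_mul_bounded (hB k) (hu.mul huz) hGM
    have e1 : ∑ k, t k * ∫ x, B k x * (u x * u (x - z))
        = ∫ x, (∑ k, t k * B k x) * (u x * u (x - z)) := by
      simp_rw [Finset.sum_mul, mul_assoc]
      rw [integral_finsetSum _ fun k _ => (hi k).const_mul _]
      simp_rw [integral_const_mul]
    rw [e1, ← integral_sub]
    · congr 1; funext x; ring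
    · exact integrable_mul_bounded (hb.sub (integrable_comp_sub hb z)) (hu.mul huz) hGM
    · exact integrable_mul_bounded (integrable_finsetSum _ fun k _ => (hB k).const_mul _)
        (hu.mul huz) hGM
  rw [h3] at h1
  have h4 : |(∑ k, t k * ∫ x, B k x * (u x * u (x - z))) - ∑ k, sinCoord k z * e k|
      ≤ ∑ k, |t k| * (δ * M + 2 * S * |e k|) := by
    rw [← Finset.sum_sub_distrib]
    refine (Finset.abs_sum_le_sum_abs _ _).trans (Finset.sum_le_sum fun k _ => ?_)
    have e1 : t k * (∫ x, B k x * (u x * u (x - z))) - sinCoord k z * e k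
        = t k * ((∫ x, B k x * (u x * u (x - z))) - e k) + (t k - sinCoord k z) * e k := by ring
    rw [e1]
    refine (abs_add_le _ _).trans ?_
    rw [abs_mul, abs_mul, mul_add]
    refine add_le_add (mul_le_mul_of_nonneg_left (h2 k) (abs_nonneg _)) ?_
    rw [← mul_assoc]
    exact mul_le_mul_of_nonneg_right (abs_sub_sinCoord_le ht k) (abs_nonneg _)
  have h5 : ∀ k, |t k| ≤ Real.sqrt S := abs_le_sqrt_sinSqSum ht
  calc |(∫ x, (b x - b (x - z)) * (u x * u (x - z))) - ∑ k, sinCoord k z * e k|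
      ≤ (∑ k, |t k|) * δ * M ^ 2 + ∑ k, |t k| * (δ * M + 2 * S * |e k|) := by
        refine le_trans ?_ (add_le_add h1 h4)
        refine le_trans (le_of_eq ?_) (abs_add_le _ _)
        congr 1
        ring
    _ = ∑ k, |t k| * (δ * (M ^ 2 + M) + 2 * S * |e k|) := by
        rw [Finset.sum_mul, Finset.sum_mul, ← Finset.sum_add_distrib]
        exact Finset.sum_congr rfl fun k _ => by ring
    _ ≤ ∑ k, Real.sqrt S * (δ * (M ^ 2 + M) + 2 * S * |e k|) :=
        Finset.sum_le_sum fun k _ => mul_le_mul_of_nonneg_right (h5 k) (by positivity)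
    _ = Real.sqrt S * (δ * (d * (M ^ 2 + M)) + 2 * S * ∑ k, |e k|) := by
        have e9 : ∑ k, (δ * (M ^ 2 + M) + 2 * S * |e k|)
            = d * (δ * (M ^ 2 + M)) + 2 * S * ∑ k, |e k| := by
          rw [Finset.sum_add_distrib, Finset.mul_sum, Finset.sum_const, Finset.card_univ,
            Fintype.card_fin, nsmul_eq_mul]
        rw [← Finset.mul_sum, e9]
        ring
    _ ≤ Real.sqrt S * (δ * K1 + 2 * S * ∑ k, |e k|) := by
        gcongr
        linarith
    _ = _ := by
        rw [hδ]
        field_simp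
        ring

/-! ### Odd kernels, positive definite kernels and the energy inequality -/

instance : (volume : Measure (Torus d)).IsNegInvariant :=
  Measure.IsAddHaarMeasure.isNegInvariant_of_regular _

instance : IsProbabilityMeasure (volume : Measure (Torus d)) :=
  have : IsProbabilityMeasure (volume : Measure UnitAddCircle) := ⟨by simp⟩
  inferInstanceAs (IsProbabilityMeasure (Measure.pi fun _ : Fin d => volume))

/-- The double integral against an odd kernel, symmetrized. -/
theorem integral_convolution_odd {b u κ : Torus d → ℝ} (hb : Integrable b) (hu : Measurable u)
    {M : ℝ} (hM : ∀ x, |u x| ≤ M) (hκ : Continuous κ) (hodd : ∀ z, κ (-z) = -κ z) :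
    (Integrable fun z => κ z * ∫ x, (b x - b (x - z)) * (u x * u (x - z))) ∧
    (Integrable fun x => b x * u x * ∫ y, u y * κ (x - y)) ∧
    ∫ x, b x * u x * ∫ y, u y * κ (x - y)
      = 1 / 2 * ∫ z, κ z * ∫ x, (b x - b (x - z)) * (u x * u (x - z)) := by
  have hM0 : 0 ≤ M := (abs_nonneg _).trans (hM 0)
  obtain ⟨K, hK0, hK⟩ := bounded_of_continuous hκ
  have hbu := integrable_mul_bounded hb hu hM
  -- Γ is the correlation of `b * u` with `u`. An odd kernel sees only the odd part of Γ, which is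
  -- half the commutator integral.
  let Γ : Torus d → ℝ := fun z => ∫ x, b x * u x * u (x - z)
  have huz : ∀ z, Measurable fun x => u (x - z) := fun z => hu.comp (measurable_sub_const z)
  have hI : Integrable (fun p : Torus d × Torus d => b p.1 * u p.1 * (u (p.1 - p.2) * κ p.2))
      (volume.prod volume) := by
    refine Integrable.mul_bdd (c := M * K) ?_ ?_ (Eventually.of_forall fun p => ?_)
    · exact hbu.comp_fst volume
    · exact ((hu.comp (measurable_fst.sub measurable_snd)).mul
        (hκ.measurable.comp measurable_snd)).aestronglyMeasurable
    · rw [norm_mul]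
      exact mul_le_mul (hM _) (hK _) (norm_nonneg _) hM0
  have e1 : ∀ x, ∫ y, u y * κ (x - y) = ∫ z, u (x - z) * κ z := fun x => by
    rw [← integral_sub_left_eq_self _ volume x]
    simp
  have e2 : ∀ z, ∫ x, b x * u x * (u (x - z) * κ z) = κ z * Γ z := fun z => by
    rw [← integral_const_mul]
    congr 1
    funext x
    ring
  have hΓ : Integrable fun z => κ z * Γ z := by
    have := hI.integral_prod_right
    simpa only [e2] using this
  have hΓneg : ∀ z, Γ (-z) = ∫ x, b (x - z) * u (x - z) * u x := fun z => by
    simp only [Γ]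
    rw [← integral_sub_right_eq_self _ z]
    simp
  have hD : ∀ z, ∫ x, (b x - b (x - z)) * (u x * u (x - z)) = Γ z - Γ (-z) := fun z => by
    rw [hΓneg, ← integral_sub]
    · congr 1; funext x; ring
    · exact integrable_mul_bounded hbu (huz z) (fun x => hM _)
    · exact integrable_mul_bounded (integrable_comp_sub hbu z) hu hM
  have hΓ' : Integrable fun z => κ z * Γ (-z) := by
    have := hΓ.comp_neg
    simp_rw [hodd] at this
    simpa using this.neg
  refine ⟨?_, ?_, ?_⟩
  · simp_rw [hD, mul_sub]
    exact hΓ.sub hΓ'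
  · simp_rw [e1]
    have := hI.integral_prod_left
    simpa only [integral_const_mul] using this
  · have h1 : ∫ x, b x * u x * ∫ y, u y * κ (x - y) = ∫ z, κ z * Γ z := by
      simp_rw [e1, ← integral_const_mul]
      rw [integral_integral_swap hI]
      exact integral_congr_ae (Eventually.of_forall e2)
    have h2 : ∫ z, κ z * Γ (-z) = -∫ z, κ z * Γ z := by
      rw [← integral_neg_eq_self _ volume, ← integral_neg]
      simp [hodd]
    simp_rw [hD, mul_sub]
    rw [integral_sub hΓ hΓ', h2, h1]
    ring

/-- The cone of nonnegative combinations of the functions `x ↦ cos (2π n · x)`. -/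
noncomputable def posCos (d : ℕ) : AddSubmonoid (Torus d → ℝ) :=
  AddSubmonoid.closure {f | ∃ (a : ℝ) (n : Fin d → ℤ), 0 ≤ a ∧ f = fun x => a * cosT n x}

theorem const_mul_cosT_mem_posCos {a : ℝ} (ha : 0 ≤ a) (n : Fin d → ℤ) :
    (fun x => a * cosT n x) ∈ posCos d :=
  AddSubmonoid.subset_closure ⟨a, n, ha, rfl⟩

theorem const_mem_posCos {a : ℝ} (ha : 0 ≤ a) : (fun _ => a) ∈ posCos d := by
  simpa [cosT_zero] using const_mul_cosT_mem_posCos ha (0 : Fin d → ℤ)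

/-- The product-to-sum formula for cosines has positive coefficients. Hence powers of cos²(πxₖ) = (1
+ cos 2πxₖ)/2 stay in the cone. -/
theorem mul_mem_posCos {f g : Torus d → ℝ} (hf : f ∈ posCos d) (hg : g ∈ posCos d) :
    (fun x => f x * g x) ∈ posCos d := by
  refine AddSubmonoid.closure_induction₂ (motive := fun f g _ _ => (fun x => f x * g x) ∈ posCos d)
    ?_ ?_ ?_ ?_ ?_ hf hg
  · rintro _ _ ⟨a, n, ha, rfl⟩ ⟨c, m, hc, rfl⟩
    convert (posCos d).add_mem (const_mul_cosT_mem_posCos (a := a * c / 2) (by positivity) (n + m))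
      (const_mul_cosT_mem_posCos (a := a * c / 2) (by positivity) (n - m)) using 1
    funext x
    have := cosT_mul_cosT n m x
    simp only [Pi.add_apply]
    linear_combination (a * c) * this
  · intro f _
    simp only [Pi.zero_apply, zero_mul]
    exact (posCos d).zero_mem
  · intro f _
    simp only [Pi.zero_apply, mul_zero]
    exact (posCos d).zero_mem
  · intro f g h _ _ _ h1 h2
    simp only [Pi.add_apply, add_mul]
    exact (posCos d).add_mem h1 h2
  · intro f g h _ _ _ h1 h2
    simp only [Pi.add_apply, mul_add]
    exact (posCos d).add_mem h1 h2

theorem prod_mem_posCos (s : Finset (Fin d)) :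
    (fun x => ∏ k ∈ s, (1 - sinSq k x)) ∈ posCos d := by
  induction s using Finset.induction_on with
  | empty => simpa using const_mem_posCos zero_le_one
  | insert a s ha ih =>
    simp_rw [Finset.prod_insert ha]
    refine mul_mem_posCos ?_ ih
    convert (posCos d).add_mem (const_mem_posCos (a := 1 / 2) (by norm_num))
      (const_mul_cosT_mem_posCos (a := 1 / 2) (by norm_num) (Pi.single a 1)) using 1
    funext x
    simp only [sinSq, Pi.add_apply]
    ring

theorem const_mul_pow_mem_posCos {c : ℝ} (hc : 0 ≤ c) (N : ℕ) :
    (fun x => c * cosSqProd x ^ N) ∈ posCos d := by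
  refine mul_mem_posCos (const_mem_posCos hc) ?_
  induction N with
  | zero => simpa using const_mem_posCos zero_le_one
  | succ N ih =>
    simp_rw [pow_succ]
    exact mul_mem_posCos ih (prod_mem_posCos Finset.univ)

theorem posCos_mem_smoothFun {f : Torus d → ℝ} (hf : f ∈ posCos d) :
    f ∈ smoothFun d ∧ ∀ x, f (-x) = f x := by
  refine AddSubmonoid.closure_induction (motive := fun f _ => f ∈ smoothFun d ∧ ∀ x, f (-x) = f x)
    ?_ ?_ ?_ hf
  · rintro _ ⟨a, n, -, rfl⟩
    exact ⟨(smoothFun d).smul_mem a (cosT_mem n), fun x => by simp only [cosT_neg]⟩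
  · exact ⟨(smoothFun d).zero_mem, fun _ => rfl⟩
  · intro f g _ _ h1 h2
    exact ⟨(smoothFun d).add_mem h1.1 h2.1, fun x => by simp [h1.2, h2.2]⟩

theorem pderiv_odd {f : Torus d → ℝ} (hf : f ∈ smoothFun d) (heven : ∀ x, f (-x) = f x)
    (k : Fin d) (z : Torus d) : pderiv k f (-z) = -pderiv k f z := by
  have h1 := hasDerivAt_pderiv hf z k
  have h2 : HasDerivAt (fun t : ℝ => f (z + Pi.single k (t : UnitAddCircle))) (pderiv k f z)
      (-(0 : ℝ)) := by rwa [neg_zero]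
  have h3 := h2.scomp (0 : ℝ) (hasDerivAt_neg (0 : ℝ))
  refine pderiv_eq ?_
  have e : (fun t : ℝ => f (-z + Pi.single k (t : UnitAddCircle)))
      = (fun t : ℝ => f (z + Pi.single k (t : UnitAddCircle))) ∘ Neg.neg := by
    funext t
    simp only [Function.comp]
    rw [← heven]
    congr 1
    rw [AddCircle.coe_neg, Pi.single_neg, neg_add, neg_neg]
  rw [e]
  simpa using h3

theorem cosT_neg_left (n : Fin d → ℤ) (x : Torus d) : cosT (-n) x = cosT n x := by
  simp [cosT, UnitAddTorus.mFourier_neg]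

theorem sinT_neg_left (n : Fin d → ℤ) (x : Torus d) : sinT (-n) x = -sinT n x := by
  simp [sinT, UnitAddTorus.mFourier_neg]

theorem integral_cosT_mul_cosT_of_ne {n m : Fin d → ℤ} (h : n ≠ m) (h' : n ≠ -m) :
    ∫ x, cosT n x * cosT m x = 0 := by
  simp_rw [cosT_mul_cosT]
  have h1 : n + m ≠ 0 := fun e => h' (eq_neg_of_add_eq_zero_left e)
  rw [integral_div, integral_add (integrable_of_continuous (continuous_of_mem (cosT_mem _)))
    (integrable_of_continuous (continuous_of_mem (cosT_mem _))), integral_cosT_of_ne h1,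
    integral_cosT_of_ne (sub_ne_zero.2 h)]
  simp

theorem integral_cosT_mul_cosT_le_one (n m : Fin d → ℤ) : ∫ x, cosT n x * cosT m x ≤ 1 := by
  have hn := continuous_of_mem (cosT_mem n)
  have hm := continuous_of_mem (cosT_mem m)
  have : ∫ x, cosT n x * cosT m x ≤ ∫ _ : Torus d, (1 : ℝ) := by
    refine integral_mono (integrable_of_continuous (by fun_prop)) (integrable_const 1) fun x => ?_
    refine (le_abs_self _).trans ?_
    rw [abs_mul]
    exact mul_le_one₀ (abs_cosT_le n x) (abs_nonneg _) (abs_cosT_le m x)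
  simpa using this

/-- The Fourier energy controls each Fourier mode. -/
theorem energy_lower_bound {b : Fin d → Torus d → ℝ} (hb : ∀ j, Integrable (b j)) {l : ℝ}
    (hl : 0 ≤ l) {u : Torus d → ℝ} (hu : Measurable u) {M : ℝ} (hM : ∀ x, |u x| ≤ M)
    (heq : ∀ φ ∈ trig d, (∫ x, u x * (l * φ x - laplacian φ x))
      + ∑ j, ∫ x, b j x * u x * pderiv j φ x = 0)
    (m : Fin d → ℤ) {f : Torus d → ℝ} (hf : f ∈ posCos d) :
    (l + 4 * Real.pi ^ 2 * ∑ i, (m i : ℝ) ^ 2)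
        * ((∫ x, u x * cosT m x) ^ 2 + (∫ x, u x * sinT m x) ^ 2) * ∫ x, f x * cosT m x
      ≤ -∑ j, ∫ x, b j x * u x * ∫ y, u y * pderiv j f (x - y) := by
  have hui : Integrable u := (integrable_const M).mono' hu.aestronglyMeasurable
    (Eventually.of_forall hM)
  have hcu : ∀ {φ : Torus d → ℝ}, Continuous φ → Integrable fun x => u x * φ x := fun h =>
    integrable_mul_continuous hui h
  have hcosT := fun n : Fin d → ℤ => continuous_of_mem (cosT_mem n)
  have hsinT := fun n : Fin d → ℤ => continuous_of_mem (sinT_mem n)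
  let A : (Fin d → ℤ) → ℝ := fun n => (l + 4 * Real.pi ^ 2 * ∑ i, (n i : ℝ) ^ 2)
        * ((∫ x, u x * cosT n x) ^ 2 + (∫ x, u x * sinT n x) ^ 2)
  have hA0 : ∀ n, 0 ≤ A n := fun n => by positivity
  have hAneg : ∀ n, A (-n) = A n := fun n => by
    simp only [A, cosT_neg_left, sinT_neg_left, mul_neg, integral_neg, Pi.neg_apply, Int.cast_neg,
      neg_sq]
  change A m * _ ≤ _
  -- Both sides are additive in `f`, so a generator a cos(2πn·x) suffices; for it the right-hand
  -- side is exactly `a * A n`.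
  refine AddSubmonoid.closure_induction (motive := fun f _ => A m * ∫ x, f x * cosT m x
    ≤ -∑ j, ∫ x, b j x * u x * ∫ y, u y * pderiv j f (x - y)) ?_ ?_ ?_ hf
  · rintro _ ⟨a, n, ha, rfl⟩
    have e1 : ∀ j x, ∫ y, u y * pderiv j (fun x => a * cosT n x) (x - y)
        = a * ((∫ y, u y * cosT n y) * pderiv j (cosT n) x
          + (∫ y, u y * sinT n y) * pderiv j (sinT n) x) := fun j x => by
      have e : ∀ y, u y * pderiv j (fun x => a * cosT n x) (x - y)
          = (a * pderiv j (cosT n) x) * (u y * cosT n y)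
            + (a * pderiv j (sinT n) x) * (u y * sinT n y) := fun y => by
        rw [pderiv_const_mul (cosT_mem n), pderiv_cosT, pderiv_sinT]
        simp only [sinT_sub]
        ring
      simp_rw [e]
      rw [integral_add ((hcu (hcosT n)).const_mul _) ((hcu (hsinT n)).const_mul _),
        integral_const_mul, integral_const_mul]
      ring
    have e2 : ∀ j, ∫ x, b j x * u x * ∫ y, u y * pderiv j (fun x => a * cosT n x) (x - y)
        = a * ((∫ y, u y * cosT n y) * (∫ x, b j x * u x * pderiv j (cosT n) x)
          + (∫ y, u y * sinT n y) * ∫ x, b j x * u x * pderiv j (sinT n) x) := fun j => by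
      have hbu := integrable_mul_bounded (hb j) hu hM
      have i1 := integrable_mul_continuous hbu (continuous_pderiv (cosT_mem n) j)
      have i2 := integrable_mul_continuous hbu (continuous_pderiv (sinT_mem n) j)
      rw [← integral_const_mul, ← integral_const_mul, ← integral_add (i1.const_mul _)
        (i2.const_mul _), ← integral_const_mul]
      congr 1
      funext x
      rw [e1]
      ring
    -- The addition formula has separated the variables of the convolution; what remains is the
    -- equation tested with `cosT n` and `sinT n`, weighted by the corresponding coefficients of
    -- `u`.
    have e3 : -∑ j, ∫ x, b j x * u x * ∫ y, u y * pderiv j (fun x => a * cosT n x) (x - y)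
        = a * A n := by
      have h1 := heq _ (cosT_mem_trig n)
      have h2 := heq _ (sinT_mem_trig n)
      have e4 : ∀ x, u x * (l * cosT n x - laplacian (cosT n) x)
          = (l + 4 * Real.pi ^ 2 * ∑ i, (n i : ℝ) ^ 2) * (u x * cosT n x) := fun x => by
        rw [laplacian_cosT]; ring
      have e5 : ∀ x, u x * (l * sinT n x - laplacian (sinT n) x)
          = (l + 4 * Real.pi ^ 2 * ∑ i, (n i : ℝ) ^ 2) * (u x * sinT n x) := fun x => by
        rw [laplacian_sinT]; ring
      simp_rw [e4, integral_const_mul] at h1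
      simp_rw [e5, integral_const_mul] at h2
      simp_rw [e2]
      rw [← Finset.mul_sum, Finset.sum_add_distrib, ← Finset.mul_sum, ← Finset.mul_sum]
      simp only [A]
      linear_combination (-a * ∫ y, u y * cosT n y) * h1 + (-a * ∫ y, u y * sinT n y) * h2
    rw [e3]
    simp_rw [mul_assoc]
    rw [integral_const_mul, mul_left_comm]
    refine mul_le_mul_of_nonneg_left ?_ ha
    -- As `cosT n` and `cosT (-n)` agree, both signs belong to the same mode. All other frequencies
    -- are orthogonal to `cosT m`, and their energy `A n` is merely dropped.
    by_cases h : n = m ∨ n = -m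
    · have hAA : A n = A m := by
        rcases h with rfl | rfl
        · rfl
        · exact hAneg m
      rw [hAA]
      exact mul_le_of_le_one_right (hA0 m) (integral_cosT_mul_cosT_le_one n m)
    · rw [not_or] at h
      rw [integral_cosT_mul_cosT_of_ne h.1 h.2, mul_zero]
      exact hA0 n
  · have : ∀ j, pderiv j (0 : Torus d → ℝ) = 0 := fun j => pderiv_const j 0
    simp [this]
  · intro f g hf hg h1 h2
    obtain ⟨hf1, hf2⟩ := posCos_mem_smoothFun hf
    obtain ⟨hg1, hg2⟩ := posCos_mem_smoothFun hg
    have hc1 := continuous_of_mem hf1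
    have hc2 := continuous_of_mem hg1
    have e1 : ∫ x, (f + g) x * cosT m x = (∫ x, f x * cosT m x) + ∫ x, g x * cosT m x := by
      rw [← integral_add (integrable_mul_continuous (integrable_of_continuous hc1) (hcosT m))
        (integrable_mul_continuous (integrable_of_continuous hc2) (hcosT m))]
      congr 1; funext x; rw [Pi.add_apply]; ring
    have e2 : ∀ j, ∫ x, b j x * u x * ∫ y, u y * pderiv j (f + g) (x - y)
        = (∫ x, b j x * u x * ∫ y, u y * pderiv j f (x - y))
          + ∫ x, b j x * u x * ∫ y, u y * pderiv j g (x - y) := fun j => by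
      have i1 := (integral_convolution_odd (hb j) hu hM (continuous_pderiv hf1 j)
        (pderiv_odd hf1 hf2 j)).2.1
      have i2 := (integral_convolution_odd (hb j) hu hM (continuous_pderiv hg1 j)
        (pderiv_odd hg1 hg2 j)).2.1
      rw [← integral_add i1 i2]
      congr 1
      funext x
      rw [← mul_add, ← integral_add]
      · congr 2; funext y; rw [pderiv_add hf1 hg1, Pi.add_apply, mul_add]
      · exact hcu ((continuous_pderiv hf1 j).comp (continuous_const.sub continuous_id))
      · exact hcu ((continuous_pderiv hg1 j).comp (continuous_const.sub continuous_id))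
    rw [e1, mul_add]
    simp_rw [e2]
    rw [Finset.sum_add_distrib, neg_add]
    exact add_le_add h1 h2

/-! ### The approximate identity and the limit of the commutator -/

/-- The trigonometric approximate identity `∏ₖ cos² (π xₖ) ^ N`, normalized. -/
noncomputable def approxId (d N : ℕ) (x : Torus d) : ℝ :=
  (∫ y : Torus d, cosSqProd y ^ N)⁻¹ * cosSqProd x ^ N

theorem approxId_mem_posCos (N : ℕ) : approxId d N ∈ posCos d :=
  const_mul_pow_mem_posCos (inv_nonneg.2 (integral_cosSqProd_pow_pos N).le) N

theorem approxId_nonneg (N : ℕ) (x : Torus d) : 0 ≤ approxId d N x :=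
  mul_nonneg (inv_nonneg.2 (integral_cosSqProd_pow_pos N).le) (pow_nonneg (cosSqProd_nonneg x) N)

theorem integral_mul_approxId (N : ℕ) (ψ : Torus d → ℝ) :
    ∫ x, ψ x * approxId d N x
      = (∫ y : Torus d, cosSqProd y ^ N)⁻¹ * ∫ x, ψ x * cosSqProd x ^ N := by
  rw [← integral_const_mul]
  congr 1
  funext x
  rw [approxId]
  ring

theorem integral_approxId (N : ℕ) : ∫ x, approxId d N x = 1 := by
  have := integral_mul_approxId (d := d) N 1
  simp only [Pi.one_apply, one_mul] at this
  rw [this, inv_mul_cancel₀ (integral_cosSqProd_pow_pos N).ne']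

theorem integral_sinSqSum_mul_approxId (N : ℕ) :
    ∫ x, sinSqSum x * approxId d N x = d / (2 * N + 2) := by
  rw [integral_mul_approxId, integral_sinSqSum_mul_pow]
  have := (integral_cosSqProd_pow_pos (d := d) N).ne'
  field_simp

theorem continuous_approxId (N : ℕ) : Continuous (approxId d N) :=
  continuous_of_mem (posCos_mem_smoothFun (approxId_mem_posCos N)).1

theorem tendsto_const_div_nat (C : ℝ) : Tendsto (fun N : ℕ => C / (2 * N + 2 : ℝ)) atTop (𝓝 0) := by
  have h : Tendsto (fun N : ℕ => (2 * N + 2 : ℝ)) atTop atTop :=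
    tendsto_atTop_add_const_right _ _ (tendsto_natCast_atTop_atTop.const_mul_atTop two_pos)
  exact h.const_div_atTop C

/-- Concentration in the style of Chebyshev: |ψ − ψ(0)| ≤ ε/2 + C `sinSqSum`, and the mean of
`sinSqSum` under the kernel is d/(2N+2). -/
theorem tendsto_integral_approxId {ψ : Torus d → ℝ} (hψ : Continuous ψ) :
    Tendsto (fun N => ∫ x, ψ x * approxId d N x) atTop (𝓝 (ψ 0)) := by
  rw [Metric.tendsto_atTop]
  intro ε hε
  obtain ⟨C, hC0, hC⟩ := exists_le_add_mul_sinSqSum (τ := fun x => |ψ x - ψ 0|) (by fun_prop)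
    (by simp) (half_pos hε)
  have h1 := (tendsto_const_div_nat (C * d)).eventually_lt_const (half_pos hε)
  obtain ⟨N0, hN0⟩ := eventually_atTop.1 h1
  refine ⟨N0, fun N hN => ?_⟩
  have hρ := continuous_approxId (d := d) N
  have hS := continuous_sinSqSum (d := d)
  have e : (∫ x, ψ x * approxId d N x) - ψ 0 = ∫ x, (ψ x - ψ 0) * approxId d N x := by
    simp_rw [sub_mul]
    rw [integral_sub (integrable_of_continuous (by fun_prop))
      (integrable_of_continuous (by fun_prop)), integral_const_mul, integral_approxId, mul_one]
  rw [Real.dist_eq, e]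
  calc |∫ x, (ψ x - ψ 0) * approxId d N x|
      ≤ ∫ x, (ε / 2 * approxId d N x + C * (sinSqSum x * approxId d N x)) := by
        refine abs_integral_le_integral_abs.trans (integral_mono
          (integrable_of_continuous (by fun_prop)) (integrable_of_continuous (by fun_prop))
          fun x => ?_)
        simp only [abs_mul, abs_of_nonneg (approxId_nonneg N x)]
        have := mul_le_mul_of_nonneg_right (hC x) (approxId_nonneg N x)
        linarith
    _ = ε / 2 + C * d / (2 * N + 2) := by
        rw [integral_add (integrable_of_continuous (by fun_prop))
          (integrable_of_continuous (by fun_prop)), integral_const_mul, integral_const_mul,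
          integral_approxId, integral_sinSqSum_mul_approxId]
        ring
    _ < ε := by linarith [hN0 N hN]

theorem pderiv_approxId_succ (N : ℕ) (j : Fin d) (x : Torus d) :
    pderiv j (approxId d (N + 1)) x
      = (∫ y : Torus d, cosSqProd y ^ (N + 1))⁻¹ * ((N + 1) * cosSqProd x ^ N)
        * pderiv j cosSqProd x := by
  have : approxId d (N + 1)
    = fun x => (∫ y : Torus d, cosSqProd y ^ (N + 1))⁻¹ * cosSqProd x ^ (N + 1) := rfl
  rw [this, pderiv_const_mul (pow_mem cosSqProd_mem _)]
  simp only [pderiv_pow cosSqProd_mem, Nat.add_sub_cancel, Nat.cast_add, Nat.cast_one]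
  ring

/-- The gradient of the kernel carries a factor `sinCoord j` of size √S, where S is `sinSqSum`.
Together with the √S of the commutator bound this gives S, whose moment of order 1/N compensates the
factor N + 1. -/
theorem abs_pderiv_approxId_mul_le (N : ℕ) (j : Fin d) (x : Torus d) :
    |pderiv j (approxId d (N + 1)) x| * Real.sqrt (sinSqSum x)
      ≤ (∫ y : Torus d, cosSqProd y ^ (N + 1))⁻¹ * (2 * Real.pi * (N + 1))
        * (sinSqSum x * cosSqProd x ^ N) := by
  have hp := Real.pi_pos
  have hc := inv_nonneg.2 (integral_cosSqProd_pow_pos (d := d) (N + 1)).le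
  have hq := pow_nonneg (cosSqProd_nonneg x) N
  rw [pderiv_approxId_succ]
  generalize (∫ y : Torus d, cosSqProd y ^ (N + 1))⁻¹ = c at hc ⊢
  generalize cosSqProd x ^ N = Q at hq ⊢
  rw [abs_mul, abs_of_nonneg (by positivity)]
  have h1 := abs_pderiv_cosSqProd_le j x
  have h2 := abs_sinCoord_le j x
  have h3 : |pderiv j cosSqProd x| * Real.sqrt (sinSqSum x) ≤ 2 * Real.pi * sinSqSum x := by
    calc |pderiv j cosSqProd x| * Real.sqrt (sinSqSum x)
        ≤ (2 * Real.pi ^ 2 * (Real.sqrt (sinSqSum x) / Real.pi)) * Real.sqrt (sinSqSum x) := by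
          gcongr
          exact h1.trans (by gcongr)
      _ = 2 * Real.pi * (Real.sqrt (sinSqSum x) * Real.sqrt (sinSqSum x)) := by
          field_simp
      _ = _ := by rw [Real.mul_self_sqrt (sinSqSum_nonneg x)]
  rw [mul_assoc]
  refine (mul_le_mul_of_nonneg_left h3 (by positivity)).trans (le_of_eq ?_)
  ring

/-- The commutator tested with the gradient of the approximate identity recovers the diagonal of
the weak gradient. -/
theorem tendsto_integral_pderiv_commutator {b : Torus d → ℝ} {B : Fin d → Torus d → ℝ}
    (hb : Integrable b) (hB : ∀ k, Integrable (B k)) (hw : ∀ k, HasWeakPDeriv k b (B k))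
    {u : Torus d → ℝ} (hu : Measurable u) {M : ℝ} (hM : ∀ x, |u x| ≤ M) (j : Fin d) :
    Tendsto (fun N => ∫ z, pderiv j (approxId d (N + 1)) z
        * ∫ x, (b x - b (x - z)) * (u x * u (x - z)))
      atTop (𝓝 (-∫ x, B j x * u x ^ 2)) := by
  have hp := Real.pi_pos
  set e : Fin d → ℝ := fun k => ∫ x, B k x * u x ^ 2 with he
  set D : Torus d → ℝ := fun z => ∫ x, (b x - b (x - z)) * (u x * u (x - z)) with hD
  have hmem : ∀ N, approxId d N ∈ smoothFun d := fun N =>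
    (posCos_mem_smoothFun (approxId_mem_posCos N)).1
  have hκc : ∀ N, Continuous (pderiv j (approxId d N)) := fun N => continuous_pderiv (hmem N) j
  have hσc : ∀ k : Fin d, Continuous (sinCoord k) := fun k => continuous_of_mem (sinCoord_mem k)
  have hκD : ∀ N, Integrable fun z => pderiv j (approxId d N) z * D z := fun N =>
    (integral_convolution_odd hb hu hM (hκc N) (pderiv_odd (hmem N)
      (posCos_mem_smoothFun (approxId_mem_posCos N)).2 j)).1
  have hκσ : ∀ N, Integrable fun z => pderiv j (approxId d N) z * ∑ k, sinCoord k z * e k :=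
    fun N => integrable_of_continuous ((hκc N).mul
      (continuous_finsetSum _ fun k _ => (hσc k).mul continuous_const))
  -- Linear part: integration by parts puts the derivative on the sum of the `sinCoord k`, where ∂ⱼ
  -- selects `e j` with a factor equal to 1 at the origin.
  have hmain : Tendsto (fun N => ∫ z, pderiv j (approxId d (N + 1)) z
      * ∑ k, sinCoord k z * e k) atTop (𝓝 (-e j)) := by
    have h1 : ∀ N, ∫ z, pderiv j (approxId d N) z * ∑ k, sinCoord k z * e k
        = -(e j * ∫ z, (1 - 2 * sinSq j z) * approxId d N z) := fun N => by
      have hmemσ : (fun z => ∑ k, sinCoord k z * e k) ∈ smoothFun d := by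
        convert (smoothFun d).sum_mem (t := Finset.univ)
          (fun k _ => (smoothFun d).smul_mem (e k) (sinCoord_mem k)) using 1
        funext z
        simp [mul_comm]
      have h2 := integral_mul_pderiv hmemσ (hmem N) j
      have h3 : ∀ z, pderiv j (fun z => ∑ k, sinCoord k z * e k) z
          = e j * (1 - 2 * sinSq j z) := fun z => by
        have h4 : ∀ k, pderiv j (fun z => sinCoord k z * e k)
            = fun z => e k * (if j = k then 1 - 2 * sinSq k z else 0) := fun k => by
          have : (fun z => sinCoord k z * e k) = fun z => e k * sinCoord k z := by
            funext z; ring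
          rw [this, pderiv_const_mul (sinCoord_mem k), pderiv_sinCoord]
        rw [pderiv_sum _ fun k _ => by
          simpa only [mul_comm] using mul_mem (const_mem (e k)) (sinCoord_mem k)]
        simp [h4]
      simp_rw [h3] at h2
      simp_rw [mul_comm (pderiv j (approxId d N) _)]
      rw [h2, ← integral_const_mul]
      simp_rw [mul_assoc]
    simp_rw [h1]
    have h5 := tendsto_integral_approxId (d := d) (ψ := fun z => 1 - 2 * sinSq j z)
      (by have := continuous_sinSq j; fun_prop)
    have h6 := ((h5.comp (tendsto_add_atTop_nat 1)).const_mul (e j)).neg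
    simpa [sinSq, cosT_apply_zero, Function.comp_def] using h6
  have herr : Tendsto (fun N => ∫ z, pderiv j (approxId d (N + 1)) z
      * (D z - ∑ k, sinCoord k z * e k)) atTop (𝓝 0) := by
    rw [Metric.tendsto_atTop]
    intro ε hε
    -- The final estimate contains 2πdη, which this choice keeps below ε/2; the summand 1 keeps the
    -- denominator positive.
    set η := ε / (4 * Real.pi * d + 1) with hη
    have hηp : 0 < η := by positivity
    obtain ⟨C, hC0, hC⟩ := exists_commutator_bound hb hB hw hu hM hηp
    have h1 := (tendsto_const_div_nat (12 * Real.pi * C * d ^ 2)).eventually_lt_const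
      (half_pos hε)
    obtain ⟨N0, hN0⟩ := eventually_atTop.1 h1
    refine ⟨max N0 d, fun N hN => ?_⟩
    have hNd : d ≤ N + 1 := (le_max_right _ _).trans (hN.trans (Nat.le_succ N))
    have hN1 := hN0 N ((le_max_left _ _).trans hN)
    set Q := ∫ y : Torus d, cosSqProd y ^ N with hQ
    set Q1 := ∫ y : Torus d, cosSqProd y ^ (N + 1) with hQ1
    have hQ1p : 0 < Q1 := integral_cosSqProd_pow_pos (N + 1)
    have hQp : 0 < Q := integral_cosSqProd_pow_pos N
    have hQQ : Q ≤ 2 * Q1 := integral_cosSqProd_pow_succ_ge hNd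
    have hS := continuous_sinSqSum (d := d)
    have hq := continuous_cosSqProd (d := d)
    rw [Real.dist_eq, sub_zero]
    set c := Q1⁻¹ * (2 * Real.pi * (N + 1)) with hc
    have hc0 : 0 ≤ c := by positivity
    calc |∫ z, pderiv j (approxId d (N + 1)) z * (D z - ∑ k, sinCoord k z * e k)|
        ≤ ∫ z, c * (η * (sinSqSum z * cosSqProd z ^ N)
            + C * (sinSqSum z ^ 2 * cosSqProd z ^ N)) := by
          refine abs_integral_le_integral_abs.trans (integral_mono_of_nonneg
            (Eventually.of_forall fun _ => abs_nonneg _) (integrable_of_continuous (by fun_prop))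
            (Eventually.of_forall fun z => ?_))
          simp only [abs_mul]
          have h2 := mul_le_mul_of_nonneg_left (hC z)
            (abs_nonneg (pderiv j (approxId d (N + 1)) z))
          have h3 := mul_le_mul_of_nonneg_right (abs_pderiv_approxId_mul_le N j z)
            (by have := sinSqSum_nonneg z; positivity : 0 ≤ η + C * sinSqSum z)
          rw [← mul_assoc] at h2
          refine (h2.trans h3).trans (le_of_eq ?_)
          rw [hc]
          ring
      _ = c * (η * (∫ z : Torus d, sinSqSum z * cosSqProd z ^ N)
            + C * ∫ z : Torus d, sinSqSum z ^ 2 * cosSqProd z ^ N) := by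
          rw [integral_const_mul, integral_add (integrable_of_continuous (by fun_prop))
            (integrable_of_continuous (by fun_prop)), integral_const_mul, integral_const_mul]
      _ ≤ c * (η * (d / (2 * N + 2) * Q) + C * (3 * d ^ 2 / (2 * N + 2) ^ 2 * Q)) := by
          have h4 := integral_sinSqSum_mul_pow (d := d) N
          have h5 := integral_sinSqSum_sq_mul_pow_le (d := d) N
          rw [h4]
          gcongr
      _ = Q / Q1 * (Real.pi * d * η + 3 * Real.pi * C * d ^ 2 / (2 * N + 2)) := by
          rw [hc]
          field_simp
      _ ≤ 2 * (Real.pi * d * η + 3 * Real.pi * C * d ^ 2 / (2 * N + 2)) := by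
          gcongr
          rw [div_le_iff₀ hQ1p]
          exact hQQ
      _ = 2 * Real.pi * d * η + 6 * Real.pi * C * d ^ 2 / (2 * N + 2) := by ring
      _ < ε := by
          have h6 : 2 * Real.pi * d * η ≤ ε / 2 := by
            rw [hη, ← mul_div_assoc, div_le_iff₀ (by positivity)]
            nlinarith
          have h7 : 6 * Real.pi * C * d ^ 2 / (2 * N + 2)
              ≤ 12 * Real.pi * C * d ^ 2 / (2 * N + 2) := by gcongr; norm_num
          linarith
  have hsum := herr.add hmain
  rw [zero_add] at hsum
  refine hsum.congr fun N => ?_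
  rw [← integral_add _ (hκσ (N + 1))]
  · congr 1
    funext z
    ring
  · simp_rw [mul_sub]
    exact (hκD (N + 1)).sub (hκσ (N + 1))

/-- Bounded distributional solutions of `l u - Δ u - div (b u) = 0` have vanishing Fourier
coefficients wherever the symbol `l + 4π²|m|²` is positive. -/
theorem fourier_eq_zero_of_bounded_solution {b : Fin d → Torus d → ℝ}
    {B : Fin d → Fin d → Torus d → ℝ} (hb : ∀ j, Integrable (b j))
    (hB : ∀ j k, Integrable (B j k)) (hw : ∀ j k, HasWeakPDeriv k (b j) (B j k))
    (hdiv : ∀ᵐ x, ∑ j, B j j x = 0) {l : ℝ}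
    (hl : 0 ≤ l) {u : Torus d → ℝ} (hu : Measurable u) {M : ℝ} (hM : ∀ x, |u x| ≤ M)
    (heq : ∀ φ ∈ trig d, (∫ x, u x * (l * φ x - laplacian φ x))
      + ∑ j, ∫ x, b j x * u x * pderiv j φ x = 0)
    {m : Fin d → ℤ} (hm : 0 < l + 4 * Real.pi ^ 2 * ∑ i, (m i : ℝ) ^ 2) :
    ∫ x, u x * cosT m x = 0 ∧ ∫ x, u x * sinT m x = 0 := by
  have h1 := fun N => energy_lower_bound hb hl hu hM heq m (approxId_mem_posCos (d := d) (N + 1))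
  have h2 : ∀ N, -∑ j, ∫ x, b j x * u x * ∫ y, u y * pderiv j (approxId d (N + 1)) (x - y)
      = -∑ j, 1 / 2 * ∫ z, pderiv j (approxId d (N + 1)) z
        * ∫ x, (b j x - b j (x - z)) * (u x * u (x - z)) := fun N => by
    obtain ⟨hs, he⟩ := posCos_mem_smoothFun (approxId_mem_posCos (d := d) (N + 1))
    congr 1
    exact Finset.sum_congr rfl fun j _ =>
      (integral_convolution_odd (hb j) hu hM (continuous_pderiv hs j) (pderiv_odd hs he j)).2.2
  have h3 : Tendsto (fun N => -∑ j, 1 / 2 * ∫ z, pderiv j (approxId d (N + 1)) z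
        * ∫ x, (b j x - b j (x - z)) * (u x * u (x - z))) atTop (𝓝 0) := by
    -- The limits of the commutators add up to a multiple of ∫ (div b) u²; only here does the
    -- divergence condition enter.
    have h4 : ∑ j, ∫ x, B j j x * u x ^ 2 = 0 := by
      have hu2 : Measurable fun x => u x ^ 2 := hu.pow_const 2
      have hM2 : ∀ x, |u x ^ 2| ≤ M ^ 2 := fun x => by
        rw [abs_pow]; exact pow_le_pow_left₀ (abs_nonneg _) (hM x) 2
      rw [← integral_finsetSum _ fun j _ => integrable_mul_bounded (hB j j) hu2 hM2]
      refine integral_eq_zero_of_ae ?_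
      filter_upwards [hdiv] with x hx
      rw [← Finset.sum_mul, hx, zero_mul, Pi.zero_apply]
    have h5 := (tendsto_finsetSum (Finset.univ : Finset (Fin d)) fun j _ =>
      (tendsto_integral_pderiv_commutator (hb j) (hB j) (hw j) hu hM j).const_mul (1 / 2)).neg
    convert h5 using 2
    rw [← Finset.mul_sum, Finset.sum_neg_distrib, h4]
    simp
  have h6 : Tendsto (fun N => ∫ x, approxId d (N + 1) x * cosT m x) atTop (𝓝 1) := by
    have := (tendsto_integral_approxId (continuous_of_mem (cosT_mem m))).comp
      (tendsto_add_atTop_nat 1)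
    simpa [cosT_apply_zero, Function.comp_def, mul_comm] using this
  -- In the limit the energy of the mode `m`, with a positive symbol in front, is at most zero.
  have h7 := le_of_tendsto_of_tendsto' (h6.const_mul _) h3 fun N => (h1 N).trans_eq (h2 N)
  rw [mul_one] at h7
  have h8 : (∫ x, u x * cosT m x) ^ 2 + (∫ x, u x * sinT m x) ^ 2 ≤ 0 :=
    nonpos_of_mul_nonpos_right h7 hm
  constructor
  · nlinarith [sq_nonneg (∫ x, u x * cosT m x), sq_nonneg (∫ x, u x * sinT m x)]
  · nlinarith [sq_nonneg (∫ x, u x * cosT m x), sq_nonneg (∫ x, u x * sinT m x)]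

/-! ### The Sobolev space H¹ as a closed space of jets -/

theorem memLp_of_continuous {φ : Torus d → ℝ} (h : Continuous φ) (p : ℝ≥0∞) : MemLp φ p := by
  obtain ⟨C, -, hC⟩ := bounded_of_continuous h
  exact MemLp.of_bound h.aestronglyMeasurable C (Eventually.of_forall hC)

/-- Square integrable functions on the torus. -/
abbrev L2T (d : ℕ) : Type := Lp ℝ 2 (volume : Measure (Torus d))

theorem inner_L2T (f g : L2T d) : inner ℝ f g = ∫ x, f x * g x := by
  rw [L2.inner_def]
  congr 1
  funext x
  simp [mul_comm]

theorem inner_toLp_right (f : L2T d) {g : Torus d → ℝ} (hg : MemLp g 2) :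
    inner ℝ f (hg.toLp g) = ∫ x, f x * g x := by
  rw [inner_L2T]
  refine integral_congr_ae ?_
  filter_upwards [hg.coeFn_toLp] with x hx
  rw [hx]

theorem integrable_L2T (f : L2T d) : Integrable f := (Lp.memLp f).integrable (by norm_num)

/-- The Hilbert space of pairs `(v, g)` of a square integrable function and vector field. -/
abbrev JetSpace (d : ℕ) : Type := PiLp 2 fun _ : Option (Fin d) => L2T d

theorem inner_jet (x y : JetSpace d) :
    inner ℝ x y = inner ℝ (x none) (y none) + ∑ i, inner ℝ (x (some i)) (y (some i)) := by
  rw [PiLp.inner_apply, Fintype.sum_option]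

theorem norm_sq_jet (x : JetSpace d) :
    ‖x‖ ^ 2 = ‖x none‖ ^ 2 + ∑ i, ‖x (some i)‖ ^ 2 := by
  rw [PiLp.norm_sq_eq_of_L2, Fintype.sum_option]

theorem memLp_smooth (φ : smoothFun d) : MemLp (φ : Torus d → ℝ) 2 :=
  memLp_of_continuous (continuous_of_mem φ.2) 2

theorem memLp_pderiv (φ : smoothFun d) (i : Fin d) : MemLp (pderiv i (φ : Torus d → ℝ)) 2 :=
  memLp_of_continuous (continuous_pderiv φ.2 i) 2

/-- The map `φ ↦ (φ, ∇φ)`. -/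
noncomputable def jet (d : ℕ) : smoothFun d →ₗ[ℝ] JetSpace d where
  toFun φ := WithLp.toLp 2 fun o => o.elim
    ((memLp_smooth φ).toLp φ)
    fun i => (memLp_pderiv φ i).toLp (pderiv i φ)
  map_add' φ ψ := by
    ext1 o
    cases o with
    | none => exact MemLp.toLp_add (memLp_smooth φ) (memLp_smooth ψ)
    | some i =>
      rw [PiLp.add_apply]
      simp only [Option.elim]
      rw [← MemLp.toLp_add]
      congr 1
      exact pderiv_add φ.2 ψ.2 i
  map_smul' c φ := by
    ext1 o
    cases o with
    | none => exact MemLp.toLp_const_smul c (memLp_smooth φ)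
    | some i =>
      rw [PiLp.smul_apply]
      simp only [Option.elim, RingHom.id_apply]
      rw [← MemLp.toLp_const_smul]
      congr 1
      exact pderiv_smul φ.2 c i

theorem coeFn_jet_none (φ : smoothFun d) : jet d φ none =ᵐ[volume] (φ : Torus d → ℝ) :=
  (memLp_smooth φ).coeFn_toLp

theorem coeFn_jet_some (φ : smoothFun d) (i : Fin d) :
    jet d φ (some i) =ᵐ[volume] pderiv i (φ : Torus d → ℝ) :=
  (memLp_pderiv φ i).coeFn_toLp

theorem inner_jet_none (f : L2T d) (φ : smoothFun d) :
    inner ℝ f (jet d φ none) = ∫ x, f x * (φ : Torus d → ℝ) x :=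
  inner_toLp_right f (memLp_smooth φ)

theorem inner_jet_some (f : L2T d) (φ : smoothFun d) (i : Fin d) :
    inner ℝ f (jet d φ (some i)) = ∫ x, f x * pderiv i (φ : Torus d → ℝ) x :=
  inner_toLp_right f (memLp_pderiv φ i)

/-- The Sobolev space `H¹`, as the closure of the jets of smooth functions. -/
noncomputable def sobolev (d : ℕ) : Submodule ℝ (JetSpace d) := (jet d).range.topologicalClosure

theorem jet_mem_sobolev (φ : smoothFun d) : jet d φ ∈ sobolev d :=
  Submodule.le_topologicalClosure _ ⟨φ, rfl⟩

theorem isClosed_sobolev : IsClosed (sobolev d : Set (JetSpace d)) :=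
  Submodule.isClosed_topologicalClosure _

/-- A closed condition that holds for smooth functions holds in `H¹`. -/
theorem sobolev_induction {P : JetSpace d → Prop} (hP : IsClosed {x | P x})
    (h : ∀ φ, P (jet d φ)) {x : JetSpace d} (hx : x ∈ sobolev d) : P x := by
  have : (sobolev d : Set (JetSpace d)) ⊆ {x | P x} := by
    rw [sobolev, Submodule.topologicalClosure_coe]
    refine closure_minimal ?_ hP
    rintro _ ⟨φ, rfl⟩
    exact h φ
  exact this hx

theorem continuous_jet_apply (o : Option (Fin d)) : Continuous fun x : JetSpace d => x o := by
  fun_prop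

theorem hasWeakPDeriv_of_mem {x : JetSpace d} (hx : x ∈ sobolev d) (i : Fin d) :
    HasWeakPDeriv i (x none) (x (some i)) := by
  intro φ hφ
  have h := sobolev_induction
    (P := fun x => inner ℝ (x none) (jet d ⟨φ, hφ⟩ (some i))
      = -inner ℝ (x (some i)) (jet d ⟨φ, hφ⟩ none))
    (isClosed_eq (by fun_prop) (by fun_prop)) (fun ψ => ?_) hx
  · rw [inner_jet_some, inner_jet_none] at h
    exact h
  · rw [inner_jet_some, inner_jet_none]
    have h1 : ∫ x, jet d ψ none x * pderiv i φ x = ∫ x, (ψ : Torus d → ℝ) x * pderiv i φ x := by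
      refine integral_congr_ae ?_
      filter_upwards [coeFn_jet_none ψ] with x hx
      rw [hx]
    have h2 : ∫ x, jet d ψ (some i) x * φ x
        = ∫ x, pderiv i (ψ : Torus d → ℝ) x * φ x := by
      refine integral_congr_ae ?_
      filter_upwards [coeFn_jet_some ψ i] with x hx
      rw [hx]
    exact h1.trans ((integral_mul_pderiv ψ.2 hφ i).trans (congrArg Neg.neg h2.symm))

theorem integral_weak_grad_eq {v : Torus d → ℝ} {g : Fin d → Torus d → ℝ} (hv : Integrable v)
    (hw : ∀ i, HasWeakPDeriv i v (g i)) {φ : Torus d → ℝ} (hφ : φ ∈ smoothFun d) :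
    ∑ i, ∫ x, g i x * pderiv i φ x = -∫ x, v x * laplacian φ x := by
  have h1 : ∀ i, ∫ x, g i x * pderiv i φ x = -∫ x, v x * pderiv i (pderiv i φ) x := fun i => by
    rw [hw i _ (pderiv_mem hφ i), neg_neg]
  simp_rw [h1, laplacian, Finset.mul_sum]
  rw [integral_finsetSum _ fun i _ => integrable_mul_continuous hv
    (continuous_pderiv (pderiv_mem hφ i) i), Finset.sum_neg_distrib]

/-- `H = W`: a pair `(v, g)` with `g = ∇v` weakly is a limit of smooth jets. -/
theorem mem_sobolev_of_hasWeakPDeriv {x : JetSpace d}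
    (hw : ∀ i, HasWeakPDeriv i (x none) (x (some i))) : x ∈ sobolev d := by
  have : CompleteSpace (sobolev d) := isClosed_sobolev.completeSpace_coe
  set p : JetSpace d := (sobolev d).starProjection x with hp
  have hpm : p ∈ sobolev d := Submodule.starProjection_apply_mem _ _
  have horth : x - p ∈ (sobolev d)ᗮ := Submodule.sub_starProjection_mem_orthogonal _
  set y := x - p with hy
  have hyw : ∀ i, HasWeakPDeriv i (y none) (y (some i)) := by
    intro i φ hφ
    have h1 := hw i φ hφ
    have h2 := hasWeakPDeriv_of_mem hpm i φ hφ
    have c := continuous_of_mem hφ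
    have c' := continuous_pderiv hφ i
    have e1 : ∫ z, y none z * pderiv i φ z
        = (∫ z, x none z * pderiv i φ z) - ∫ z, p none z * pderiv i φ z := by
      rw [← integral_sub (integrable_mul_continuous (integrable_L2T _) c')
        (integrable_mul_continuous (integrable_L2T _) c')]
      refine integral_congr_ae ?_
      filter_upwards [Lp.coeFn_sub (x none) (p none)] with z hz
      have : y none z = x none z - p none z := hz
      rw [this, sub_mul]
    have e2 : ∫ z, y (some i) z * φ z
        = (∫ z, x (some i) z * φ z) - ∫ z, p (some i) z * φ z := by
      rw [← integral_sub (integrable_mul_continuous (integrable_L2T _) c)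
        (integrable_mul_continuous (integrable_L2T _) c)]
      refine integral_congr_ae ?_
      filter_upwards [Lp.coeFn_sub (x (some i)) (p (some i))] with z hz
      have : y (some i) z = x (some i) z - p (some i) z := hz
      rw [this, sub_mul]
    rw [e1, e2, h1, h2]
    ring
  -- For an eigenfunction with −Δφ = cφ, orthogonality of `y` to the jet of φ in H¹ reads (1 + c) ∫
  -- yφ = 0. So the residual of the projection has no Fourier coefficients.
  have hy0 : ∀ φ : smoothFun d, ∀ c : ℝ, (∀ z, laplacian (φ : Torus d → ℝ) z = -c * φ.1 z) →
      0 ≤ c → ∫ z, y none z * (φ : Torus d → ℝ) z = 0 := by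
    intro φ c hc hc0
    have h1 : inner ℝ (jet d φ) y = 0 := (Submodule.mem_orthogonal _ _).1 horth _ (jet_mem_sobolev φ)
    rw [real_inner_comm, inner_jet, inner_jet_none] at h1
    simp_rw [inner_jet_some] at h1
    rw [integral_weak_grad_eq (integrable_L2T _) hyw φ.2] at h1
    simp_rw [hc] at h1
    have h2 : ∀ z, y none z * (-c * φ.1 z) = -c * (y none z * φ.1 z) := fun z => by ring
    simp_rw [h2, integral_const_mul] at h1
    have h3 : (1 + c) * ∫ z, y none z * φ.1 z = 0 := by linarith
    rcases mul_eq_zero.1 h3 with h | h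
    · linarith
    · exact h
  have hnn : ∀ n : Fin d → ℤ, 0 ≤ 4 * Real.pi ^ 2 * ∑ i, (n i : ℝ) ^ 2 := fun n => by positivity
  have h0 : (y none : Torus d → ℝ) =ᵐ[volume] 0 := ae_eq_zero_of_cosT_sinT (integrable_L2T _)
    (fun n => hy0 ⟨_, cosT_mem n⟩ _ (laplacian_cosT n) (hnn n))
    (fun n => hy0 ⟨_, sinT_mem n⟩ _ (laplacian_sinT n) (hnn n))
  have hi : ∀ i, (y (some i) : Torus d → ℝ) =ᵐ[volume] 0 := fun i => by
    refine ae_eq_zero_of_trig (integrable_L2T _) fun φ hφ => ?_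
    have h1 := hyw i φ (trig_le hφ)
    have h2 : ∫ z, y none z * pderiv i φ z = 0 := by
      refine integral_eq_zero_of_ae ?_
      filter_upwards [h0] with z hz
      simp [hz]
    linarith
  have hyz : y = 0 := by
    ext1 o
    cases o with
    | none => exact (Lp.eq_zero_iff_ae_eq_zero).2 h0
    | some i => exact (Lp.eq_zero_iff_ae_eq_zero).2 (hi i)
  rw [sub_eq_zero.1 hyz]
  exact hpm

/-! ### Parseval, Poincaré and Rellich -/

theorem volume_unitAddCircle : (volume : Measure UnitAddCircle) = AddCircle.haarAddCircle := by
  have := AddCircle.volume_eq_smul_haarAddCircle (T := 1)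
  rw [ENNReal.ofReal_one, one_smul] at this
  exact this

theorem hasSum_sq_mFourier (f : Lp ℂ 2 (volume : Measure (Torus d))) :
    HasSum (fun n => ‖∫ t, UnitAddTorus.mFourier (-n) t • f t‖ ^ 2) (∫ t, ‖f t‖ ^ 2) := by
  -- The volume and the Haar measure of the circle are only propositionally equal; a variable
  -- measure allows the substitution inside the type of `f`.
  have key : ∀ μ : Measure UnitAddCircle, μ = AddCircle.haarAddCircle →
      ∀ f : Lp ℂ 2 (Measure.pi fun _ : Fin d => μ),
      HasSum (fun n => ‖∫ t, UnitAddTorus.mFourier (-n) t • f t ∂(Measure.pi fun _ => μ)‖ ^ 2)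
        (∫ t, ‖f t‖ ^ 2 ∂(Measure.pi fun _ => μ)) := by
    rintro _ rfl f
    exact UnitAddTorus.hasSum_sq_mFourierCoeff f
  exact key _ volume_unitAddCircle f

/-- Parseval's identity for real functions. -/
theorem hasSum_parseval (f : L2T d) :
    HasSum (fun n => (∫ x, f x * cosT n x) ^ 2 + (∫ x, f x * sinT n x) ^ 2) (‖f‖ ^ 2) := by
  have hf : MemLp (fun x => (f x : ℂ)) 2 := (Lp.memLp f).ofReal
  have h := hasSum_sq_mFourier (hf.toLp _)
  have e1 : ∫ t, ‖hf.toLp _ t‖ ^ 2 = ‖f‖ ^ 2 := by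
    rw [← real_inner_self_eq_norm_sq, inner_L2T]
    refine integral_congr_ae ?_
    filter_upwards [hf.coeFn_toLp] with x hx
    rw [hx, Complex.norm_real, Real.norm_eq_abs, sq_abs, sq]
  have e2 : ∀ n, ‖∫ t, UnitAddTorus.mFourier (-n) t • hf.toLp _ t‖ ^ 2
      = (∫ x, f x * cosT n x) ^ 2 + (∫ x, f x * sinT n x) ^ 2 := fun n => by
    have hc : Integrable fun x => f x * cosT n x :=
      integrable_mul_continuous (integrable_L2T f) (continuous_of_mem (cosT_mem n))
    have hs : Integrable fun x => f x * sinT n x :=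
      integrable_mul_continuous (integrable_L2T f) (continuous_of_mem (sinT_mem n))
    have e3 : ∫ t, UnitAddTorus.mFourier (-n) t • hf.toLp _ t
        = ∫ t, (((f t * cosT n t : ℝ) : ℂ) - ((f t * sinT n t : ℝ) : ℂ) * Complex.I) := by
      refine integral_congr_ae ?_
      filter_upwards [hf.coeFn_toLp] with x hx
      rw [hx, UnitAddTorus.mFourier_neg]
      apply Complex.ext <;> simp [cosT, sinT, mul_comm]
    have hs' : Integrable fun t => ((f t * sinT n t : ℝ) : ℂ) * Complex.I := hs.ofReal.mul_const _
    have hc' : Integrable fun t => ((f t * cosT n t : ℝ) : ℂ) := hc.ofReal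
    rw [e3, integral_sub hc' hs', integral_mul_const, integral_complex_ofReal,
      integral_complex_ofReal, ← Complex.normSq_eq_norm_sq, Complex.normSq_apply]
    simp
    ring
  rw [e1] at h
  simpa only [e2] using h

/-- A weak derivative tested with a cosine gives the sine coefficient and conversely, up to the
factor ±2π`n i`; the squares then add up. -/
theorem fourier_grad_sq {x : JetSpace d} (hx : x ∈ sobolev d) (n : Fin d → ℤ) :
    ∑ i, ((∫ z, x (some i) z * cosT n z) ^ 2 + (∫ z, x (some i) z * sinT n z) ^ 2)
      = (4 * Real.pi ^ 2 * ∑ i, (n i : ℝ) ^ 2)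
        * ((∫ z, x none z * cosT n z) ^ 2 + (∫ z, x none z * sinT n z) ^ 2) := by
  rw [Finset.mul_sum, Finset.sum_mul]
  refine Finset.sum_congr rfl fun i _ => ?_
  have h1 := hasWeakPDeriv_of_mem hx i _ (cosT_mem n)
  have h2 := hasWeakPDeriv_of_mem hx i _ (sinT_mem n)
  rw [pderiv_cosT] at h1
  rw [pderiv_sinT] at h2
  have e1 : ∀ z, x none z * -(2 * Real.pi * n i * sinT n z)
      = -(2 * Real.pi * n i) * (x none z * sinT n z) := fun z => by ring
  have e2 : ∀ z, x none z * (2 * Real.pi * n i * cosT n z)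
      = (2 * Real.pi * n i) * (x none z * cosT n z) := fun z => by ring
  simp_rw [e1, integral_const_mul] at h1
  simp_rw [e2, integral_const_mul] at h2
  have h1' := neg_eq_iff_eq_neg.2 h1
  rw [← neg_eq_iff_eq_neg.2 h1, ← neg_eq_iff_eq_neg.2 h2]
  ring

/-- Spectral splitting of the `L²` norm: the high frequencies are controlled by the gradient. -/
theorem norm_sq_le_of_spectral_gap {x : JetSpace d} (hx : x ∈ sobolev d)
    (S : Finset (Fin d → ℤ)) {κ : ℝ}
    (hS : ∀ n ∉ S, κ ≤ 4 * Real.pi ^ 2 * ∑ i, (n i : ℝ) ^ 2) :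
    κ * ‖x none‖ ^ 2 ≤ κ * ∑ n ∈ S, ((∫ z, x none z * cosT n z) ^ 2
      + (∫ z, x none z * sinT n z) ^ 2) + ∑ i, ‖x (some i)‖ ^ 2 := by
  set a : (Fin d → ℤ) → ℝ := fun n => (∫ z, x none z * cosT n z) ^ 2
      + (∫ z, x none z * sinT n z) ^ 2 with ha
  have ha0 : ∀ n, 0 ≤ a n := fun n => by positivity
  have h1 : HasSum a (‖x none‖ ^ 2) := hasSum_parseval (x none)
  have h2 : HasSum (fun n => (4 * Real.pi ^ 2 * ∑ i, (n i : ℝ) ^ 2) * a n)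
      (∑ i, ‖x (some i)‖ ^ 2) := by
    have := hasSum_sum (s := Finset.univ) fun i _ => hasSum_parseval (x (some i))
    simpa only [fourier_grad_sq hx] using this
  have h3 : HasSum (fun n => if n ∈ S then κ * a n else 0) (κ * ∑ n ∈ S, a n) := by
    rw [Finset.mul_sum]
    have : HasSum (fun n => if n ∈ S then κ * a n else 0)
        (∑ n ∈ S, if n ∈ S then κ * a n else 0) :=
      hasSum_sum_of_ne_finset_zero fun n hn => by simp [hn]
    convert this using 1
    exact Finset.sum_congr rfl fun n hn => by simp [hn]
  refine hasSum_le (fun n => ?_) (h1.mul_left κ) (h3.add h2)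
  by_cases hn : n ∈ S
  · simp only [hn, if_true]
    have : 0 ≤ (4 * Real.pi ^ 2 * ∑ i, (n i : ℝ) ^ 2) * a n := mul_nonneg (by positivity) (ha0 n)
    linarith
  · simp only [hn, if_false, zero_add]
    exact mul_le_mul_of_nonneg_right (hS n hn) (ha0 n)

/-- The Poincaré inequality. -/
theorem poincare {x : JetSpace d} (hx : x ∈ sobolev d) (h0 : ∫ z, x none z = 0) :
    ‖x none‖ ^ 2 ≤ ∑ i, ‖x (some i)‖ ^ 2 := by
  -- Only the frequency 0 is removed, and there the zero mean kills the coefficient. The gap κ = 1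
  -- is crude but sufficient.
  have h := norm_sq_le_of_spectral_gap hx {0} (κ := 1) fun n hn => ?_
  · simpa [cosT_zero, sinT_zero, h0] using h
  · have hn' : n ≠ 0 := by simpa using hn
    obtain ⟨i, hi⟩ := Function.ne_iff.1 hn'
    have h1 : (1 : ℝ) ≤ (n i : ℝ) ^ 2 := by
      have : 1 ≤ (n i) ^ 2 := by
        have := sq_nonneg (n i)
        have h2 : (n i) ^ 2 ≠ 0 := pow_ne_zero 2 hi
        omega
      exact_mod_cast this
    have h2 : (n i : ℝ) ^ 2 ≤ ∑ i, (n i : ℝ) ^ 2 :=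
      Finset.single_le_sum (f := fun i => (n i : ℝ) ^ 2) (fun _ _ => sq_nonneg _)
        (Finset.mem_univ i)
    nlinarith [Real.pi_gt_three]

instance : TopologicalSpace.SeparableSpace (L2T d) := by
  have : Fact ((2 : ℝ≥0∞) ≠ ⊤) := ⟨by norm_num⟩
  infer_instance

instance : TopologicalSpace.SeparableSpace (JetSpace d) :=
  (PiLp.homeomorph 2 fun _ : Option (Fin d) => L2T d).symm.surjective.denseRange.separableSpace
    (PiLp.homeomorph 2 fun _ : Option (Fin d) => L2T d).symm.continuous

/-- Weak compactness in `H¹` together with Rellich's theorem. -/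
theorem exists_subseq_tendsto {x : ℕ → JetSpace d} (hx : ∀ n, x n ∈ sobolev d) {C : ℝ}
    (hC : ∀ n, ‖x n‖ ≤ C) :
    ∃ y ∈ sobolev d, ∃ σ : ℕ → ℕ, StrictMono σ ∧
      (∀ z, Tendsto (fun n => inner ℝ (x (σ n)) z) atTop (𝓝 (inner ℝ y z))) ∧
      Tendsto (fun n => x (σ n) none) atTop (𝓝 (y none)) ∧
      ∀ᵐ z, Tendsto (fun n => x (σ n) none z) atTop (𝓝 (y none z)) := by
  have : CompleteSpace (sobolev d) := isClosed_sobolev.completeSpace_coe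
  obtain ⟨T, -, σ, hσ, hT⟩ := WeakDual.isSeqCompact_closedBall ℝ (JetSpace d) 0 C
    (x := fun n => StrongDual.toWeakDual (InnerProductSpace.toDual ℝ (JetSpace d) (x n)))
    (fun n => by simpa using hC n)
  set y := (InnerProductSpace.toDual ℝ (JetSpace d)).symm (WeakDual.toStrongDual T) with hy
  have hweak : ∀ z, Tendsto (fun n => inner ℝ (x (σ n)) z) atTop (𝓝 (inner ℝ y z)) := fun z => by
    have h1 := (WeakDual.eval_continuous z).continuousAt.tendsto.comp hT
    have h2 : inner ℝ y z = T z := by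
      rw [hy, InnerProductSpace.toDual_symm_apply]
      rfl
    rw [h2]
    exact h1
  have hyH : y ∈ sobolev d := by
    rw [← Submodule.orthogonal_orthogonal (sobolev d)]
    refine (Submodule.mem_orthogonal _ _).2 fun z hz => ?_
    have h1 := hweak z
    have h2 : ∀ n, inner ℝ (x (σ n)) z = 0 := fun n =>
      (Submodule.mem_orthogonal _ _).1 hz _ (hx (σ n))
    simp_rw [h2] at h1
    rw [real_inner_comm]
    exact (tendsto_nhds_unique h1 tendsto_const_nhds)
  have hstrong : Tendsto (fun n => x (σ n) none) atTop (𝓝 (y none)) := by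
    rw [tendsto_iff_norm_sub_tendsto_zero]
    set w : ℕ → JetSpace d := fun n => x (σ n) - y with hw
    have hwH : ∀ n, w n ∈ sobolev d := fun n => (sobolev d).sub_mem (hx _) hyH
    have hwC : ∀ n, ‖w n‖ ≤ C + ‖y‖ := fun n =>
      (norm_sub_le _ _).trans (add_le_add_left (hC _) _)
    -- Weak convergence tested with the vector (φ, 0).
    have hcoef : ∀ φ : smoothFun d, Tendsto (fun n => ∫ z, w n none z * (φ : Torus d → ℝ) z)
        atTop (𝓝 0) := fun φ => by
      have h1 := (hweak (WithLp.toLp 2 fun o => o.elim (jet d φ none) fun _ => 0)).sub_const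
        (inner ℝ y (WithLp.toLp 2 fun o => o.elim (jet d φ none) fun _ => 0))
      rw [sub_self] at h1
      refine h1.congr fun n => ?_
      rw [← inner_sub_left, inner_jet, ← inner_jet_none]
      simp [hw]
    rw [Metric.tendsto_atTop]
    intro ε hε
    -- Frequencies beyond `R` contribute at most (C + ‖y‖)²/R < ε²/2 to the squared norm; the
    -- finitely many others converge to zero.
    obtain ⟨R, hR⟩ := exists_nat_gt (2 * (C + ‖y‖) ^ 2 / ε ^ 2)
    let S : Finset (Fin d → ℤ) := Fintype.piFinset fun _ => Finset.Icc (-(R : ℤ)) R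
    have hS : ∀ n ∉ S, (R : ℝ) ≤ 4 * Real.pi ^ 2 * ∑ i, (n i : ℝ) ^ 2 := fun n hn => by
      simp only [S, Fintype.mem_piFinset, Finset.mem_Icc, not_forall] at hn
      obtain ⟨i, hi⟩ := hn
      have h1 : (R : ℤ) ≤ (n i) ^ 2 := by
        rw [← abs_le, not_le] at hi
        have h0 : (0 : ℤ) ≤ R := Int.natCast_nonneg R
        nlinarith [sq_abs (n i)]
      have h1' : (R : ℝ) ≤ (n i : ℝ) ^ 2 := by exact_mod_cast h1
      have h2 : (n i : ℝ) ^ 2 ≤ ∑ i, (n i : ℝ) ^ 2 :=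
        Finset.single_le_sum (f := fun i => (n i : ℝ) ^ 2) (fun _ _ => sq_nonneg _)
          (Finset.mem_univ i)
      have h3 : (1 : ℝ) ≤ 4 * Real.pi ^ 2 := by nlinarith [Real.pi_gt_three]
      exact (h1'.trans h2).trans (le_mul_of_one_le_left (by positivity) h3)
    have hlow : Tendsto (fun n => ∑ m ∈ S, ((∫ z, w n none z * cosT m z) ^ 2
        + (∫ z, w n none z * sinT m z) ^ 2)) atTop (𝓝 0) := by
      have := tendsto_finsetSum S fun m _ =>
        ((hcoef ⟨_, cosT_mem m⟩).pow 2).add ((hcoef ⟨_, sinT_mem m⟩).pow 2)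
      simpa using this
    have hR0 : (0 : ℝ) < R := lt_of_le_of_lt (by positivity) hR
    obtain ⟨N, hN⟩ := eventually_atTop.1
      (hlow.eventually_lt_const (by positivity : 0 < ε ^ 2 / 2))
    refine ⟨N, fun n hn => ?_⟩
    rw [Real.dist_eq, sub_zero, abs_norm]
    have h1 := norm_sq_le_of_spectral_gap (hwH n) S hS
    have h2 : ∑ i, ‖w n (some i)‖ ^ 2 ≤ (C + ‖y‖) ^ 2 := by
      have h3 := norm_sq_jet (w n)
      have h4 := pow_le_pow_left₀ (norm_nonneg _) (hwC n) 2
      nlinarith [sq_nonneg ‖w n none‖]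
    have h5 := hN n hn
    rw [div_lt_iff₀ (by positivity)] at hR
    have h6 : R * ‖w n none‖ ^ 2 < R * ε ^ 2 := by nlinarith
    exact lt_of_pow_lt_pow_left₀ 2 hε.le (lt_of_mul_lt_mul_left h6 hR0.le)
  -- A further subsequence converges almost everywhere, as needed later to pass pointwise bounds to
  -- the limit.
  have hmeas : TendstoInMeasure volume (fun n => (x (σ n) none : Torus d → ℝ)) atTop (y none) :=
    tendstoInMeasure_of_tendsto_Lp hstrong
  obtain ⟨τ, hτ, hae⟩ := hmeas.exists_seq_tendsto_ae
  exact ⟨y, hyH, σ ∘ τ, hσ.comp hτ, fun z => (hweak z).comp hτ.tendsto_atTop,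
    hstrong.comp hτ.tendsto_atTop, hae⟩

/-! ### Uniqueness of bounded solutions -/

theorem exists_ae_bound {u : Torus d → ℝ} (hu : MemLp u ⊤) : ∃ M, 0 ≤ M ∧ ∀ᵐ x, |u x| ≤ M := by
  have h : eLpNormEssSup u volume ≠ ⊤ := by
    rw [← eLpNorm_exponent_top]
    exact hu.2.ne
  refine ⟨(eLpNormEssSup u volume).toReal, ENNReal.toReal_nonneg, ?_⟩
  filter_upwards [enorm_ae_le_eLpNormEssSup u volume] with x hx
  rw [← ENNReal.ofReal_le_iff_le_toReal h]
  rwa [← Real.norm_eq_abs, ofReal_norm]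

theorem exists_bounded_representative {u : Torus d → ℝ} (hu : MemLp u ⊤) :
    ∃ v : Torus d → ℝ, Measurable v ∧ (∃ M, ∀ x, |v x| ≤ M) ∧ u =ᵐ[volume] v := by
  obtain ⟨M, hM0, hM⟩ := exists_ae_bound hu
  refine ⟨fun x => max (-M) (min M (hu.1.mk u x)),
    measurable_const.max (measurable_const.min hu.1.stronglyMeasurable_mk.measurable),
    ⟨M, fun x => abs_le.2 ⟨le_max_left _ _, max_le (by linarith) (min_le_left _ _)⟩⟩, ?_⟩
  filter_upwards [hM, hu.1.ae_eq_mk] with x h1 h2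
  rw [← h2, min_eq_right (abs_le.1 h1).2, max_eq_right (abs_le.1 h1).1]

theorem integrable_mul_of_memLp_top {f u : Torus d → ℝ} (hf : Integrable f) (hu : MemLp u ⊤) :
    Integrable fun x => f x * u x := by
  obtain ⟨v, hv, ⟨M, hM⟩, huv⟩ := exists_bounded_representative hu
  refine (integrable_mul_bounded hf hv hM).congr ?_
  filter_upwards [huv] with x hx
  rw [hx]

/-- A weakly divergence-free Sobolev vector field has vanishing divergence almost everywhere. -/
theorem ae_div_eq_zero {b : Fin d → Torus d → ℝ} {B : Fin d → Fin d → Torus d → ℝ}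
    (hB : ∀ j k, Integrable (B j k)) (hw : ∀ j k, HasWeakPDeriv k (b j) (B j k))
    (hdiv : ∀ φ ∈ smoothFun d, ∑ j, ∫ x, b j x * pderiv j φ x = 0) :
    ∀ᵐ x, ∑ j, B j j x = 0 := by
  have hint : Integrable fun x => ∑ j, B j j x := integrable_finsetSum _ fun j _ => hB j j
  refine ae_eq_zero_of_trig hint fun φ hφ => ?_
  have h := hdiv φ (trig_le hφ)
  simp_rw [fun j => hw j j φ (trig_le hφ), Finset.sum_neg_distrib] at h
  simp_rw [Finset.sum_mul]
  rw [integral_finsetSum _ fun j _ => integrable_mul_continuous (hB j j)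
    (continuous_of_mem (trig_le hφ))]
  linarith

/-- Bounded distributional solutions of `l u - Δu - b · ∇u = 0` vanish. -/
theorem ae_eq_zero_of_bounded_solution {b : Fin d → Torus d → ℝ} (hb : ∀ j, MemW1 (b j) 1)
    (hdiv : ∀ φ ∈ smoothFun d, ∑ j, ∫ x, b j x * pderiv j φ x = 0) {l : ℝ} (hl : 0 ≤ l)
    {u : Torus d → ℝ} (hu : MemLp u ⊤) (h0 : l = 0 → ∫ x, u x = 0)
    (heq : ∀ φ ∈ trig d, (∫ x, u x * (l * φ x - laplacian φ x))
      + ∑ j, ∫ x, b j x * u x * pderiv j φ x = 0) : u =ᵐ[volume] 0 := by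
  choose B hB hw using fun j => (hb j).2
  have hBi : ∀ j k, Integrable (B j k) := fun j k => memLp_one_iff_integrable.1 (hB j k)
  have hbi : ∀ j, Integrable (b j) := fun j => memLp_one_iff_integrable.1 (hb j).1
  obtain ⟨v, hv, ⟨M, hM⟩, huv⟩ := exists_bounded_representative hu
  have hint : ∀ F : Torus d → ℝ → ℝ, ∫ x, F x (v x) = ∫ x, F x (u x) := fun F => by
    refine integral_congr_ae ?_
    filter_upwards [huv] with x hx
    rw [hx]
  have key := fun m => fourier_eq_zero_of_bounded_solution hbi hBi hw
    (ae_div_eq_zero hBi hw hdiv) hl hv hM (fun φ hφ => by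
      rw [hint fun x y => y * (l * φ x - laplacian φ x), ← heq φ hφ]
      congr 1
      exact Finset.sum_congr rfl fun j _ => hint fun x y => b j x * y * pderiv j φ x) (m := m)
  have hui : Integrable u := hu.integrable le_top
  -- The symbol degenerates only for the constant mode with `l = 0`, which the zero-mean hypothesis
  -- `h0` covers.
  have hz : ∀ m : Fin d → ℤ, ¬ 0 < l + 4 * Real.pi ^ 2 * ∑ i, (m i : ℝ) ^ 2 → m = 0 ∧ l = 0 := by
    intro m hm
    have h1 : 0 ≤ ∑ i, (m i : ℝ) ^ 2 := by positivity
    have h2 : 0 < 4 * Real.pi ^ 2 := by positivity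
    have h3 : ∑ i, (m i : ℝ) ^ 2 = 0 := by nlinarith
    rw [h3] at hm
    refine ⟨funext fun i => ?_, by linarith⟩
    have := (Finset.sum_eq_zero_iff_of_nonneg fun i _ => sq_nonneg (m i : ℝ)).1 h3 i
      (Finset.mem_univ i)
    simpa using this
  refine ae_eq_zero_of_cosT_sinT hui (fun m => ?_) fun m => ?_
  · by_cases hm : 0 < l + 4 * Real.pi ^ 2 * ∑ i, (m i : ℝ) ^ 2
    · rw [← hint fun x y => y * cosT m x]
      exact (key m hm).1
    · obtain ⟨rfl, hl0⟩ := hz m hm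
      simpa [cosT_zero] using h0 hl0
  · by_cases hm : 0 < l + 4 * Real.pi ^ 2 * ∑ i, (m i : ℝ) ^ 2
    · rw [← hint fun x y => y * sinT m x]
      exact (key m hm).2
    · obtain ⟨rfl, -⟩ := hz m hm
      simp [sinT_zero]

theorem weaklyDivFree_sum {b : Torus d → EuclideanSpace ℝ (Fin d)}
    (hb : ∀ j, Integrable fun x => b x j) (hdiv : WeaklyDivFree b) :
    ∀ φ ∈ smoothFun d, ∑ j, ∫ x, b x j * pderiv j φ x = 0 := fun φ hφ => by
  rw [← integral_finsetSum _ fun j _ => integrable_mul_continuous (hb j) (continuous_pderiv hφ j)]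
  exact hdiv φ hφ

theorem continuous_laplacian {φ : Torus d → ℝ} (hφ : φ ∈ smoothFun d) :
    Continuous (laplacian φ) :=
  continuous_finsetSum _ fun i _ => continuous_pderiv (pderiv_mem hφ i) i

theorem weakForm_eq {b : Torus d → EuclideanSpace ℝ (Fin d)} {u : Torus d → ℝ}
    (hu : Integrable u) (hbu : ∀ j, Integrable fun x => b x j * u x) {φ : Torus d → ℝ}
    (hφ : φ ∈ smoothFun d) :
    weakForm b u φ = -(∫ x, u x * laplacian φ x) + ∑ j, ∫ x, b x j * u x * pderiv j φ x := by
  have h1 := integrable_mul_continuous hu (continuous_laplacian hφ)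
  have h2 : ∀ j, Integrable fun x => b x j * u x * pderiv j φ x := fun j =>
    integrable_mul_continuous (hbu j) (continuous_pderiv hφ j)
  have h3 : Integrable fun x => -(u x * laplacian φ x) := h1.neg
  rw [weakForm, integral_add h3 (integrable_finsetSum _ fun j _ => h2 j), integral_neg,
    integral_finsetSum _ fun j _ => h2 j]

/-- Uniqueness of bounded solutions with zero mean. -/
theorem ae_eq_zero_of_weakForm {b : Torus d → EuclideanSpace ℝ (Fin d)}
    (hb : ∀ j, MemW1 (fun x => b x j) 1) (hdiv : WeaklyDivFree b) {u : Torus d → ℝ}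
    (hu : MemLp u ⊤) (h0 : ∫ x, u x = 0) (heq : ∀ φ ∈ smoothFun d, weakForm b u φ = 0) :
    u =ᵐ[volume] 0 := by
  have hbi : ∀ j, Integrable fun x => b x j := fun j => memLp_one_iff_integrable.1 (hb j).1
  refine ae_eq_zero_of_bounded_solution hb (weaklyDivFree_sum hbi hdiv) le_rfl hu (fun _ => h0)
    fun φ hφ => ?_
  have := heq φ (trig_le hφ)
  rw [weakForm_eq (hu.integrable le_top) (fun j => integrable_mul_of_memLp_top (hbi j) hu)
    (trig_le hφ)] at this
  simp only [zero_mul, zero_sub, mul_neg, integral_neg]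
  exact this

theorem weakForm_eq_of_weak_gradient {b : Torus d → EuclideanSpace ℝ (Fin d)}
    {u : Torus d → ℝ} {g : Fin d → Torus d → ℝ}
    (hu : Integrable u) (hbu : ∀ j, Integrable fun x => b x j * u x)
    (hg : ∀ i, Integrable (g i) ∧ HasWeakPDeriv i u (g i)) {φ : Torus d → ℝ}
    (hφ : φ ∈ smoothFun d) :
    weakForm b u φ = ∫ x, ∑ i, (g i x + b x i * u x) * pderiv i φ x := by
  have h1 : ∀ i, Integrable fun x => g i x * pderiv i φ x := fun i =>
    integrable_mul_continuous (hg i).1 (continuous_pderiv hφ i)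
  have h2 : ∀ i, Integrable fun x => b x i * u x * pderiv i φ x := fun i =>
    integrable_mul_continuous (hbu i) (continuous_pderiv hφ i)
  rw [weakForm_eq hu hbu hφ, ← integral_weak_grad_eq hu (fun i => (hg i).2) hφ]
  simp_rw [add_mul]
  have h3 : ∀ i, Integrable fun x => g i x * pderiv i φ x + b x i * u x * pderiv i φ x :=
    fun i => (h1 i).add (h2 i)
  rw [integral_finsetSum _ fun i _ => h3 i, ← Finset.sum_add_distrib]
  exact Finset.sum_congr rfl fun i _ => (integral_add (h1 i) (h2 i)).symm

/-! ### Bounded drifts: the transport form and the resolvent problem -/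

/-- Multiplication by a bounded function, as an operator on `L²`. -/
noncomputable def mulL (a : Lp ℝ ⊤ (volume : Measure (Torus d))) : L2T d →L[ℝ] L2T d :=
  (ContinuousLinearMap.mul ℝ ℝ).holderL volume ⊤ 2 2 a

theorem coeFn_mulL (a : Lp ℝ ⊤ (volume : Measure (Torus d))) (f : L2T d) :
    mulL a f =ᵐ[volume] fun x => a x * f x :=
  (ContinuousLinearMap.mul ℝ ℝ).coeFn_holder a f

/-- The transport form `∫ (a · X) y`, where `X` is the vector part of `x`. -/
noncomputable def transport (a : Fin d → Lp ℝ ⊤ (volume : Measure (Torus d)))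
    (x y : JetSpace d) : ℝ :=
  ∑ i, inner ℝ (mulL (a i) (x (some i))) (y none)

theorem transport_sub_left (a : Fin d → Lp ℝ ⊤ (volume : Measure (Torus d)))
    (x y z : JetSpace d) : transport a (x - y) z = transport a x z - transport a y z := by
  simp [transport, inner_sub_left, Finset.sum_sub_distrib]

theorem transport_eq_integral (a : Fin d → Lp ℝ ⊤ (volume : Measure (Torus d)))
    (x y : JetSpace d) :
    transport a x y = ∑ i, ∫ z, a i z * x (some i) z * y none z := by
  refine Finset.sum_congr rfl fun i _ => ?_
  rw [inner_L2T]
  refine integral_congr_ae ?_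
  filter_upwards [coeFn_mulL (a i) (x (some i))] with z hz
  rw [hz]

theorem transport_jet (a : Fin d → Lp ℝ ⊤ (volume : Measure (Torus d))) (φ ψ : smoothFun d) :
    transport a (jet d φ) (jet d ψ)
      = ∑ i, ∫ z, a i z * (pderiv i (φ : Torus d → ℝ) z * (ψ : Torus d → ℝ) z) := by
  rw [transport_eq_integral]
  refine Finset.sum_congr rfl fun i _ => integral_congr_ae ?_
  filter_upwards [coeFn_jet_none ψ, coeFn_jet_some φ i] with z h1 h2
  rw [h1, h2, mul_assoc]

/-- The vector field with components `a i` is weakly divergence-free. -/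
def DivFree (a : Fin d → Lp ℝ ⊤ (volume : Measure (Torus d))) : Prop :=
  ∀ φ ∈ smoothFun d, ∑ i, ∫ z, a i z * pderiv i φ z = 0

theorem integrable_Lp_top (a : Lp ℝ ⊤ (volume : Measure (Torus d))) : Integrable a :=
  (Lp.memLp a).integrable le_top

/-- For smooth φ and ψ the sum of the two forms is ∫ a · ∇(φψ) = 0. Both sides are continuous in
each argument because `a` is bounded, and density is applied to one argument at a time. -/
theorem transport_skew {a : Fin d → Lp ℝ ⊤ (volume : Measure (Torus d))} (ha : DivFree a)
    {x y : JetSpace d} (hx : x ∈ sobolev d) (hy : y ∈ sobolev d) :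
    transport a x y = -transport a y x := by
  refine sobolev_induction (P := fun x => transport a x y = -transport a y x)
    (isClosed_eq (by unfold transport; fun_prop) (by unfold transport; fun_prop)) (fun φ => ?_) hx
  refine sobolev_induction (P := fun y => transport a (jet d φ) y = -transport a y (jet d φ))
    (isClosed_eq (by unfold transport; fun_prop) (by unfold transport; fun_prop)) (fun ψ => ?_) hy
  have hc : ∀ (φ ψ : smoothFun d) i, Integrable fun z => a i z *
      (pderiv i (φ : Torus d → ℝ) z * (ψ : Torus d → ℝ) z) := fun φ ψ i => integrable_mul_continuous (integrable_Lp_top (a i))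
    ((continuous_pderiv φ.2 i).mul (continuous_of_mem ψ.2))
  rw [transport_jet, transport_jet, eq_neg_iff_add_eq_zero, ← Finset.sum_add_distrib,
    ← ha _ (mul_mem φ.2 ψ.2)]
  refine Finset.sum_congr rfl fun i _ => ?_
  rw [← integral_add (hc φ ψ i) (hc ψ φ i)]
  refine integral_congr_ae (Eventually.of_forall fun z => ?_)
  simp only [pderiv_mul φ.2 ψ.2]
  ring

theorem transport_self {a : Fin d → Lp ℝ ⊤ (volume : Measure (Torus d))} (ha : DivFree a)
    {x : JetSpace d} (hx : x ∈ sobolev d) : transport a x x = 0 := by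
  have := transport_skew ha hx hx
  linarith

/-- The jet of the constant function `1`. -/
noncomputable def jetOne (d : ℕ) : JetSpace d := jet d ⟨fun _ => 1, const_mem 1⟩

theorem jetOne_some (i : Fin d) : jetOne d (some i) = 0 := by
  refine (Lp.eq_zero_iff_ae_eq_zero).2 ((coeFn_jet_some _ i).trans (Eventually.of_forall fun z => ?_))
  simp [pderiv_const]

theorem inner_jetOne_none (f : L2T d) : inner ℝ f (jetOne d none) = ∫ x, f x := by
  rw [jetOne, inner_jet_none]
  simp

theorem jetOne_mem : jetOne d ∈ sobolev d := jet_mem_sobolev _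

theorem transport_jetOne {a : Fin d → Lp ℝ ⊤ (volume : Measure (Torus d))} (ha : DivFree a)
    {x : JetSpace d} (hx : x ∈ sobolev d) : transport a x (jetOne d) = 0 := by
  rw [transport_skew ha hx jetOne_mem]
  simp [transport, jetOne_some]

/-- The gradient part `∫ X · Y` of the inner product. -/
noncomputable def dirichlet (x y : JetSpace d) : ℝ := ∑ i, inner ℝ (x (some i)) (y (some i))

/-- The operator representing the form `l ∫ x y + ∫ X · Y + ∫ (a · X) y`. -/
noncomputable def formOperator (a : Fin d → Lp ℝ ⊤ (volume : Measure (Torus d))) (l : ℝ) :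
    JetSpace d →L[ℝ] JetSpace d :=
  (PiLp.continuousLinearEquiv 2 ℝ fun _ : Option (Fin d) => L2T d).symm.toContinuousLinearMap.comp
    (ContinuousLinearMap.pi fun o => o.elim
      (l • PiLp.proj 2 (fun _ : Option (Fin d) => L2T d) none
        + ∑ i, (mulL (a i)).comp (PiLp.proj 2 (fun _ : Option (Fin d) => L2T d) (some i)))
      fun i => PiLp.proj 2 (fun _ : Option (Fin d) => L2T d) (some i))

theorem inner_formOperator (a : Fin d → Lp ℝ ⊤ (volume : Measure (Torus d))) (l : ℝ)
    (x y : JetSpace d) : inner ℝ (formOperator a l x) y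
      = l * inner ℝ (x none) (y none) + dirichlet x y + transport a x y := by
  rw [inner_jet]
  have h1 : formOperator a l x none = l • x none + ∑ i, mulL (a i) (x (some i)) := by
    simp [formOperator]
  have h2 : ∀ i, formOperator a l x (some i) = x (some i) := fun i => by
    simp [formOperator]
  simp_rw [h1, h2, inner_add_left, sum_inner, real_inner_smul_left]
  rw [dirichlet, transport]
  ring

/-- `v` is a weak solution of `l v - Δv + a · ∇v = F`. -/
def IsResolvent (a : Fin d → Lp ℝ ⊤ (volume : Measure (Torus d))) (l : ℝ) (F : L2T d)
    (v : JetSpace d) : Prop :=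
  v ∈ sobolev d ∧ ∀ y ∈ sobolev d,
    l * inner ℝ (v none) (y none) + dirichlet v y + transport a v y = inner ℝ F (y none)

/-- Lax–Milgram. The transport form vanishes on the diagonal, so the form is coercive with constant
`min l 1`, whatever the size of the drift. -/
theorem exists_isResolvent {a : Fin d → Lp ℝ ⊤ (volume : Measure (Torus d))} (ha : DivFree a)
    {l : ℝ} (hl : 0 < l) (F : L2T d) : ∃ v, IsResolvent a l F v := by
  have : CompleteSpace (sobolev d) := isClosed_sobolev.completeSpace_coe
  let B : sobolev d →L[ℝ] sobolev d →L[ℝ] ℝ :=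
    (ContinuousLinearMap.precomp ℝ (sobolev d).subtypeL).comp
      ((innerSL ℝ : JetSpace d →L[ℝ] JetSpace d →L[ℝ] ℝ).comp ((formOperator a l).comp (sobolev d).subtypeL))
  have hB : ∀ x y : sobolev d, B x y = inner ℝ (formOperator a l (x : JetSpace d)) (y : JetSpace d) :=
    fun x y => rfl
  have hco : IsCoercive B := by
    refine ⟨min l 1, lt_min hl one_pos, fun x => ?_⟩
    rw [hB, inner_formOperator, transport_self ha x.2, dirichlet, mul_assoc, ← sq, Submodule.coe_norm,
      norm_sq_jet]
    simp_rw [real_inner_self_eq_norm_sq]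
    have h1 := mul_le_mul_of_nonneg_right (min_le_left l 1) (sq_nonneg ‖(x : JetSpace d) none‖)
    have h2 := mul_le_mul_of_nonneg_right (min_le_right l 1)
      (Finset.sum_nonneg fun i (_ : i ∈ Finset.univ) => sq_nonneg ‖(x : JetSpace d) (some i)‖)
    linarith
  let Fj : JetSpace d := WithLp.toLp 2 fun o => o.elim F fun _ => 0
  let G : sobolev d := (InnerProductSpace.toDual ℝ (sobolev d)).symm
    ((innerSL ℝ Fj).comp (sobolev d).subtypeL)
  refine ⟨(hco.continuousLinearEquivOfBilin.symm G : sobolev d), Subtype.mem _, fun y hy => ?_⟩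
  have h1 := hco.continuousLinearEquivOfBilin_apply (hco.continuousLinearEquivOfBilin.symm G)
    ⟨y, hy⟩
  rw [ContinuousLinearEquiv.apply_symm_apply, InnerProductSpace.toDual_symm_apply, hB,
    inner_formOperator] at h1
  rw [← h1]
  change inner ℝ Fj y = _
  rw [inner_jet]
  simp [Fj]

theorem dirichlet_self (x : JetSpace d) : dirichlet x x = ∑ i, ‖x (some i)‖ ^ 2 := by
  simp_rw [dirichlet, real_inner_self_eq_norm_sq]

/-- Testing with the constant 1 shows that `v` has zero mean, so Poincaré replaces the weak term
with `l`. The bounds depend neither on `l` nor on the drift, which both limits later require. -/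
theorem IsResolvent.norm_le {a : Fin d → Lp ℝ ⊤ (volume : Measure (Torus d))} (ha : DivFree a)
    {l : ℝ} (hl : 0 < l) {F : L2T d} (hF : ∫ x, F x = 0) {v : JetSpace d}
    (hv : IsResolvent a l F v) : ‖v none‖ ≤ ‖F‖ ∧ ‖v‖ ≤ 2 * ‖F‖ := by
  have h0 : ∫ x, v none x = 0 := by
    have := hv.2 _ jetOne_mem
    rw [transport_jetOne ha hv.1, inner_jetOne_none, inner_jetOne_none, hF, dirichlet] at this
    simpa [jetOne_some, hl.ne'] using this
  have h1 := poincare hv.1 h0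
  have h2 := hv.2 v hv.1
  rw [transport_self ha hv.1, dirichlet_self, real_inner_self_eq_norm_sq] at h2
  have h3 := real_inner_le_norm F (v none)
  have h4 := mul_nonneg hl.le (sq_nonneg ‖v none‖)
  have h5 : ‖v none‖ ≤ ‖F‖ := by
    by_contra h
    push Not at h
    nlinarith [norm_nonneg F, norm_nonneg (v none)]
  refine ⟨h5, ?_⟩
  have h6 := norm_sq_jet v
  have h7 := norm_nonneg (v none)
  have h8 := norm_nonneg F
  refine abs_le_of_sq_le_sq' ?_ (by positivity) |>.2
  nlinarith [mul_le_mul_of_nonneg_left h5 h8, sq_nonneg ‖F‖, mul_self_le_mul_self h7 h5]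

/-! ### The maximum principle -/

theorem exists_smooth_primitive {G : ℝ → ℝ} (hG : ContDiff ℝ ∞ G) :
    ∃ Θ : ℝ → ℝ, ContDiff ℝ ∞ Θ ∧ deriv Θ = G := by
  have h : ∀ s, HasDerivAt (fun s => ∫ t in (0 : ℝ)..s, G t) (G s) s := fun s =>
    intervalIntegral.integral_hasDerivAt_right (hG.continuous.intervalIntegrable _ _)
      (hG.continuous.stronglyMeasurableAtFilter _ _) hG.continuous.continuousAt
  have h' : deriv (fun s => ∫ t in (0 : ℝ)..s, G t) = G := funext fun s => (h s).deriv
  refine ⟨_, contDiff_infty_iff_deriv.2 ⟨fun s => (h s).differentiableAt, ?_⟩, h'⟩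
  rw [h']
  exact hG

/-- With Θ′ = G one has G(φ)∇φ = ∇Θ(φ), and `a` is divergence-free. -/
theorem transport_jet_comp {a : Fin d → Lp ℝ ⊤ (volume : Measure (Torus d))} (ha : DivFree a)
    {G : ℝ → ℝ} (hG : ContDiff ℝ ∞ G) (φ : smoothFun d) :
    transport a (jet d φ) (jet d ⟨_, comp_mem φ.2 hG⟩) = 0 := by
  obtain ⟨Θ, hΘ, rfl⟩ := exists_smooth_primitive hG
  rw [transport_jet, ← ha _ (comp_mem φ.2 hΘ)]
  refine Finset.sum_congr rfl fun i _ => integral_congr_ae (Eventually.of_forall fun z => ?_)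
  simp only [pderiv_comp φ.2 hΘ]
  ring

theorem dirichlet_jet_comp_nonneg {G : ℝ → ℝ} (hG : ContDiff ℝ ∞ G) (hmono : Monotone G)
    (φ : smoothFun d) : 0 ≤ dirichlet (jet d φ) (jet d ⟨_, comp_mem φ.2 hG⟩) := by
  refine Finset.sum_nonneg fun i _ => ?_
  rw [inner_L2T]
  refine integral_nonneg_of_ae ?_
  filter_upwards [coeFn_jet_some φ i, coeFn_jet_some ⟨_, comp_mem φ.2 hG⟩ i] with z h1 h2
  rw [h1, h2]
  simp only [pderiv_comp φ.2 hG, Pi.zero_apply]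
  have := hmono.deriv_nonneg (x := (φ : Torus d → ℝ) z)
  nlinarith [mul_nonneg this (mul_self_nonneg (pderiv i (φ : Torus d → ℝ) z))]

theorem norm_jet_comp_some_le {G : ℝ → ℝ} (hG : ContDiff ℝ ∞ G) {L : ℝ}
    (hL : ∀ s, |deriv G s| ≤ L) (φ : smoothFun d) (i : Fin d) :
    ‖jet d ⟨_, comp_mem φ.2 hG⟩ (some i)‖ ≤ L * ‖jet d φ (some i)‖ := by
  refine Lp.norm_le_mul_norm_of_ae_le_mul ?_
  filter_upwards [coeFn_jet_some φ i, coeFn_jet_some ⟨_, comp_mem φ.2 hG⟩ i] with z h1 h2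
  rw [h1, h2]
  simp only [pderiv_comp φ.2 hG, Real.norm_eq_abs, abs_mul]
  exact mul_le_mul_of_nonneg_right (hL _) (abs_nonneg _)

/-- Testing the resolvent equation with a monotone function of the solution. -/
theorem IsResolvent.integral_comp_nonpos {a : Fin d → Lp ℝ ⊤ (volume : Measure (Torus d))}
    (ha : DivFree a) {l : ℝ} {F : L2T d} {v : JetSpace d} (hv : IsResolvent a l F v)
    {G : ℝ → ℝ} (hG : ContDiff ℝ ∞ G) (hmono : Monotone G) (hG1 : ∀ s, |G s| ≤ 1) {L : ℝ}
    (hL : ∀ s, |deriv G s| ≤ L) : ∫ x, (l * v none x - F x) * G (v none x) ≤ 0 := by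
  have hmem : v ∈ closure (Set.range (jet d)) := by
    have := hv.1
    rwa [sobolev, ← SetLike.mem_coe, Submodule.topologicalClosure_coe, LinearMap.coe_range] at this
  obtain ⟨ξ, hξ, hlim⟩ := mem_closure_iff_seq_limit.1 hmem
  choose φ hφ using hξ
  have hlim' : Tendsto (fun k => jet d (φ k)) atTop (𝓝 v) := by simpa only [hφ] using hlim
  have hq : MemLp (fun x => G (v none x)) 2 := by
    refine MemLp.of_bound (hG.continuous.comp_aestronglyMeasurable (Lp.aestronglyMeasurable _)) 1
      (Eventually.of_forall fun x => hG1 _)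
  have hL0 : 0 ≤ L := (abs_nonneg _).trans (hL 0)
  have hLip : ∀ s t, |G s - G t| ≤ L * |s - t| := fun s t => by
    have := Convex.norm_image_sub_le_of_norm_deriv_le (f := G) (s := Set.univ) (C := L)
      (fun x _ => (hG.differentiable (by simp)).differentiableAt) (fun x _ => hL x) convex_univ
      (Set.mem_univ t) (Set.mem_univ s)
    simpa using this
  -- Testing with G(φₖ) instead of G(v) avoids a chain rule in H¹. The functions G(φₖ) converge in
  -- L² while their gradients are only bounded; this is enough, as the gradients are paired with ∇(v
  -- − φₖ) → 0.
  set w : ℕ → JetSpace d := fun k => jet d ⟨_, comp_mem (φ k).2 hG⟩ with hw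
  have hwq : Tendsto (fun k => w k none) atTop (𝓝 (hq.toLp _)) := by
    rw [tendsto_iff_norm_sub_tendsto_zero]
    have h1 : Tendsto (fun k => L * ‖jet d (φ k) none - v none‖) atTop (𝓝 0) := by
      have := (((continuous_jet_apply none).tendsto v).comp hlim').sub_const (v none)
      simpa using this.norm.const_mul L
    refine squeeze_zero (fun k => norm_nonneg _) (fun k => ?_) h1
    refine Lp.norm_le_mul_norm_of_ae_le_mul ?_
    filter_upwards [coeFn_jet_none (φ k), coeFn_jet_none ⟨_, comp_mem (φ k).2 hG⟩,
      Lp.coeFn_sub (w k none) (hq.toLp _), Lp.coeFn_sub (jet d (φ k) none) (v none),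
      hq.coeFn_toLp] with z h1 h2 h3 h4 h5
    rw [h3, h4, Pi.sub_apply, Pi.sub_apply, h5, h1]
    have : w k none z = G ((φ k : Torus d → ℝ) z) := h2
    rw [this]
    exact hLip _ _
  have hstep : ∀ k, l * inner ℝ (v none) (w k none) - inner ℝ F (w k none)
      ≤ (∑ i, ‖(v - jet d (φ k)) (some i)‖ * (L * ‖jet d (φ k) (some i)‖))
        - transport a (v - jet d (φ k)) (w k) := fun k => by
    have h1 := hv.2 (w k) (jet_mem_sobolev _)
    have h2 : transport a (jet d (φ k)) (w k) = 0 := transport_jet_comp ha hG (φ k)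
    have h3 : 0 ≤ dirichlet (jet d (φ k)) (w k) := dirichlet_jet_comp_nonneg hG hmono (φ k)
    have h4 : dirichlet v (w k) = dirichlet (v - jet d (φ k)) (w k)
        + dirichlet (jet d (φ k)) (w k) := by
      simp [dirichlet, inner_sub_left, Finset.sum_sub_distrib]
    have h5 : -dirichlet (v - jet d (φ k)) (w k)
        ≤ ∑ i, ‖(v - jet d (φ k)) (some i)‖ * (L * ‖jet d (φ k) (some i)‖) := by
      rw [dirichlet, ← Finset.sum_neg_distrib]
      refine Finset.sum_le_sum fun i _ => ?_
      exact (neg_le_abs _).trans ((abs_real_inner_le_norm _ _).trans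
        (mul_le_mul_of_nonneg_left (norm_jet_comp_some_le hG hL (φ k) i) (norm_nonneg _)))
    rw [transport_sub_left]
    linarith
  have he : Tendsto (fun k => v - jet d (φ k)) atTop (𝓝 0) := by
    simpa using hlim'.const_sub v
  have hes : ∀ i, Tendsto (fun k => (v - jet d (φ k)) (some i)) atTop (𝓝 0) := fun i =>
    ((continuous_jet_apply (some i)).tendsto _).comp he
  have hjs : ∀ i, Tendsto (fun k => jet d (φ k) (some i)) atTop (𝓝 (v (some i))) := fun i =>
    ((continuous_jet_apply (some i)).tendsto _).comp hlim'
  have hR : Tendsto (fun k => (∑ i, ‖(v - jet d (φ k)) (some i)‖ * (L * ‖jet d (φ k) (some i)‖))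
        - transport a (v - jet d (φ k)) (w k)) atTop (𝓝 0) := by
    have h1 := tendsto_finsetSum Finset.univ fun i _ => (hes i).norm.mul ((hjs i).norm.const_mul L)
    have h2 := tendsto_finsetSum Finset.univ fun i _ =>
      (((mulL (a i)).continuous.tendsto _).comp (hes i)).inner (𝕜 := ℝ) hwq
    simpa [transport] using h1.sub h2
  have hLl : Tendsto (fun k => l * inner ℝ (v none) (w k none) - inner ℝ F (w k none)) atTop
      (𝓝 (l * inner ℝ (v none) (hq.toLp _) - inner ℝ F (hq.toLp _))) :=
    ((tendsto_const_nhds.inner hwq).const_mul l).sub (tendsto_const_nhds.inner hwq)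
  have hfin := le_of_tendsto_of_tendsto' hLl hR hstep
  rw [inner_toLp_right, inner_toLp_right, ← integral_const_mul, ← integral_sub] at hfin
  · refine le_of_eq_of_le (integral_congr_ae (Eventually.of_forall fun x => ?_)) hfin
    ring
  · exact ((Lp.memLp (v none)).integrable_mul hq).const_mul l
  · exact (Lp.memLp F).integrable_mul hq

/-- A smooth replacement for the indicator of (0, ∞). Its derivative is bounded because it vanishes
outside the compact interval [0, 1]. -/
theorem exists_smooth_step : ∃ G : ℝ → ℝ, ContDiff ℝ ∞ G ∧ Monotone G ∧ (∀ s, 0 ≤ G s) ∧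
    (∀ s, |G s| ≤ 1) ∧ (∀ s, 0 < s → 0 < G s) ∧ (∀ s ≤ 0, G s = 0) ∧
    ∃ L, ∀ s, |deriv G s| ≤ L := by
  refine ⟨Real.smoothTransition, Real.smoothTransition.contDiff, Real.smoothTransition.monotone,
    Real.smoothTransition.nonneg, fun s => ?_, fun s hs => Real.smoothTransition.pos_of_pos hs,
    fun s hs => Real.smoothTransition.zero_of_nonpos hs, ?_⟩
  · rw [abs_of_nonneg (Real.smoothTransition.nonneg s)]
    exact Real.smoothTransition.le_one s
  · have hc : Continuous (deriv Real.smoothTransition) :=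
      (Real.smoothTransition.contDiff (n := 1)).continuous_deriv le_rfl
    obtain ⟨L, hL⟩ := isCompact_Icc.exists_bound_of_continuousOn (s := Set.Icc (0 : ℝ) 1)
      hc.continuousOn
    refine ⟨L, fun s => ?_⟩
    have hL0 : 0 ≤ L := (norm_nonneg _).trans (hL 0 (by simp))
    rcases lt_or_ge s 0 with hs | hs
    · have : Real.smoothTransition =ᶠ[𝓝 s] fun _ => 0 := by
        filter_upwards [gt_mem_nhds hs] with t ht
        exact Real.smoothTransition.zero_of_nonpos (le_of_lt ht)
      rw [this.deriv_eq]
      simpa using hL0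
    rcases lt_or_ge 1 s with hs1 | hs1
    · have : Real.smoothTransition =ᶠ[𝓝 s] fun _ => 1 := by
        filter_upwards [lt_mem_nhds hs1] with t ht
        exact Real.smoothTransition.one_of_one_le (le_of_lt ht)
      rw [this.deriv_eq]
      simpa using hL0
    · exact hL s ⟨hs, hs1⟩

/-- The maximum principle, upper bound. -/
theorem IsResolvent.le {a : Fin d → Lp ℝ ⊤ (volume : Measure (Torus d))}
    (ha : DivFree a) {l : ℝ} (hl : 0 < l) {F : L2T d} {v : JetSpace d} (hv : IsResolvent a l F v)
    {K : ℝ} (hK : ∀ᵐ x, F x ≤ K) : ∀ᵐ x, v none x ≤ K / l := by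
  obtain ⟨G, hG, hmono, hG0, hG1, hGpos, hGz, L, hL⟩ := exists_smooth_step
  have hsub : ContDiff ℝ ∞ fun s : ℝ => s - K / l := contDiff_id.sub contDiff_const
  have h := hv.integral_comp_nonpos ha (G := fun s => G (s - K / l)) (hG.comp hsub)
    (fun s t hst => hmono (sub_le_sub_right hst _)) (fun s => hG1 _) (L := L) (fun s => by
      rw [deriv_comp_sub_const]
      exact hL _)
  -- Where the factor `G` is nonzero, l v > K ≥ F. The integrand is thus nonnegative with
  -- nonpositive integral, hence zero almost everywhere, which excludes v > K/l.
  have hnn : 0 ≤ᵐ[volume] fun x => (l * v none x - F x) * G (v none x - K / l) := by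
    filter_upwards [hK] with x hx
    rcases le_or_gt (v none x - K / l) 0 with h1 | h1
    · simp [hGz _ h1]
    · refine mul_nonneg ?_ (hG0 _)
      rw [sub_pos, div_lt_iff₀ hl] at h1
      linarith
  have hint : Integrable fun x => (l * v none x - F x) * G (v none x - K / l) := by
    have hq : MemLp (fun x => G (v none x - K / l)) 2 := by
      refine MemLp.of_bound ((hG.comp hsub).continuous.comp_aestronglyMeasurable
        (Lp.aestronglyMeasurable _)) 1 (Eventually.of_forall fun x => hG1 _)
    exact (((Lp.memLp (v none)).const_mul l).sub (Lp.memLp F)).integrable_mul hq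
  have h0 := (integral_eq_zero_iff_of_nonneg_ae hnn hint).1 (le_antisymm h (integral_nonneg_of_ae hnn))
  filter_upwards [h0, hK] with x h1 h2
  by_contra hc
  push Not at hc
  have h3 := hGpos _ (sub_pos.2 hc)
  rw [div_lt_iff₀ hl] at hc
  rcases mul_eq_zero.1 h1 with h4 | h4 <;> linarith

theorem IsResolvent.neg {a : Fin d → Lp ℝ ⊤ (volume : Measure (Torus d))} {l : ℝ} {F : L2T d}
    {v : JetSpace d} (hv : IsResolvent a l F v) : IsResolvent a l (-F) (-v) := by
  refine ⟨(sobolev d).neg_mem hv.1, fun y hy => ?_⟩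
  have := hv.2 y hy
  simp only [dirichlet, transport] at this ⊢
  simp only [PiLp.neg_apply, inner_neg_left, map_neg, Finset.sum_neg_distrib]
  linarith

/-- The maximum principle. -/
theorem IsResolvent.abs_none_le {a : Fin d → Lp ℝ ⊤ (volume : Measure (Torus d))}
    (ha : DivFree a) {l : ℝ} (hl : 0 < l) {F : L2T d} {v : JetSpace d} (hv : IsResolvent a l F v)
    {K : ℝ} (hK : ∀ᵐ x, |F x| ≤ K) : ∀ᵐ x, |v none x| ≤ K / l := by
  have h1 := hv.le ha hl (hK.mono fun x hx => (abs_le.1 hx).2)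
  have h2 := hv.neg.le ha hl (K := K) (by
    filter_upwards [hK, Lp.coeFn_neg F] with x hx h3
    rw [h3, Pi.neg_apply]
    linarith [(abs_le.1 hx).1])
  filter_upwards [h1, h2, Lp.coeFn_neg (v none)] with x h3 h4 h5
  have : (-v) none x = -(v none x) := h5
  rw [this] at h4
  exact abs_le.2 ⟨by linarith, h3⟩

/-! ### Functionals in H⁻¹ and duality -/

theorem normH1_eq (φ : smoothFun d) : normH1 (φ : Torus d → ℝ) = ‖jet d φ‖ := by
  have hc := continuous_of_mem φ.2
  have hp := fun i => continuous_pderiv φ.2 i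
  have h1 : ∫ x, ((φ : Torus d → ℝ) x ^ 2 + ∑ i, pderiv i (φ : Torus d → ℝ) x ^ 2)
      = ‖jet d φ‖ ^ 2 := by
    have h2 : Integrable fun x => (φ : Torus d → ℝ) x ^ 2 := integrable_of_continuous (hc.pow 2)
    have h3 : ∀ i, Integrable fun x => pderiv i (φ : Torus d → ℝ) x ^ 2 := fun i =>
      integrable_of_continuous ((hp i).pow 2)
    rw [integral_add h2 (integrable_finsetSum _ fun i _ => h3 i),
      integral_finsetSum _ fun i _ => h3 i, norm_sq_jet, ← real_inner_self_eq_norm_sq, inner_L2T]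
    congr 1
    · refine integral_congr_ae ?_
      filter_upwards [coeFn_jet_none φ] with z hz
      rw [hz, sq]
    · refine Finset.sum_congr rfl fun i _ => ?_
      rw [← real_inner_self_eq_norm_sq, inner_L2T]
      refine integral_congr_ae ?_
      filter_upwards [coeFn_jet_some φ i] with z hz
      rw [hz, sq]
  rw [normH1, h1, Real.sqrt_sq (norm_nonneg _)]

/-- Riesz representation of `H^{-1}`. -/
theorem exists_repr {f : smoothFun d →ₗ[ℝ] ℝ} (hf : MemHMinusOne f) :
    ∃ r : JetSpace d, ∀ φ, f φ = inner ℝ r (jet d φ) := by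
  obtain ⟨C, hC⟩ := hf
  simp_rw [normH1_eq] at hC
  -- Boundedness lets `f` factor through the range of `jet`; Hahn–Banach and Riesz then provide the
  -- vector.
  have hker : LinearMap.ker (jet d) ≤ LinearMap.ker f := fun φ hφ => by
    rw [LinearMap.mem_ker] at hφ ⊢
    have := hC φ
    rw [hφ, norm_zero, mul_zero] at this
    exact abs_nonpos_iff.1 this
  let g₀ : LinearMap.range (jet d) →ₗ[ℝ] ℝ :=
    ((LinearMap.ker (jet d)).liftQ f hker).comp (jet d).quotKerEquivRange.symm.toLinearMap
  have hg₀ : ∀ φ, g₀ ⟨jet d φ, LinearMap.mem_range_self _ φ⟩ = f φ := fun φ => by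
    simp only [g₀, LinearMap.comp_apply, LinearEquiv.coe_coe]
    rw [LinearMap.quotKerEquivRange_symm_apply_image]
    rfl
  let g : StrongDual ℝ (LinearMap.range (jet d)) := g₀.mkContinuous C (by
    rintro ⟨_, φ, rfl⟩
    exact (congrArg norm (hg₀ φ)).trans_le (hC φ))
  obtain ⟨G, hG, -⟩ := _root_.exists_extension_norm_eq _ g
  refine ⟨(InnerProductSpace.toDual ℝ (JetSpace d)).symm G, fun φ => ?_⟩
  rw [InnerProductSpace.toDual_symm_apply, ← hg₀]
  exact (hG ⟨jet d φ, LinearMap.mem_range_self _ φ⟩).symm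

/-- A representation of the functional that is adapted to test functions without the zero mean
constraint. -/
theorem exists_repr_weakForm {f : smoothFun d →ₗ[ℝ] ℝ} (hf : MemHMinusOne f) :
    ∃ r : JetSpace d, ∀ (b : Torus d → EuclideanSpace ℝ (Fin d)) (u : Torus d → ℝ),
      SolvesZhikov b f u → ∀ φ : smoothFun d, weakForm b u φ = inner ℝ r (jet d φ) := by
  obtain ⟨r, hr⟩ := exists_repr hf
  -- The weak form depends only on derivatives of φ, so φ may be replaced by φ − ∫φ. Removing the
  -- component along the constant 1 has the same effect on the functional.
  refine ⟨r - (inner ℝ r (jetOne d) : ℝ) • jetOne d, fun b u hu φ => ?_⟩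
  set one : smoothFun d := ⟨fun _ => 1, const_mem 1⟩ with hone
  set c := ∫ x, (φ : Torus d → ℝ) x with hc
  have hφi : Integrable (φ : Torus d → ℝ) := integrable_of_continuous (continuous_of_mem φ.2)
  have hcoe : ∀ x, ((φ + (-c) • one : smoothFun d) : Torus d → ℝ) x = (φ : Torus d → ℝ) x - c := by
    intro x
    simp [hone, sub_eq_add_neg]
  have hpd : ∀ i, pderiv i ((φ + (-c) • one : smoothFun d) : Torus d → ℝ)
      = pderiv i (φ : Torus d → ℝ) := fun i => by
    funext x
    simp only [pderiv, hcoe]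
    rw [deriv_sub_const_fun]
  have h1 := hu (φ + (-c) • one) (by
    simp_rw [hcoe]
    rw [integral_sub hφi (integrable_const c), ← hc]
    simp)
  have h2 : weakForm b u ((φ + (-c) • one : smoothFun d) : Torus d → ℝ) = weakForm b u φ := by
    simp only [weakForm, laplacian, hpd]
  rw [← h2, h1, hr, map_add, map_smul, inner_add_right, inner_smul_right, inner_sub_left,
    inner_smul_left]
  have h3 : inner ℝ (jetOne d) (jet d φ) = c := by
    rw [real_inner_comm, inner_jet, inner_jetOne_none, hc]
    simp only [jetOne_some, inner_zero_right, Finset.sum_const_zero, add_zero]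
    exact integral_congr_ae (coeFn_jet_none φ)
  rw [h3]
  simp only [conj_trivial]
  change _ + -c * inner ℝ r (jetOne d) = _
  ring

theorem memLp_coord {b : Torus d → EuclideanSpace ℝ (Fin d)} {p : ℝ≥0∞} (hb : MemLp b p)
    (i : Fin d) : MemLp (fun x => b x i) p :=
  hb.mono ((EuclideanSpace.proj (𝕜 := ℝ) i).continuous.comp_aestronglyMeasurable hb.1)
    (Eventually.of_forall fun _ => PiLp.norm_apply_le _ _)

/-- The components of a bounded vector field. -/
noncomputable def components {b : Torus d → EuclideanSpace ℝ (Fin d)} (hb : MemLp b ⊤)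
    (i : Fin d) : Lp ℝ ⊤ (volume : Measure (Torus d)) := (memLp_coord hb i).toLp _

theorem coeFn_components {b : Torus d → EuclideanSpace ℝ (Fin d)} (hb : MemLp b ⊤) (i : Fin d) :
    components hb i =ᵐ[volume] fun x => b x i := (memLp_coord hb i).coeFn_toLp

theorem divFree_components {b : Torus d → EuclideanSpace ℝ (Fin d)} (hb : MemLp b ⊤)
    (hdiv : WeaklyDivFree b) : DivFree (components hb) := fun φ hφ => by
  rw [← weaklyDivFree_sum (fun j => (memLp_coord hb j).integrable le_top) hdiv φ hφ]
  refine Finset.sum_congr rfl fun i _ => integral_congr_ae ?_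
  filter_upwards [coeFn_components hb i] with x hx
  rw [hx]

/-- `x` is the jet of a weak solution of `-div (∇u + a u) = r`. -/
def IsDualSolution (a : Fin d → Lp ℝ ⊤ (volume : Measure (Torus d))) (r x : JetSpace d) : Prop :=
  x ∈ sobolev d ∧ ∫ z, x none z = 0 ∧
    ∀ y ∈ sobolev d, dirichlet x y + transport a y x = inner ℝ r y

/-- By `mem_sobolev_of_hasWeakPDeriv` the pair (u, ∇u) is a limit of smooth jets. For a bounded
drift the equation extends by density to all tests in H¹, in particular to resolvents and to `u`
itself. -/
theorem IsWeakSolution.exists_isDualSolution {b : Torus d → EuclideanSpace ℝ (Fin d)}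
    (hb : MemLp b ⊤) {f : smoothFun d →ₗ[ℝ] ℝ} {u : Torus d → ℝ} (hu : IsWeakSolution b f u)
    {r : JetSpace d} (hr : ∀ φ : smoothFun d, weakForm b u φ = inner ℝ r (jet d φ)) :
    ∃ x, IsDualSolution (components hb) r x ∧ x none =ᵐ[volume] u := by
  obtain ⟨⟨hu2, hg⟩, hu0, -⟩ := hu
  choose g hg2 hgw using hg
  set x : JetSpace d := WithLp.toLp 2 fun o => o.elim (hu2.toLp u) fun i => (hg2 i).toLp (g i)
  have hx0 : x none =ᵐ[volume] u := hu2.coeFn_toLp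
  have hxi : ∀ i, x (some i) =ᵐ[volume] g i := fun i => (hg2 i).coeFn_toLp
  have hint : ∀ {f₁ f₂ h : Torus d → ℝ}, f₁ =ᵐ[volume] f₂ →
      ∫ z, f₁ z * h z = ∫ z, f₂ z * h z := fun h12 => by
    refine integral_congr_ae ?_
    filter_upwards [h12] with z hz
    rw [hz]
  have hxw : ∀ i, HasWeakPDeriv i (x none) (x (some i)) := fun i φ hφ => by
    rw [hint hx0, hint (hxi i)]
    exact hgw i φ hφ
  refine ⟨x, ⟨mem_sobolev_of_hasWeakPDeriv hxw, (integral_congr_ae hx0).trans hu0,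
    fun y hy => ?_⟩, hx0⟩
  refine sobolev_induction (P := fun y => dirichlet x y + transport (components hb) y x
    = inner ℝ r y) (isClosed_eq (by unfold transport dirichlet; fun_prop) (by fun_prop))
    (fun φ => ?_) hy
  have hui : Integrable u := hu2.integrable (by norm_num)
  rw [← hr, weakForm_eq hui (fun j => (integrable_mul_of_memLp_top hui (memLp_coord hb j)).congr
    (Eventually.of_forall fun z => mul_comm _ _)) φ.2, transport_eq_integral, dirichlet]
  simp_rw [inner_jet_some]
  rw [integral_weak_grad_eq (integrable_L2T _) hxw φ.2, hint hx0]
  congr 1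
  refine Finset.sum_congr rfl fun i _ => integral_congr_ae ?_
  filter_upwards [hx0, coeFn_components hb i, coeFn_jet_some φ i] with z h1 h2 h3
  rw [h1, h2, h3]
  ring

/-- Testing with the solution removes the drift, so the bound is uniform along the approximating
sequence. -/
theorem IsDualSolution.norm_le {a : Fin d → Lp ℝ ⊤ (volume : Measure (Torus d))} (ha : DivFree a)
    {r x : JetSpace d} (hx : IsDualSolution a r x) : ‖x‖ ≤ 2 * ‖r‖ := by
  have h1 := poincare hx.1 hx.2.1
  have h2 := hx.2.2 x hx.1
  rw [transport_self ha hx.1, dirichlet_self, add_zero] at h2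
  have h3 := real_inner_le_norm r x
  have h4 := norm_sq_jet x
  by_contra h
  push Not at h
  nlinarith [norm_nonneg r, norm_nonneg x]

/-- Duality between the resolvent problem and the original problem. -/
theorem IsResolvent.inner_eq {a : Fin d → Lp ℝ ⊤ (volume : Measure (Torus d))} {l : ℝ}
    {F : L2T d} {v r x : JetSpace d} (hv : IsResolvent a l F v) (hx : IsDualSolution a r x) :
    inner ℝ F (x none) = inner ℝ r v + l * inner ℝ (v none) (x none) := by
  have h1 := hv.2 x hx.1
  have h2 := hx.2.2 v hv.1
  have h3 : dirichlet v x = dirichlet x v :=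
    Finset.sum_congr rfl fun i _ => real_inner_comm _ _
  linarith

theorem integral_abs_eq_toReal_eLpNorm {h : Torus d → ℝ} (hh : Integrable h) :
    ∫ x, |h x| = (eLpNorm h 1 volume).toReal := by
  rw [eLpNorm_one_eq_lintegral_enorm, ← integral_norm_eq_lintegral_enorm hh.1]
  rfl

/-! ### Passage to the limit and uniqueness of approximation solutions -/

/-- Products of an `L¹` convergent and a bounded, almost everywhere convergent sequence. -/
theorem tendsto_integral_mul_of_bounded {h : ℕ → Torus d → ℝ} {h' : Torus d → ℝ}
    {g : ℕ → Torus d → ℝ} {g' : Torus d → ℝ} (hh : ∀ n, Integrable (h n)) (hh' : Integrable h')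
    (hlim : Tendsto (fun n => eLpNorm (h n - h') 1 volume) atTop (𝓝 0))
    (hg : ∀ n, AEStronglyMeasurable (g n)) {C : ℝ}
    (hC : ∀ n, ∀ᵐ x, |g n x| ≤ C) (hgg : ∀ᵐ x, Tendsto (fun n => g n x) atTop (𝓝 (g' x))) :
    Tendsto (fun n => ∫ x, h n x * g n x) atTop (𝓝 (∫ x, h' x * g' x)) := by
  have hI : ∀ (k : Torus d → ℝ), Integrable k → ∀ n, Integrable fun x => k x * g n x :=
    fun k hk n => hk.mul_bdd (hg n) (hC n)
  have h1 : Tendsto (fun n => ∫ x, h' x * g n x) atTop (𝓝 (∫ x, h' x * g' x)) := by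
    refine tendsto_integral_of_dominated_convergence (fun x => C * |h' x|)
      (fun n => hh'.1.mul (hg n)) (hh'.abs.const_mul C) (fun n => ?_) ?_
    · filter_upwards [hC n] with x hx
      rw [Real.norm_eq_abs, abs_mul, mul_comm]
      exact mul_le_mul_of_nonneg_right hx (abs_nonneg _)
    · filter_upwards [hgg] with x hx
      exact hx.const_mul _
  have h2 : Tendsto (fun n => ∫ x, (h n - h') x * g n x) atTop (𝓝 0) := by
    have h3 : Tendsto (fun n => C * (eLpNorm (h n - h') 1 volume).toReal) atTop (𝓝 0) := by
      have := ((ENNReal.tendsto_toReal ENNReal.zero_ne_top).comp hlim).const_mul C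
      simpa using this
    refine squeeze_zero_norm (fun n => ?_) h3
    have hd : Integrable (h n - h') := (hh n).sub hh'
    rw [← integral_abs_eq_toReal_eLpNorm hd, ← integral_const_mul]
    refine norm_integral_le_of_norm_le (hd.abs.const_mul C) ?_
    filter_upwards [hC n] with x hx
    rw [Real.norm_eq_abs, abs_mul, mul_comm]
    exact mul_le_mul_of_nonneg_right hx (abs_nonneg _)
  have h4 := h2.add h1
  rw [zero_add] at h4
  refine h4.congr fun n => ?_
  rw [← integral_add (hI _ ((hh n).sub hh') n) (hI _ hh' n)]
  refine integral_congr_ae (Eventually.of_forall fun x => ?_)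
  simp only [Pi.sub_apply]
  ring

/-- `v` is the jet of a bounded distributional solution of `l v - Δv + b · ∇v = F`. -/
def IsBoundedResolvent (b : Torus d → EuclideanSpace ℝ (Fin d)) (l : ℝ) (F : L2T d)
    (v : JetSpace d) : Prop :=
  v ∈ sobolev d ∧ MemLp (v none) ⊤ ∧ ∀ φ ∈ trig d,
    (∫ x, v none x * (l * φ x - laplacian φ x)) - ∑ j, ∫ x, b x j * v none x * pderiv j φ x
      = ∫ x, F x * φ x

theorem IsResolvent.distributional {a : Fin d → Lp ℝ ⊤ (volume : Measure (Torus d))}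
    (ha : DivFree a) {l : ℝ} {F : L2T d} {v : JetSpace d} (hv : IsResolvent a l F v)
    (φ : smoothFun d) :
    (∫ x, v none x * (l * (φ : Torus d → ℝ) x - laplacian φ x))
      - ∑ j, ∫ x, a j x * (pderiv j (φ : Torus d → ℝ) x * v none x)
      = ∫ x, F x * (φ : Torus d → ℝ) x := by
  have h1 := hv.2 _ (jet_mem_sobolev φ)
  rw [transport_skew ha hv.1 (jet_mem_sobolev φ), transport_eq_integral, dirichlet,
    inner_jet_none, inner_jet_none] at h1
  simp_rw [inner_jet_some] at h1
  rw [integral_weak_grad_eq (integrable_L2T _) (hasWeakPDeriv_of_mem hv.1) φ.2] at h1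
  rw [← h1]
  have h2 : ∀ x, v none x * (l * (φ : Torus d → ℝ) x - laplacian φ x)
      = l * (v none x * (φ : Torus d → ℝ) x) - v none x * laplacian φ x := fun x => by ring
  simp_rw [h2]
  rw [integral_sub ((integrable_mul_continuous (integrable_L2T _)
    (continuous_of_mem φ.2)).const_mul l) (integrable_mul_continuous (integrable_L2T _)
    (continuous_laplacian φ.2)), integral_const_mul, ← sub_eq_add_neg, ← sub_eq_add_neg]
  congr 1
  refine Finset.sum_congr rfl fun j _ => integral_congr_ae ?_
  filter_upwards [coeFn_jet_some φ j] with x hx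
  rw [hx, mul_assoc]

/-- Bounded solutions of the resolvent equation with a Sobolev drift are unique. -/
theorem IsBoundedResolvent.unique {b : Torus d → EuclideanSpace ℝ (Fin d)}
    (hb : ∀ j, MemW1 (fun x => b x j) 1) (hdiv : WeaklyDivFree b) {l : ℝ} (hl : 0 < l)
    {F : L2T d} {v w : JetSpace d} (hv : IsBoundedResolvent b l F v)
    (hw : IsBoundedResolvent b l F w) : v = w := by
  have hbi : ∀ j, Integrable fun x => b x j := fun j => memLp_one_iff_integrable.1 (hb j).1
  -- The adjoint equation has the opposite drift sign, so the difference of two solutions falls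
  -- under `ae_eq_zero_of_bounded_solution` with drift −b.
  have hnb : ∀ j, MemW1 (fun x => -b x j) 1 := fun j => by
    refine ⟨(hb j).1.neg, fun i => ?_⟩
    obtain ⟨B, hB, hBw⟩ := (hb j).2 i
    refine ⟨fun x => -B x, hB.neg, fun φ hφ => ?_⟩
    simp_rw [neg_mul, integral_neg]
    rw [hBw φ hφ]
  have hnd : ∀ φ ∈ smoothFun d, ∑ j, ∫ x, -b x j * pderiv j φ x = 0 := fun φ hφ => by
    simp_rw [neg_mul, integral_neg, Finset.sum_neg_distrib]
    rw [weaklyDivFree_sum hbi hdiv φ hφ, neg_zero]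
  have h0 : (fun x => v none x - w none x) =ᵐ[volume] 0 := by
    refine ae_eq_zero_of_bounded_solution hnb hnd hl.le (hv.2.1.sub hw.2.1)
      (fun h => absurd h hl.ne') fun φ hφ => ?_
    have hφ' := trig_le hφ
    have h1 := hv.2.2 φ hφ
    have h2 := hw.2.2 φ hφ
    have hc : Continuous fun x => l * φ x - laplacian φ x :=
      (continuous_const.mul (continuous_of_mem hφ')).sub (continuous_laplacian hφ')
    have e1 : ∫ x, (v none x - w none x) * (l * φ x - laplacian φ x)
        = (∫ x, v none x * (l * φ x - laplacian φ x))
          - ∫ x, w none x * (l * φ x - laplacian φ x) := by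
      rw [← integral_sub (integrable_mul_continuous (integrable_L2T _) hc)
        (integrable_mul_continuous (integrable_L2T _) hc)]
      simp_rw [sub_mul]
    have e2 : ∀ j, ∫ x, -b x j * (v none x - w none x) * pderiv j φ x
        = (∫ x, b x j * w none x * pderiv j φ x) - ∫ x, b x j * v none x * pderiv j φ x :=
      fun j => by
      rw [← integral_sub (integrable_mul_continuous (integrable_mul_of_memLp_top (hbi j) hw.2.1)
        (continuous_pderiv hφ' j)) (integrable_mul_continuous
        (integrable_mul_of_memLp_top (hbi j) hv.2.1) (continuous_pderiv hφ' j))]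
      refine integral_congr_ae (Eventually.of_forall fun x => ?_)
      ring
    simp_rw [e1, e2, Finset.sum_sub_distrib]
    linarith
  -- The function part determines the weak gradient, hence the whole jet.
  have hn : v none = w none := Lp.ext (h0.mono fun x hx => sub_eq_zero.1 hx)
  ext1 o
  cases o with
  | none => exact hn
  | some i =>
    refine Lp.ext ?_
    have : (fun x => v (some i) x - w (some i) x) =ᵐ[volume] 0 := by
      refine ae_eq_zero_of_trig ((integrable_L2T _).sub (integrable_L2T _)) fun φ hφ => ?_
      have hc := continuous_of_mem (trig_le hφ)
      have h1 := hasWeakPDeriv_of_mem hv.1 i φ (trig_le hφ)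
      have h2 := hasWeakPDeriv_of_mem hw.1 i φ (trig_le hφ)
      rw [hn] at h1
      simp_rw [sub_mul]
      rw [integral_sub (integrable_mul_continuous (integrable_L2T _) hc)
        (integrable_mul_continuous (integrable_L2T _) hc)]
      linarith
    exact this.mono fun x hx => sub_eq_zero.1 hx

/-- An approximation solution is square integrable, and its moments are determined by the bounded
solution of the dual problem. -/
theorem IsApproximationSolution.exists_isBoundedResolvent {p p' : ℝ≥0∞} [p.HolderConjugate p']
    {b : Torus d → EuclideanSpace ℝ (Fin d)} (hbi : ∀ j, Integrable fun x => b x j)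
    (hbm : AEStronglyMeasurable b volume)
    {f : smoothFun d →ₗ[ℝ] ℝ} {u : Torus d → ℝ} (hu : IsApproximationSolution p p' b f u)
    {r : JetSpace d} (hr : ∀ (b : Torus d → EuclideanSpace ℝ (Fin d)) (u : Torus d → ℝ),
      SolvesZhikov b f u → ∀ φ : smoothFun d, weakForm b u φ = inner ℝ r (jet d φ))
    {l : ℝ} (hl : 0 < l) {F : L2T d} (hF0 : ∫ x, F x = 0) {K : ℝ} (hK : ∀ᵐ x, |F x| ≤ K) :
    ∃ (v : JetSpace d) (y : L2T d), IsBoundedResolvent b l F v ∧ ‖v none‖ ≤ ‖F‖ ∧ y =ᵐ[volume] u ∧ ∫ x, y x = 0 ∧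
      inner ℝ F y = inner ℝ r v + l * inner ℝ (v none) y := by
  obtain ⟨hup, -, bn, un, hbn, hun, hlim, hweak⟩ := hu
  have hp1 : 1 ≤ p := ENNReal.HolderConjugate.one_le p p'
  have hp1' : 1 ≤ p' := ENNReal.HolderConjugate.one_le p' p
  set a := fun n => components (hbn n).1
  have ha : ∀ n, DivFree (a n) := fun n => divFree_components (hbn n).1 (hbn n).2
  choose x hx hxu using fun n =>
    (hun n).1.exists_isDualSolution (hbn n).1 (hr (bn n) (un n) (hun n).1.2.2)
  obtain ⟨y, hy, σ, hσ, -, hyL, -⟩ := exists_subseq_tendsto (fun n => (hx n).1)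
    (fun n => (hx n).norm_le (ha n))
  choose v hv using fun n => exists_isResolvent (ha (σ n)) hl F
  obtain ⟨v', hv', τ, hτ, hvw, hvL, hvae⟩ := exists_subseq_tendsto (fun n => (hv n).1)
    (fun n => ((hv n).norm_le (ha _) hl hF0).2)
  have hyL' : Tendsto (fun n => x (σ (τ n)) none) atTop (𝓝 (y none)) := hyL.comp hτ.tendsto_atTop
  have hui : Integrable u := hup.integrable hp1'
  -- The strong L² limit and the weak limit in L^{p'} have the same integrals against trigonometric
  -- polynomials; no inclusion between the two spaces is needed.
  have hyu : y none =ᵐ[volume] u := by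
    have : (fun z => y none z - u z) =ᵐ[volume] 0 := by
      refine ae_eq_zero_of_trig ((integrable_L2T _).sub hui) fun φ hφ => ?_
      have hc := continuous_of_mem (trig_le hφ)
      simp_rw [sub_mul]
      rw [integral_sub (integrable_mul_continuous (integrable_L2T _) hc)
        (integrable_mul_continuous hui hc), sub_eq_zero]
      have h1 := (hweak φ (memLp_of_continuous hc p)).comp
        (hσ.comp hτ).tendsto_atTop
      have h2 := hyL'.inner (𝕜 := ℝ) (tendsto_const_nhds (x := jet d ⟨φ, trig_le hφ⟩ none))
      simp_rw [inner_jet_none] at h2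
      refine tendsto_nhds_unique h2 (h1.congr fun n => integral_congr_ae ?_)
      filter_upwards [hxu (σ (τ n))] with z hz
      rw [hz]
      rfl
    exact this.mono fun z hz => sub_eq_zero.1 hz
  refine ⟨v', y none, ⟨hv', ?_, ?_⟩, ?_, hyu, ?_, ?_⟩
  · have hbd : ∀ᵐ z, |v' none z| ≤ K / l := by
      have h1 : ∀ᵐ z, ∀ n, |v (τ n) none z| ≤ K / l :=
        ae_all_iff.2 fun n => (hv (τ n)).abs_none_le (ha _) hl hK
      filter_upwards [h1, hvae] with z h2 h3
      exact le_of_tendsto' h3.abs h2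
    exact memLp_top_of_bound (Lp.aestronglyMeasurable _) _ hbd
  · intro φ hφ
    have hφ' := trig_le hφ
    have hc : Continuous fun z => l * φ z - laplacian φ z :=
      (continuous_const.mul (continuous_of_mem hφ')).sub (continuous_laplacian hφ')
    have h1 : Tendsto (fun n => ∫ z, v (τ n) none z * (l * φ z - laplacian φ z)) atTop
        (𝓝 (∫ z, v' none z * (l * φ z - laplacian φ z))) := by
      have := hvL.inner (𝕜 := ℝ) (tendsto_const_nhds (x := (memLp_of_continuous hc 2).toLp _))
      simpa only [inner_toLp_right] using this
    -- The maximum principle bounds the resolvents uniformly, so convergence of the drifts in L¹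
    -- suffices, and that follows from L^p on a probability space.
    have h2 : ∀ j, Tendsto (fun n => ∫ z, a (σ (τ n)) j z * (pderiv j φ z * v (τ n) none z)) atTop
        (𝓝 (∫ z, b z j * (pderiv j φ z * v' none z))) := fun j => by
      obtain ⟨C, hC0, hC⟩ := bounded_of_continuous (continuous_pderiv hφ' j)
      refine tendsto_integral_mul_of_bounded (fun n => integrable_Lp_top _) (hbi j) ?_
        (fun n => (continuous_pderiv hφ' j).aestronglyMeasurable.mul (Lp.aestronglyMeasurable _))
        (C := C * (K / l)) (fun n => ?_) ?_
      · have h3 : Tendsto (fun n => eLpNorm (bn (σ (τ n)) - b) p volume) atTop (𝓝 0) :=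
          hlim.comp (hσ.comp hτ).tendsto_atTop
        refine tendsto_of_tendsto_of_tendsto_of_le_of_le tendsto_const_nhds h3
          (fun n => zero_le) fun n => ?_
        refine (eLpNorm_mono_ae ?_).trans
          (eLpNorm_le_eLpNorm_of_exponent_le hp1 ((hbn _).1.1.sub hbm))
        filter_upwards [coeFn_components (hbn (σ (τ n))).1 j] with z hz
        rw [Pi.sub_apply, hz]
        exact PiLp.norm_apply_le ((bn (σ (τ n)) - b) z) j
      · filter_upwards [(hv (τ n)).abs_none_le (ha _) hl hK] with z hz
        rw [abs_mul]
        exact mul_le_mul (hC z) hz (abs_nonneg _) hC0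
      · filter_upwards [hvae] with z hz
        exact hz.const_mul _
    have h4 := h1.sub (tendsto_finsetSum Finset.univ fun j _ => h2 j)
    have h5 := tendsto_nhds_unique h4 (tendsto_const_nhds.congr fun n =>
      ((hv (τ n)).distributional (ha _) ⟨φ, hφ'⟩).symm)
    rw [← h5]
    congr 1
    refine Finset.sum_congr rfl fun j _ => integral_congr_ae (Eventually.of_forall fun z => ?_)
    ring
  · exact le_of_tendsto' hvL.norm fun n => ((hv (τ n)).norm_le (ha _) hl hF0).1
  · rw [← inner_jetOne_none]
    refine tendsto_nhds_unique (hyL'.inner tendsto_const_nhds)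
      (tendsto_const_nhds.congr fun n => ?_)
    rw [inner_jetOne_none, (hx _).2.1]
  · have h1 := tendsto_const_nhds (x := F).inner (𝕜 := ℝ) hyL'
    -- Weak convergence in H¹ serves the term with `r`, which involves ∇v; the product of the two
    -- varying functions uses strong convergence in L².
    have h2 := (hvw r).add ((hvL.inner (𝕜 := ℝ) hyL').const_mul l)
    rw [real_inner_comm v' r]
    refine tendsto_nhds_unique h1 (h2.congr fun n => ?_)
    rw [(hv (τ n)).inner_eq (hx _), real_inner_comm]

/-- The two approximating sequences share the limit resolvent, so the terms with `r` cancel and the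
difference of the solutions is tested to be O(l) against each bounded `F` of zero mean. -/
theorem IsApproximationSolution.unique {p p' : ℝ≥0∞} [p.HolderConjugate p']
    {b : Torus d → EuclideanSpace ℝ (Fin d)} (hb : ∀ j, MemW1 (fun x => b x j) 1)
    (hdiv : WeaklyDivFree b) (hbm : AEStronglyMeasurable b volume)
    {f : smoothFun d →ₗ[ℝ] ℝ} (hf : MemHMinusOne f) {u₁ u₂ : Torus d → ℝ}
    (h₁ : IsApproximationSolution p p' b f u₁) (h₂ : IsApproximationSolution p p' b f u₂) :
    u₁ =ᵐ[volume] u₂ := by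
  have hbi : ∀ j, Integrable fun x => b x j := fun j => memLp_one_iff_integrable.1 (hb j).1
  obtain ⟨r, hr⟩ := exists_repr_weakForm hf
  have key := fun {l : ℝ} (hl : 0 < l) {F : L2T d} (hF0 : ∫ x, F x = 0) {K : ℝ}
    (hK : ∀ᵐ x, |F x| ≤ K) => h₁.exists_isBoundedResolvent hbi hbm hr hl hF0 hK
  have key' := fun {l : ℝ} (hl : 0 < l) {F : L2T d} (hF0 : ∫ x, F x = 0) {K : ℝ}
    (hK : ∀ᵐ x, |F x| ≤ K) => h₂.exists_isBoundedResolvent hbi hbm hr hl hF0 hK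
  have hz : ∀ᵐ x : Torus d, |(0 : L2T d) x| ≤ 0 :=
    Eventually.of_forall fun x => by simp
  have hz0 : ∫ x, (0 : L2T d) x = 0 := by
    rw [← inner_jetOne_none, inner_zero_left]
  -- The trivial data `F = 0` and `l = 1` serve only to extract representatives of the two solutions
  -- in L².
  obtain ⟨-, y₁, -, -, hy₁, hy₁0, -⟩ := key one_pos hz0 hz
  obtain ⟨-, y₂, -, -, hy₂, hy₂0, -⟩ := key' one_pos hz0 hz
  have horth : ∀ (F : L2T d) (K : ℝ), ∫ x, F x = 0 → (∀ᵐ x, |F x| ≤ K) →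
      inner ℝ F (y₁ - y₂) = 0 := by
    intro F K hF0 hK
    have hle : ∀ l : ℝ, 0 < l → |inner ℝ F (y₁ - y₂)| ≤ l * (‖F‖ * ‖y₁ - y₂‖) := fun l hl => by
      obtain ⟨v, z₁, hv, hvn, hz₁, -, e₁⟩ := key hl hF0 hK
      obtain ⟨w, z₂, hw, -, hz₂, -, e₂⟩ := key' hl hF0 hK
      -- The Sobolev regularity of `b` is used here: the limit resolvents obtained along the two
      -- sequences coincide.
      obtain rfl := hv.unique hb hdiv hl hw
      obtain rfl : z₁ = y₁ := Lp.ext (hz₁.trans hy₁.symm)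
      obtain rfl : z₂ = y₂ := Lp.ext (hz₂.trans hy₂.symm)
      have e : inner ℝ F (z₁ - z₂) = l * inner ℝ (v none) (z₁ - z₂) := by
        rw [inner_sub_right, inner_sub_right, e₁, e₂]
        ring
      rw [e, abs_mul, abs_of_pos hl]
      exact mul_le_mul_of_nonneg_left ((abs_real_inner_le_norm _ _).trans
        (mul_le_mul_of_nonneg_right hvn (norm_nonneg _))) hl.le
    have hlim : Tendsto (fun l : ℝ => l * (‖F‖ * ‖y₁ - y₂‖)) (𝓝[>] 0) (𝓝 0) := by
      have : Tendsto (fun l : ℝ => l * (‖F‖ * ‖y₁ - y₂‖)) (𝓝 0) (𝓝 (0 * (‖F‖ * ‖y₁ - y₂‖))) :=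
        tendsto_id.mul_const _
      rw [zero_mul] at this
      exact this.mono_left nhdsWithin_le_nhds
    exact abs_nonpos_iff.1 (ge_of_tendsto hlim
      (eventually_mem_nhdsWithin.mono fun l hl => hle l hl))
  have hmom : ∀ φ : smoothFun d, ∫ x, (φ : Torus d → ℝ) x = 0 →
      ∫ x, (y₁ - y₂) x * (φ : Torus d → ℝ) x = 0 := fun φ hφ => by
    obtain ⟨C, -, hC⟩ := bounded_of_continuous (continuous_of_mem φ.2)
    rw [← inner_jet_none, real_inner_comm]
    refine horth _ C ((integral_congr_ae (coeFn_jet_none φ)).trans hφ) ?_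
    filter_upwards [coeFn_jet_none φ] with x hx
    rw [hx]
    exact hC x
  have h0 : ∫ x, (y₁ - y₂) x = 0 := by
    rw [← inner_jetOne_none, inner_sub_left, inner_jetOne_none, inner_jetOne_none, hy₁0, hy₂0,
      sub_zero]
  have hzero : ((y₁ - y₂ : L2T d) : Torus d → ℝ) =ᵐ[volume] 0 := by
    refine ae_eq_zero_of_trig (integrable_L2T _) fun φ hφ => ?_
    set c := ∫ x, φ x with hc
    have hφi : Integrable φ := integrable_of_continuous (continuous_of_mem (trig_le hφ))
    -- The right-hand sides `F` had zero mean; subtracting the mean of φ changes nothing, since `y₁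
    -- - y₂` has zero mean too.
    have hm := (smoothFun d).sub_mem (trig_le hφ) (const_mem c)
    have h1 := hmom ⟨_, hm⟩ (by
      simp only [Pi.sub_apply]
      rw [integral_sub hφi (integrable_const c), ← hc]
      simp)
    simp only [Pi.sub_apply, mul_sub] at h1
    rw [integral_sub (integrable_mul_continuous (integrable_L2T _)
      (continuous_of_mem (trig_le hφ))) ((integrable_L2T _).mul_const c), integral_mul_const,
      h0, zero_mul, sub_zero] at h1
    exact h1
  have hyy : y₁ = y₂ := sub_eq_zero.1 ((Lp.eq_zero_iff_ae_eq_zero).2 hzero)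
  rw [hyy] at hy₁
  exact hy₁.symm.trans hy₂

end Zhikov

/-! ### The theorem -/

theorem theorem1 (d : ℕ) (hd : 2 ≤ d) (b : Zhikov.Torus d → EuclideanSpace ℝ (Fin d))
    (hb : ∀ j, Zhikov.MemW1 (fun x => b x j) 1) (hdiv : Zhikov.WeaklyDivFree b) :
    -- bounded solutions of the homogeneous equation, with `∇u` in the sense of distributions
    (∀ u : Zhikov.Torus d → ℝ, MemLp u ∞ → ∫ x, u x = 0 →
      (∀ φ ∈ Zhikov.smoothFun d, Zhikov.weakForm b u φ = 0) → u =ᵐ[volume] 0) ∧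
    -- the same with an integrable weak gradient `g = ∇u`; this contains the case `u ∈ H^1`
    (∀ (u : Zhikov.Torus d → ℝ) (g : Fin d → Zhikov.Torus d → ℝ), MemLp u ∞ → ∫ x, u x = 0 →
      (∀ i, Integrable (g i) ∧ Zhikov.HasWeakPDeriv i u (g i)) →
      (∀ φ ∈ Zhikov.smoothFun d,
        ∫ x, ∑ i, (g i x + b x i * u x) * Zhikov.pderiv i φ x = 0) → u =ᵐ[volume] 0) ∧
    -- approximation solutions are unique
    (∀ p p' : ℝ≥0∞, p.HolderConjugate p' → MemLp b p →
      ∀ f : Zhikov.smoothFun d →ₗ[ℝ] ℝ, Zhikov.MemHMinusOne f →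
      ∀ u₁ u₂ : Zhikov.Torus d → ℝ, Zhikov.IsApproximationSolution p p' b f u₁ →
        Zhikov.IsApproximationSolution p p' b f u₂ → u₁ =ᵐ[volume] u₂) := by
  have hbi : ∀ j, Integrable fun x => b x j := fun j => memLp_one_iff_integrable.1 (hb j).1
  refine ⟨fun u hu h0 h => Zhikov.ae_eq_zero_of_weakForm hb hdiv hu h0 h,
    fun u g hu h0 hg h => Zhikov.ae_eq_zero_of_weakForm hb hdiv hu h0 fun φ hφ => ?_,
    fun p p' hp hbp f hf u₁ u₂ h₁ h₂ => ?_⟩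
  · rw [Zhikov.weakForm_eq_of_weak_gradient (hu.integrable le_top)
      (fun j => Zhikov.integrable_mul_of_memLp_top (hbi j) hu) hg hφ]
    exact h φ hφ
  · exact h₁.unique hb hdiv hbp.1 hf h₂
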